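/- **Setting.** Let $0<k_3<k_1$, $0<w_M<w_m$, $c_1=\sqrt{k_1}$, $c_3=\sqrt{k_3}$, and consider the system $$\partial_t w-\partial_x v=0,\qquad \partial_t v-\partial_x\sigma(w)=0,\qquad u=(v,w),$$ where $\sigma$ is continuous and piecewise affine: $\sigma(w)=k_1w$ for $w\le w_M$, $\sigma(w)=k_3w$ for $w\ge w_m$, and affine on $[w_M,w_m]$. Phase 1 is $\mathcal H_1=\{-1<w\le w_M\}$, phase 3 is $\mathcal H_3=\{w\ge w_m\}$. For a discontinuity with strains $w_-$ (left) and $w_+$ (right) put $e(w_-,w_+)=\int_{w_-}^{w_+}\{\sigma(y)-\tfrac12(\sigma(w_-)+\sigma(w_+))\}\,dy$. Let $\underline\psi(V)=\frac{k_1-k_3}{2}w_M\big(w_m-\frac{k_1-V^2}{k_3-V^2}w_M\big)$ and $\overline\psi(V)=\frac{k_1-k_3}{2}w_m\big(w_M-\frac{k_3-V^2}{k_1-V^2}w_m\big)$. The function $\phi$ on $(-c_3,c_3]$ is nondecreasing, of class $C^2$ on $(-c_3,0)$ and on $(0,c_3]$, has limits $\phi(0\pm)$, $\phi'(0\pm)$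 and $\phi'''(c_3-)$, satisfies $\phi(c_3-)=\overline\psi(c_3)$ and $\phi(V)\to-\infty$ as $V\to -c_3^+$, and $\underline\psi\le\phi\le 0$ on $(-c_3,0]$, $0\le\phi\le\overline\psi$ on $[0,c_3]$. The kinetic relation $e=\phi(V)$ is read at $V=0$ as $\phi(0-)\le e\le\phi(0+)$. **Riemann problem.** A Riemann solution with left state $u_\ell$ and right state $u_r$ is a self-similar fan of constant states satisfying the Rankine–Hugoniot relations, of one of these forms: (i) $u_\ell,u_r$ and the single intermediate state all in $\mathcal H_1$ (resp. all in $\mathcal H_3$), with contact discontinuities of speeds $\pm c_1$ (resp. $\pm c_3$); (ii) $u_\ell\in\mathcal H_1$, $u_r\in\mathcal H_3$, with a contact discontinuity of speed $-c_1$ from $u_\ell$ to $u_-\in\mathcal H_1$, a phase boundary of speed $V\in(-c_3,c_3)$ from $u_-$ to $u_+\in\mathcal H_3$ satisfying the kinetic relation $e(w_-,w_+)=\phi(V)$, and a contact discontinuity of speed $c_3$ from $u_+$ to $u_r$; (iii) $u_\ell\in\mathcal H_1$, $u_r\in\mathcal H_3$, with a contact discontinuity of speed $-c_1$ from $u_\ell$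 to $u_-\in\mathcal H_1$ and a phase boundary of speed $V\in[c_3,c_1)$ from $u_-$ to $u_r$. Let $u_L^*\in\mathcal H_1$, $u_R^*\in\mathcal H_3$ be constant states with $w_L^*<w_M$ and $w_R^*>w_m$ for which the Riemann problem is solved by a single phase boundary, of speed $V^*$, without contact discontinuities; if $V^*=c_3$, assume also $w_L^*=0$ and $w_R^*=\sqrt{\phi'(c_3)/c_3}$. **Glimm's scheme.** Let $u_0=u_L^0$ for $x<0$ and $u_0=u_R^0$ for $x>0$, with values in $\mathcal H_1\cup\mathcal H_3$. Fix $\lambda>c_1$ and a sequence $(a_n)_{n\ge1}$ equidistributed in $(-1,1)$. For $h>0$ put $\tau=h/\lambda$. The approximate solution $u^h$ is, at time $0$, the mean value of $u_0$ on each cell $[mh,(m+2)h)$, $m$ even. On the strip $n\tau\le t<(n+1)\tau$ it is given by the Riemann solutions centred at the points $x=mh$, $m+n$ even. At time $n\tau$, $n\ge1$, it is restarted from the constant values $u^h(n\tau-0,(m+1+a_n)h-0)$ on the cells $[mh,(m+2)h)$, $m+n$ even. **Theorem 4.1.** There is $\delta>0$, depending only on $k_1,k_3,w_M,w_m,\phi,u_L^*,u_R^*$,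 such that the following holds whenever $$\|u_L^0-u_L^*\|_{L^1(-\infty,0)}+TV_{(-\infty,0)}(u_L^0)+\|u_R^0-u_R^*\|_{L^1(0,\infty)}+TV_{(0,\infty)}(u_R^0)<\delta .$$ For every $\lambda>c_1$, every sequence $(a_n)$ equidistributed in $(-1,1)$ and every $h>0$, each Riemann problem met by the scheme has exactly one solution, and $u^h$ has a phase boundary $\chi^h:[0,\infty)\to\mathbb R$: for every $t\ge0$, $u^h(t,x)\in\mathcal H_1$ for $x<\chi^h(t)$ and $u^h(t,x)\in\mathcal H_3$ for $x>\chi^h(t)$, and $\chi^h$ is affine on each $[n\tau,(n+1)\tau)$, with constant slope there denoted $\dot\chi^h$. Moreover every sequence of positive mesh sizes tending to $0$ has a subsequence along which, for some Lipschitz function $\chi:[0,\infty)\to\mathbb R$ and some at most countable set $E\subset[0,\infty)$, $$\sup_{0\le t\le T}|\chi^h(t)-\chi(t)|\to0\quad\text{for all }T>0,$$ and, for every $t\in[0,\infty)\setminus E$, $\chi$ is differentiable at $t$ (from the right if $t=0$) and $\dot\chi^h(t)\to\frac{d\chi}{dt}(t)$. -/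

import Mathlib

open Set Filter Topology MeasureTheory

noncomputable section

/-- A state `u = (v, w)`: the velocity `v` is `u.1`, the deformation gradient `w` is `u.2`. -/
abbrev State := ℝ × ℝ

/-- The constants of a two-phase elastic material with piecewise linear stress. -/
structure Material where
  k₁ : ℝ
  k₃ : ℝ
  wM : ℝ
  wm : ℝ
  k₃_pos : 0 < k₃
  k₃_lt_k₁ : k₃ < k₁
  wM_pos : 0 < wM
  wM_lt_wm : wM < wm

namespace Material

/-- Sound speed in phase 1. -/
def c₁ (M : Material) : ℝ := √M.k₁

/-- Sound speed in phase 3. -/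
def c₃ (M : Material) : ℝ := √M.k₃

/-- The piecewise linear stress function `σ`. -/
def stress (M : Material) (w : ℝ) : ℝ :=
  if w ≤ M.wM then M.k₁ * w
  else if w ≤ M.wm then
    M.k₃ * M.wm + (M.k₁ * M.wM - M.k₃ * M.wm) * (w - M.wm) / (M.wM - M.wm)
  else M.k₃ * w

/-- The phase 1 region `-1 < w ≤ w_M`. -/
def phase1 (M : Material) : Set State := {u | -1 < u.2 ∧ u.2 ≤ M.wM}

/-- The phase 3 region `w ≥ w_m`. -/
def phase3 (M : Material) : Set State := {u | M.wm ≤ u.2}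

/-- The minimal entropy dissipation function, used for `-c₃ < V ≤ 0`. -/
def psiMin (M : Material) (V : ℝ) : ℝ :=
  (M.k₁ - M.k₃) / 2 * M.wM * (M.wm - (M.k₁ - V ^ 2) / (M.k₃ - V ^ 2) * M.wM)

/-- The maximal entropy dissipation function, used for `0 ≤ V ≤ c₃`. -/
def psiMax (M : Material) (V : ℝ) : ℝ :=
  (M.k₁ - M.k₃) / 2 * M.wm * (M.wM - (M.k₃ - V ^ 2) / (M.k₁ - V ^ 2) * M.wm)

/-- The Rankine-Hugoniot relations, for `∂ₜ w - ∂ₓ v = 0`, `∂ₜ v - ∂ₓ σ(w) = 0`, of a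
discontinuity of speed `s` between the constant states `ul` (left) and `ur` (right). -/
def RankineHugoniot (M : Material) (s : ℝ) (ul ur : State) : Prop :=
  s * (ur.2 - ul.2) + (ur.1 - ul.1) = 0 ∧
  s * (ur.1 - ul.1) + (M.stress ur.2 - M.stress ul.2) = 0

/-- `∫ (σ(y) - (σ(w₋) + σ(w₊)) / 2) dy` over `y` from `w₋` to `w₊`: minus the entropy dissipation
rate of a discontinuity between the strains `w₋` (left) and `w₊` (right). -/
def drivingForce (M : Material) (wl wr : ℝ) : ℝ :=
  ∫ y in wl..wr, (M.stress y - (M.stress wl + M.stress wr) / 2)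

end Material

/-- The standing assumptions on the entropy dissipation function `φ` on `(-c₃, c₃]`. -/
structure IsDissipationFunction (M : Material) (φ : ℝ → ℝ) : Prop where
  contDiff_neg : ContDiffOn ℝ 2 φ (Ioo (-M.c₃) 0)
  contDiff_pos : ContDiffOn ℝ 2 φ (Ioc 0 M.c₃)
  lim_zero_left : ∃ l, Tendsto φ (𝓝[<] 0) (𝓝 l)
  lim_zero_right : ∃ l, Tendsto φ (𝓝[>] 0) (𝓝 l)
  deriv_lim_zero_left : ∃ l, Tendsto (deriv φ) (𝓝[<] 0) (𝓝 l)
  deriv_lim_zero_right : ∃ l, Tendsto (deriv φ) (𝓝[>] 0) (𝓝 l)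
  lim_c₃ : Tendsto φ (𝓝[<] M.c₃) (𝓝 (M.psiMax M.c₃))
  differentiable_near_c₃ : ∀ᶠ V in 𝓝[<] M.c₃, DifferentiableAt ℝ (iteratedDeriv 2 φ) V
  third_deriv_lim_c₃ : ∃ l, Tendsto (iteratedDeriv 3 φ) (𝓝[<] M.c₃) (𝓝 l)
  lim_neg_c₃ : Tendsto φ (𝓝[>] (-M.c₃)) atBot
  monotone : MonotoneOn φ (Ioc (-M.c₃) M.c₃)
  bounds_neg : ∀ V ∈ Ioc (-M.c₃) 0, M.psiMin V ≤ φ V ∧ φ V ≤ 0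
  bounds_pos : ∀ V ∈ Icc 0 M.c₃, 0 ≤ φ V ∧ φ V ≤ M.psiMax V

/-- The kinetic relation `e = φ(V)`. Since `φ` may jump at `0`, its graph is completed there by
the vertical segment from `φ(0-)` to `φ(0+)`. -/
def KineticRelation (φ : ℝ → ℝ) (V e : ℝ) : Prop :=
  (V ≠ 0 → e = φ V) ∧
  (V = 0 → Function.leftLim φ 0 ≤ e ∧ e ≤ Function.rightLim φ 0)

/-- The intermediate states `um`, `up` and the wave speeds of a self-similar fan of the form
left state, (speed `sl`), `um`, (speed `V`), `up`, (speed `sr`), right state. -/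
structure Fan where
  um : State
  up : State
  sl : ℝ
  V : ℝ
  sr : ℝ

instance : Nonempty Fan := ⟨⟨0, 0, 0, 0, 0⟩⟩

/-- The value at `(t, x)` of the fan issued from the origin, normalised to be left-continuous
in `x`. -/
def Fan.eval (F : Fan) (ul ur : State) (t x : ℝ) : State :=
  if x ≤ F.sl * t then ul
  else if x ≤ F.V * t then F.um
  else if x ≤ F.sr * t then F.up
  else ur

/-- `IsRiemannSolution M φ ul ur F`: the fan `F` is the admissible solution of the Riemann problem
with left state `ul` and right state `ur`, in one of the following four configurations.
* `phase1`, `phase3`: both data and the solution lie in one phase; two contact discontinuities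
  (here `um = up`, and the middle speed `0` carries no wave).
* `subsonic`: `ul` in phase 1, `ur` in phase 3; a contact discontinuity of speed `-c₁`, a phase
  boundary of speed `V` in `(-c₃, c₃)` obeying the kinetic relation, and a contact discontinuity
  of speed `c₃`.
* `supersonic`: `ul` in phase 1, `ur` in phase 3; a contact discontinuity of speed `-c₁` and a
  phase boundary of speed `V` in `[c₃, c₁)`, with `ur` on its right. -/
inductive IsRiemannSolution (M : Material) (φ : ℝ → ℝ) (ul ur : State) : Fan → Prop
  | phase1 (u : State) (hl : ul ∈ M.phase1) (hr : ur ∈ M.phase1) (hu : u ∈ M.phase1)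
      (h1 : M.RankineHugoniot (-M.c₁) ul u) (h2 : M.RankineHugoniot M.c₁ u ur) :
      IsRiemannSolution M φ ul ur ⟨u, u, -M.c₁, 0, M.c₁⟩
  | phase3 (u : State) (hl : ul ∈ M.phase3) (hr : ur ∈ M.phase3) (hu : u ∈ M.phase3)
      (h1 : M.RankineHugoniot (-M.c₃) ul u) (h2 : M.RankineHugoniot M.c₃ u ur) :
      IsRiemannSolution M φ ul ur ⟨u, u, -M.c₃, 0, M.c₃⟩
  | subsonic (um up : State) (V : ℝ) (hl : ul ∈ M.phase1) (hr : ur ∈ M.phase3)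
      (hm : um ∈ M.phase1) (hp : up ∈ M.phase3) (hV : V ∈ Ioo (-M.c₃) M.c₃)
      (h1 : M.RankineHugoniot (-M.c₁) ul um) (h2 : M.RankineHugoniot V um up)
      (h3 : M.RankineHugoniot M.c₃ up ur)
      (hk : KineticRelation φ V (M.drivingForce um.2 up.2)) :
      IsRiemannSolution M φ ul ur ⟨um, up, -M.c₁, V, M.c₃⟩
  | supersonic (um : State) (V : ℝ) (hl : ul ∈ M.phase1) (hr : ur ∈ M.phase3)
      (hm : um ∈ M.phase1) (hV : V ∈ Ico M.c₃ M.c₁)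
      (h1 : M.RankineHugoniot (-M.c₁) ul um) (h2 : M.RankineHugoniot V um ur) :
      IsRiemannSolution M φ ul ur ⟨um, ur, -M.c₁, V, V⟩

/-- The solution of the Riemann problem (an arbitrary fan if there is none). -/
def riemann (M : Material) (φ : ℝ → ℝ) (ul ur : State) : Fan :=
  Classical.epsilon (IsRiemannSolution M φ ul ur)

/-- `a 1, a 2, …` is equidistributed in `(-1, 1)`; the value `a 0` is not used. -/
def IsEquidistributed (a : ℕ → ℝ) : Prop :=
  (∀ n, 1 ≤ n → a n ∈ Ioo (-1 : ℝ) 1) ∧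
  ∀ α β : ℝ, -1 ≤ α → α < β → β ≤ 1 →
    Tendsto (fun N : ℕ => (((Finset.Icc 1 N).filter (fun n => a n ∈ Ico α β)).card : ℝ) / N)
      atTop (𝓝 ((β - α) / 2))

/-- The data equal to `uL` for `x < 0` and to `uR` for `x > 0`. -/
def cauchyData (uL uR : ℝ → State) (x : ℝ) : State := if x < 0 then uL x else uR x

/-- The norm `‖f‖_{L¹(s)} + TV_s(f)`. -/
def bvNorm (f : ℝ → State) (s : Set ℝ) : ENNReal :=
  (∫⁻ x in s, ‖f x‖ₑ) + eVariationOn f s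

/-- The values of Glimm's scheme with space mesh `h` and time mesh `τ = h / lam`.
For `m + n` even, `glimmGrid M φ u₀ lam a h n m` is the constant value of the approximate solution
at time `nτ + 0` on the cell `[mh, (m+2)h)`. At time `0` it is the mean value of the data; at time
`(n+1)τ` it is the value at `(m + 1 + a (n+1)) h - 0` of the Riemann fan issued from the point
`(nτ, (m+1)h)`. The entries with `m + n` odd are never used. -/
def glimmGrid (M : Material) (φ : ℝ → ℝ) (u₀ : ℝ → State) (lam : ℝ) (a : ℕ → ℝ) (h : ℝ) :
    ℕ → ℤ → State
  | 0, m => (1 / (2 * h)) • ∫ y in (m * h : ℝ)..((m + 2) * h : ℝ), u₀ y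
  | n + 1, m =>
      (riemann M φ (glimmGrid M φ u₀ lam a h n (m - 1)) (glimmGrid M φ u₀ lam a h n (m + 1))).eval
        (glimmGrid M φ u₀ lam a h n (m - 1)) (glimmGrid M φ u₀ lam a h n (m + 1))
        (h / lam) (a (n + 1) * h)

/-- The approximate solution on the strip `nτ ≤ t < (n+1)τ`. For `t = nτ` it is constant on the
cells `[mh, (m+2)h)` with `m + n` even; for `t > nτ` it is, on `[(m-1)h, (m+1)h)` with `m + n` even,
the Riemann fan issued from `(nτ, mh)`. -/
def glimmStrip (M : Material) (φ : ℝ → ℝ) (u₀ : ℝ → State) (lam : ℝ) (a : ℕ → ℝ) (h : ℝ)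
    (n : ℕ) (t x : ℝ) : State :=
  if t = n * (h / lam) then
    glimmGrid M φ u₀ lam a h n (n + 2 * ⌊(x / h - n) / 2⌋)
  else
    let m : ℤ := n + 2 * ⌊(x / h + 1 - n) / 2⌋
    (riemann M φ (glimmGrid M φ u₀ lam a h n (m - 2)) (glimmGrid M φ u₀ lam a h n m)).eval
      (glimmGrid M φ u₀ lam a h n (m - 2)) (glimmGrid M φ u₀ lam a h n m)
      (t - n * (h / lam)) (x - m * h)

/-- The approximate solution `u^h` of Glimm's scheme, for `t ≥ 0`. -/
def glimmSolution (M : Material) (φ : ℝ → ℝ) (u₀ : ℝ → State) (lam : ℝ) (a : ℕ → ℝ) (h : ℝ)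
    (t x : ℝ) : State :=
  glimmStrip M φ u₀ lam a h ⌊t / (h / lam)⌋₊ t x

/-- `χ` is the phase boundary of `u`: at each time `t ≥ 0` the states on its left lie in phase 1 and
those on its right in phase 3; in each time slab `[nτ, (n+1)τ)` the curve is affine, and `speed` is
its constant slope there. These requirements determine `χ` and `speed` on `[0, ∞)` uniquely. -/
structure IsPhaseBoundary (M : Material) (u : ℝ → ℝ → State) (τ : ℝ) (χ speed : ℝ → ℝ) : Prop where
  left : ∀ t, 0 ≤ t → ∀ x, x < χ t → u t x ∈ M.phase1
  right : ∀ t, 0 ≤ t → ∀ x, χ t < x → u t x ∈ M.phase3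
  affine : ∀ n : ℕ, ∀ t ∈ Ico (n * τ) ((n + 1) * τ),
    speed t = speed (n * τ) ∧ χ t = χ (n * τ) + speed (n * τ) * (t - n * τ)

end

/-! Inside each phase the system is linear, so the Riemann invariants p = v - c₁w, q = v + c₁w of
phase 1 and r = v - c₃w, s = v + c₃w of phase 3 are merely transported, and sampling moves their
values from cell to cell unchanged. Waves interact only at the phase boundary, which receives p from
the left and s from the right. The Rankine–Hugoniot relations express both strains at the boundary
through its speed V and the incoming jump D = s - p (`rankineHugoniot_boundary_iff`), and the sign
of D separates the regimes: subsonic for D > 0, supersonic for D ≤ 0. For D > 0 the driving force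
strictly decreases in V while φ is nondecreasing, so at most one speed obeys the kinetic relation
(`kinetic_speed_unique`). For D ≤ 0 the speed is an explicit function of D and the right strain.

Near the reference states the subsonic speed and right strain are Lipschitz in D
(`exists_localSolver`). If the reference jump is positive, monotonicity of φ suffices. If it is
zero, the formula for the right strain degenerates to 0/0. The kinetic relation then gives the
squared right strain as the difference quotient of φ at c₃ times a smooth factor, with limit
φ'(c₃)/c₃, so the assumption on the characteristic case is exactly continuity of the strain.

The invariants p and s are never created by the boundary, so they stay in the small box where they
start. The emitted q and r then stay in boxes of proportional size (`exists_stableBox`,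
`step_inBox`), and all Riemann problems remain uniquely and explicitly solvable.

The jump D has total variation in time bounded by the initial variations of p and s. A subsonic
speed depends on D only. A supersonic speed depends also on r, whose waves the boundary may have
emitted earlier, but this dependence carries the factor max(-D, 0). The product of this factor with
the variation of r does not grow by emission, which needs D > 0, pays for absorption, and otherwise
grows by at most a constant times |ΔD| (`sum_absorbed_le`). Hence the boundary speeds have bounded
variation in time, uniformly in h (`exists_sum_speed_le`).

Helly's theorem gives a limit speed off a countable set, and χ is its integral. The distance between
the sampled front and the integral of its own speed is a discrepancy sum of the sequence (a_n).
Equidistribution makes it tend to zero, uniformly over thresholds of bounded variation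
(`exists_mesh_le`, `exists_subseq_front_tendsto`). -/

/-! ### Compactness of monotone functions and of step functions of bounded variation. -/

/-- Helly's selection theorem for uniformly bounded monotone functions. -/
theorem exists_subseq_tendsto_of_monotone {F : ℕ → ℝ → ℝ} {C : ℝ} (hF : ∀ j, Monotone (F j))
    (hC : ∀ j t, F j t ∈ Icc (-C) C) :
    ∃ ι : ℕ → ℕ, StrictMono ι ∧ ∃ (G : ℝ → ℝ) (E : Set ℝ), E.Countable ∧
      ∀ t ∉ E, ContinuousAt G t ∧ Tendsto (fun j => F (ι j) t) atTop (𝓝 (G t)) := by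
  obtain ⟨g, -, ι, hι, hg⟩ := (isCompact_univ_pi (fun _ : ℚ => isCompact_Icc (a := -C) (b := C))
    ).tendsto_subseq (x := fun j (q : ℚ) => F j q) (fun j q _ => hC j q)
  rw [tendsto_pi_nhds] at hg
  have hgm : ∀ p q : ℚ, p ≤ q → g p ≤ g q := fun p q hpq =>
    le_of_tendsto_of_tendsto' (hg p) (hg q) (fun j => hF _ (by exact_mod_cast hpq))
  -- The limit along the rationals is extended to a monotone function on the line; its
  -- discontinuities form the exceptional countable set.
  set G : ℝ → ℝ := fun t => sSup (g '' {q : ℚ | (q : ℝ) < t}) with hG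
  have hbdd : ∀ t, BddAbove (g '' {q : ℚ | (q : ℝ) < t}) := by
    intro t
    obtain ⟨p, hp⟩ := exists_rat_gt t
    refine ⟨g p, ?_⟩
    rintro _ ⟨q, hq, rfl⟩
    exact hgm q p (by exact_mod_cast (lt_trans hq hp).le)
  have hne : ∀ t, (g '' {q : ℚ | (q : ℝ) < t}).Nonempty := by
    intro t
    obtain ⟨p, hp⟩ := exists_rat_lt t
    exact ⟨g p, p, hp, rfl⟩
  have hle1 : ∀ (q : ℚ) t, (q : ℝ) < t → g q ≤ G t := fun q t h =>
    le_csSup (hbdd t) ⟨q, h, rfl⟩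
  have hle2 : ∀ (q : ℚ) t, t ≤ (q : ℝ) → G t ≤ g q := fun q t h => by
    refine csSup_le (hne t) ?_
    rintro _ ⟨p, hp, rfl⟩
    exact hgm p q (by exact_mod_cast (lt_of_lt_of_le hp h).le)
  have hGm : Monotone G := fun s t hst =>
    csSup_le_csSup (hbdd t) (hne s) (image_mono fun q hq => lt_of_lt_of_le hq hst)
  refine ⟨ι, hι, G, {t | ¬ ContinuousAt G t}, hGm.countable_not_continuousAt, fun t ht => ?_⟩
  have hcont : ContinuousAt G t := by simpa using ht
  refine ⟨hcont, ?_⟩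
  rw [Metric.tendsto_atTop]
  intro ε hε
  obtain ⟨η, hη, hηG⟩ := Metric.continuousAt_iff.1 hcont (ε / 2) (by positivity)
  -- At a continuity point, rationals on both sides trap the sequence by monotonicity, at the cost
  -- of the small oscillation of `G`.
  obtain ⟨q1, h11, h12⟩ := exists_rat_btwn (show t - η / 2 < t by linarith)
  obtain ⟨q2, h21, h22⟩ := exists_rat_btwn (show t < t + η / 2 by linarith)
  have e1 := hηG (x := t - η / 2) (by rw [Real.dist_eq, abs_lt]; constructor <;> linarith)
  have e2 := hηG (x := t + η / 2) (by rw [Real.dist_eq, abs_lt]; constructor <;> linarith)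
  rw [Real.dist_eq, abs_lt] at e1 e2
  have f1 := hle2 q1 (t - η / 2) h11.le
  have f2 := hle1 q2 (t + η / 2) h22
  obtain ⟨N1, hN1⟩ := Metric.tendsto_atTop.1 (hg q1) (ε / 2) (by positivity)
  obtain ⟨N2, hN2⟩ := Metric.tendsto_atTop.1 (hg q2) (ε / 2) (by positivity)
  refine ⟨max N1 N2, fun n hn => ?_⟩
  have g1 := hN1 n (le_trans (le_max_left _ _) hn)
  have g2 := hN2 n (le_trans (le_max_right _ _) hn)
  simp only [Function.comp, Real.dist_eq, abs_lt] at g1 g2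
  have m1 := hF (ι n) h12.le
  have m2 := hF (ι n) h21.le
  rw [Real.dist_eq, abs_lt]
  constructor <;> linarith [g1.1, g1.2, g2.1, g2.2]

/-- Helly's selection theorem for step functions of uniformly bounded variation. -/
theorem exists_subseq_tendsto_of_step {x : ℕ → ℕ → ℝ} {τ : ℕ → ℝ} (hτ : ∀ j, 0 < τ j) {B C : ℝ}
    (hB : ∀ j, |x j 0| ≤ B) (hC : ∀ j N, ∑ n ∈ Finset.range N, |x j (n + 1) - x j n| ≤ C) :
    ∃ ι : ℕ → ℕ, StrictMono ι ∧ ∃ (G : ℝ → ℝ) (E : Set ℝ), E.Countable ∧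
      ∀ t ∉ E, ContinuousAt G t ∧
        Tendsto (fun j => x (ι j) ⌊t / τ (ι j)⌋₊) atTop (𝓝 (G t)) := by
  -- Jordan decomposition into positive and negative variations, each monotone and bounded by `C`.
  set P : ℕ → ℕ → ℝ := fun j N => ∑ n ∈ Finset.range N, max (x j (n + 1) - x j n) 0 with hP
  set Q : ℕ → ℕ → ℝ := fun j N => ∑ n ∈ Finset.range N, max (-(x j (n + 1) - x j n)) 0 with hQ
  have hfloor : ∀ j, Monotone fun t : ℝ => ⌊t / τ j⌋₊ := fun j s t hst =>
    Nat.floor_mono (div_le_div_of_nonneg_right hst (hτ j).le)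
  have hPm : ∀ j, Monotone (P j) := fun j => monotone_nat_of_le_succ fun n => by
    simp only [hP, Finset.sum_range_succ]; linarith [le_max_right (x j (n + 1) - x j n) 0]
  have hQm : ∀ j, Monotone (Q j) := fun j => monotone_nat_of_le_succ fun n => by
    simp only [hQ, Finset.sum_range_succ]; linarith [le_max_right (-(x j (n + 1) - x j n)) 0]
  have hP0 : ∀ j N, 0 ≤ P j N := fun j N => Finset.sum_nonneg fun n _ => le_max_right _ _
  have hQ0 : ∀ j N, 0 ≤ Q j N := fun j N => Finset.sum_nonneg fun n _ => le_max_right _ _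
  have hPC : ∀ j N, P j N ≤ C := fun j N => le_trans
    (Finset.sum_le_sum fun n _ => max_le (le_abs_self _) (abs_nonneg _)) (hC j N)
  have hQC : ∀ j N, Q j N ≤ C := fun j N => le_trans
    (Finset.sum_le_sum fun n _ => max_le (neg_le_abs _) (abs_nonneg _)) (hC j N)
  have hx : ∀ j N, x j N = x j 0 + P j N - Q j N := by
    intro j N
    have h1 : P j N - Q j N = ∑ n ∈ Finset.range N, (x j (n + 1) - x j n) := by
      rw [hP, hQ]; simp only; rw [← Finset.sum_sub_distrib]
      exact Finset.sum_congr rfl fun n _ => by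
        rcases le_total (x j (n + 1) - x j n) 0 with h | h
        · rw [max_eq_right h, max_eq_left (by linarith)]; ring
        · rw [max_eq_left h, max_eq_right (by linarith)]; ring
    rw [Finset.sum_range_sub] at h1
    linarith
  have hB0 : 0 ≤ B := le_trans (abs_nonneg _) (hB 0)
  obtain ⟨ι₁, hι₁, G₁, E₁, hE₁, h₁⟩ := exists_subseq_tendsto_of_monotone (C := B + C)
    (F := fun j t => x j 0 + P j ⌊t / τ j⌋₊) (fun j s t hst => by
      have := hPm j (hfloor j hst); simp only at this ⊢; linarith)
    (fun j t => by
      have := abs_le.1 (hB j)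
      have h0 := hP0 j ⌊t / τ j⌋₊
      have h2 := hPC j ⌊t / τ j⌋₊
      simp only [mem_Icc]; constructor <;> linarith)
  obtain ⟨ι₂, hι₂, G₂, E₂, hE₂, h₂⟩ := exists_subseq_tendsto_of_monotone (C := C)
    (F := fun j t => Q (ι₁ j) ⌊t / τ (ι₁ j)⌋₊) (fun j s t hst => hQm _ (hfloor _ hst))
    (fun j t => by
      have h0 := hQ0 (ι₁ j) ⌊t / τ (ι₁ j)⌋₊
      have h2 := hQC (ι₁ j) ⌊t / τ (ι₁ j)⌋₊
      simp only [mem_Icc]; constructor <;> linarith)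
  refine ⟨ι₁ ∘ ι₂, hι₁.comp hι₂, fun t => G₁ t - G₂ t, E₁ ∪ E₂, hE₁.union hE₂, fun t ht => ?_⟩
  rw [mem_union, not_or] at ht
  refine ⟨(h₁ t ht.1).1.sub (h₂ t ht.2).1, ?_⟩
  have := ((h₁ t ht.1).2.comp hι₂.tendsto_atTop).sub (h₂ t ht.2).2
  exact this.congr fun j => (hx (ι₁ (ι₂ j)) _).symm

/-! ### Discrepancy of an equidistributed sequence with moving thresholds. -/

/-- The centred indicator of `a (n + 1) ≤ α`. -/
noncomputable def centredIndicator (a : ℕ → ℝ) (n : ℕ) (α : ℝ) : ℝ :=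
  (if a (n + 1) ≤ α then 1 else 0) - (α + 1) / 2

/-- Uniformity in the threshold comes from monotonicity of the counting function: control at
finitely many equally spaced thresholds controls all those between them. The finitely many initial
`N` are absorbed in `C`. -/
theorem IsEquidistributed.sum_centredIndicator_le {a : ℕ → ℝ} (ha : IsEquidistributed a) {ε : ℝ}
    (hε : 0 < ε) : ∃ C : ℝ, 0 ≤ C ∧ ∀ N : ℕ, ∀ α ∈ Ioo (-1 : ℝ) 1,
      |∑ n ∈ Finset.range N, centredIndicator a n α| ≤ ε * N + C := by
  obtain ⟨K, hK⟩ := exists_nat_gt (2 / ε)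
  have hK0 : (0 : ℝ) < K := lt_trans (by positivity) hK
  have hKε : 1 / (K : ℝ) ≤ ε / 2 := by
    rw [div_le_div_iff₀ hK0 two_pos]
    rw [div_lt_iff₀ hε] at hK
    linarith
  set c : ℝ → ℕ → ℝ := fun β N =>
    (((Finset.Icc 1 N).filter (fun n => a n ∈ Ico (-1) β)).card : ℝ) with hc
  have hev : ∀ᶠ N : ℕ in atTop, ∀ i ∈ Finset.range (K + 1),
      |c (-1 + 2 * i / K) N - N * (i / K)| ≤ ε / 2 * N := by
    rw [Filter.eventually_all_finset]
    intro i hi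
    rcases Nat.eq_zero_or_pos i with rfl | hi0
    -- The leftmost threshold gives an empty interval, which the definition of equidistribution
    -- leaves out.
    · refine Eventually.of_forall fun N => ?_
      have : 0 ≤ ε / 2 * (N : ℝ) := by positivity
      have h0 : c (-1 + 2 * (0 : ℕ) / K) N = 0 := by
        simp only [hc, Nat.cast_eq_zero, Finset.card_eq_zero, Finset.filter_eq_empty_iff]
        intro n _ hn
        simp only [Nat.cast_zero, mul_zero, zero_div, add_zero, Ico_self, mem_empty_iff_false] at hn
      rw [h0]
      simpa using this
    · have hi0' : (0 : ℝ) < i := by exact_mod_cast hi0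
      have hiK : (i : ℝ) ≤ K := by
        have := Finset.mem_range.1 hi; exact_mod_cast Nat.lt_succ_iff.1 this
      have h1 : 0 < 2 * (i : ℝ) / K := by positivity
      have h2 : 2 * (i : ℝ) / K ≤ 2 := by rw [div_le_iff₀ hK0]; linarith
      have := ha.2 (-1) (-1 + 2 * i / K) le_rfl (by linarith) (by linarith)
      have h3 : ((-1 + 2 * (i : ℝ) / K) - -1) / 2 = i / K := by ring
      rw [h3] at this
      filter_upwards [(Metric.tendsto_nhds.1 this) (ε / 2) (by positivity),
        eventually_gt_atTop 0] with N hN hN0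
      have hN0' : (0 : ℝ) < N := by exact_mod_cast hN0
      rw [Real.dist_eq] at hN
      have h4 : c (-1 + 2 * i / K) N - N * (i / K)
        = N * (c (-1 + 2 * i / K) N / N - i / K) := by field_simp
      rw [h4, abs_mul, abs_of_pos hN0', mul_comm]
      exact mul_le_mul_of_nonneg_right hN.le hN0'.le
  obtain ⟨N0, hN0⟩ := eventually_atTop.1 hev
  refine ⟨N0, by positivity, fun N α hα => ?_⟩
  have hcount : ∑ n ∈ Finset.range N, centredIndicator a n α
      = (((Finset.Icc 1 N).filter (fun n => a n ≤ α)).card : ℝ) - N * ((α + 1) / 2) := by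
    simp only [centredIndicator, Finset.sum_sub_distrib, Finset.sum_const, Finset.card_range,
      nsmul_eq_mul]
    congr 1
    rw [Finset.card_filter]
    push_cast
    rw [Finset.range_eq_Ico, Finset.sum_Ico_add' (fun n => if a n ≤ α then (1 : ℝ) else 0) 0 N 1]
    rfl
  have hle : ∀ β, α < β → (((Finset.Icc 1 N).filter (fun n => a n ≤ α)).card : ℝ) ≤ c β N := by
    intro β hβ
    refine Nat.cast_le.2 ?_
    refine Finset.card_le_card fun n hn => ?_
    rw [Finset.mem_filter] at hn ⊢
    exact ⟨hn.1, (ha.1 n (Finset.mem_Icc.1 hn.1).1).1.le, lt_of_le_of_lt hn.2 hβ⟩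
  have hge : ∀ β, β ≤ α → c β N ≤ (((Finset.Icc 1 N).filter (fun n => a n ≤ α)).card : ℝ) := by
    intro β hβ
    refine Nat.cast_le.2 ?_
    refine Finset.card_le_card fun n hn => ?_
    rw [Finset.mem_filter] at hn ⊢
    exact ⟨hn.1, (lt_of_lt_of_le hn.2.2 hβ).le⟩
  rcases le_or_gt N0 N with hN | hN
  · set i := ⌊(α + 1) * K / 2⌋₊ with hi
    have hnn : 0 ≤ (α + 1) * K / 2 := by
      have := hα.1; have : 0 < α + 1 := by linarith
      positivity
    have hi1 : (i : ℝ) ≤ (α + 1) * K / 2 := Nat.floor_le hnn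
    have hi2 : (α + 1) * K / 2 < i + 1 := Nat.lt_floor_add_one _
    have hiK : i < K := by
      have : (i : ℝ) < K := lt_of_le_of_lt hi1 (by nlinarith [hα.2])
      exact_mod_cast this
    have h1 := hN0 N hN i (Finset.mem_range.2 (by omega))
    have h2 := hN0 N hN (i + 1) (Finset.mem_range.2 (by omega))
    have h3 := hge (-1 + 2 * i / K) (by
      have : 2 * (i : ℝ) / K ≤ α + 1 := by rw [div_le_iff₀ hK0]; linarith
      linarith)
    have h4 := hle (-1 + 2 * (i + 1 : ℕ) / K) (by
      have : α + 1 < 2 * ((i + 1 : ℕ) : ℝ) / K := by rw [lt_div_iff₀ hK0]; push_cast; linarith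
      linarith)
    rw [abs_le] at h1 h2
    have hNn : (0 : ℝ) ≤ N := by positivity
    have h5 : (i : ℝ) / K ≤ (α + 1) / 2 := by rw [div_le_iff₀ hK0]; linarith
    have h6 : (α + 1) / 2 ≤ (i : ℝ) / K + 1 / K := by
      rw [← add_div, le_div_iff₀ hK0]; linarith
    have h7 : ((i + 1 : ℕ) : ℝ) / K = (i : ℝ) / K + 1 / K := by push_cast; ring
    rw [h7] at h2
    have h8 := mul_le_mul_of_nonneg_left h5 hNn
    have h9 := mul_le_mul_of_nonneg_left h6 hNn
    have h10 := mul_le_mul_of_nonneg_left hKε hNn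
    rw [hcount, abs_le]
    have : (0 : ℝ) ≤ N0 := by positivity
    constructor <;> nlinarith
  · have hb : |∑ n ∈ Finset.range N, centredIndicator a n α| ≤ ∑ n ∈ Finset.range N, (1 : ℝ) := by
      refine le_trans (Finset.abs_sum_le_sum_abs _ _) (Finset.sum_le_sum fun n _ => ?_)
      have := hα.1
      have := hα.2
      rw [centredIndicator, abs_le]
      split_ifs <;> constructor <;> linarith
    simp only [Finset.sum_const, Finset.card_range, nsmul_eq_mul, mul_one] at hb
    have : (N : ℝ) ≤ N0 := by exact_mod_cast hN.le
    have : 0 ≤ ε * N := by positivity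
    linarith

/-- On a block the thresholds differ by at most their variation there. Since the indicator is
monotone in the threshold, replacing them by their maximum or minimum costs at most that variation
per term. A constant threshold is a difference of two initial sums. -/
theorem sum_centredIndicator_Ico_le {a : ℕ → ℝ} {ε C : ℝ} (hε : 0 ≤ ε)
    (h : ∀ N : ℕ, ∀ α ∈ Ioo (-1 : ℝ) 1, |∑ n ∈ Finset.range N, centredIndicator a n α| ≤ ε * N + C)
    {α : ℕ → ℝ} (hα : ∀ n, α n ∈ Ioo (-1 : ℝ) 1) {m n : ℕ} (hmn : m ≤ n) :
    |∑ k ∈ Finset.Ico m n, centredIndicator a k (α k)| ≤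
      2 * (ε * n + C) + (n - m) * ∑ k ∈ Finset.Ico m n, |α (k + 1) - α k| := by
  rcases hmn.eq_or_lt with rfl | hlt
  · have := (abs_nonneg _).trans (h m 0 (by simp))
    simp; linarith
  set v := ∑ k ∈ Finset.Ico m n, |α (k + 1) - α k| with hv
  have hv0 : 0 ≤ v := Finset.sum_nonneg fun _ _ => abs_nonneg _
  have hosc : ∀ i ∈ Finset.Ico m n, ∀ j ∈ Finset.Ico m n, α i - α j ≤ v := by
    have key : ∀ i j, m ≤ i → i ≤ j → j < n → |α j - α i| ≤ v := by
      intro i j hi hij hj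
      have h1 : α j - α i = ∑ k ∈ Finset.Ico i j, (α (k + 1) - α k) := by
        rw [Finset.sum_Ico_sub _ hij]
      rw [h1]
      refine le_trans (Finset.abs_sum_le_sum_abs _ _)
        (Finset.sum_le_sum_of_subset_of_nonneg ?_ fun _ _ _ => abs_nonneg _)
      exact Finset.Ico_subset_Ico hi hj.le
    intro i hi j hj
    rw [Finset.mem_Ico] at hi hj
    rcases le_total i j with hij | hij
    · linarith [(abs_le.1 (key i j hi.1 hij hj.2)).1]
    · linarith [(abs_le.1 (key j i hj.1 hij hi.2)).2]
  have hfix : ∀ β ∈ Ioo (-1 : ℝ) 1,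
      |∑ k ∈ Finset.Ico m n, centredIndicator a k β| ≤ 2 * (ε * n + C) := by
    intro β hβ
    rw [Finset.sum_Ico_eq_sub _ hmn]
    have h1 := h n β hβ
    have h2 := h m β hβ
    have h3 : ε * m ≤ ε * n := mul_le_mul_of_nonneg_left (by exact_mod_cast hmn) hε
    rw [abs_le] at *
    constructor <;> linarith [h1.1, h1.2, h2.1, h2.2]
  have hmono : ∀ k β γ, β ≤ γ → centredIndicator a k β ≤ centredIndicator a k γ + (γ - β) / 2 := by
    intro k β γ hβγ
    simp only [centredIndicator]
    split_ifs with h1 h2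
    · linarith
    · exact absurd (h1.trans hβγ) h2
    · linarith
    · linarith
  have hne : (Finset.Ico m n).Nonempty := Finset.nonempty_Ico.2 hlt
  obtain ⟨i, hi, hmax⟩ := Finset.exists_max_image (Finset.Ico m n) α hne
  obtain ⟨j, hj, hmin⟩ := Finset.exists_min_image (Finset.Ico m n) α hne
  have hcard : ((Finset.Ico m n).card : ℝ) = n - m := by
    rw [Nat.card_Ico, Nat.cast_sub hmn]
  have hnm : (0 : ℝ) ≤ n - m := by rw [← hcard]; positivity
  have up : ∑ k ∈ Finset.Ico m n, centredIndicator a k (α k) ≤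
      ∑ k ∈ Finset.Ico m n, (centredIndicator a k (α i) + v) :=
    Finset.sum_le_sum fun k hk => by
      have := hmono k _ _ (hmax k hk)
      linarith [hosc i hi k hk]
  have lo : ∑ k ∈ Finset.Ico m n, (centredIndicator a k (α j) - v) ≤
      ∑ k ∈ Finset.Ico m n, centredIndicator a k (α k) :=
    Finset.sum_le_sum fun k hk => by
      have := hmono k _ _ (hmin k hk)
      linarith [hosc k hk j hj]
  rw [Finset.sum_add_distrib, Finset.sum_const, nsmul_eq_mul, hcard] at up
  rw [Finset.sum_sub_distrib, Finset.sum_const, nsmul_eq_mul, hcard] at lo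
  have e1 := abs_le.1 (hfix _ (hα i))
  have e2 := abs_le.1 (hfix _ (hα j))
  rw [abs_le]
  constructor <;> linarith [e1.1, e1.2, e2.1, e2.2]

/-- The range is cut into blocks of length `B`, so that the variation is multiplied by `B` and not
by `N`. The price is one discrepancy bound per block. -/
theorem sum_centredIndicator_range_le {a : ℕ → ℝ} {ε C : ℝ} (hε : 0 ≤ ε) (hC : 0 ≤ C)
    (h : ∀ N : ℕ, ∀ α ∈ Ioo (-1 : ℝ) 1, |∑ n ∈ Finset.range N, centredIndicator a n α| ≤ ε * N + C)
    {α : ℕ → ℝ} (hα : ∀ n, α n ∈ Ioo (-1 : ℝ) 1) {B : ℕ} (hB : 0 < B) (N : ℕ) :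
    |∑ k ∈ Finset.range N, centredIndicator a k (α k)| ≤
      (N / B + 1) * (2 * (ε * N + C)) + B * ∑ k ∈ Finset.range N, |α (k + 1) - α k| := by
  have hB' : (0 : ℝ) < B := by exact_mod_cast hB
  induction N using Nat.strong_induction_on with
  | _ N ih =>
    rcases le_or_gt N B with hNB | hNB
    · have h1 := sum_centredIndicator_Ico_le hε h hα (Nat.zero_le N)
      rw [← Finset.range_eq_Ico] at h1
      have h2 : 0 ≤ ∑ k ∈ Finset.range N, |α (k + 1) - α k| :=
        Finset.sum_nonneg fun _ _ => abs_nonneg _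
      have h3 : ((N : ℝ) - (0 : ℕ)) ≤ B := by
        have : (N : ℝ) ≤ B := by exact_mod_cast hNB
        simpa using this
      have h4 := mul_le_mul_of_nonneg_right h3 h2
      have h5 : 0 ≤ (N / B : ℝ) * (2 * (ε * N + C)) := by positivity
      nlinarith
    -- Strong induction removes the last block.
    · have hlt : N - B < N := by omega
      have h0 := ih (N - B) hlt
      have h1 := sum_centredIndicator_Ico_le hε h hα hlt.le
      rw [← Finset.sum_range_add_sum_Ico (fun k => centredIndicator a k (α k)) hlt.le,
        ← Finset.sum_range_add_sum_Ico (fun k => |α (k + 1) - α k|) hlt.le]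
      have hcast : ((N - B : ℕ) : ℝ) = N - B := by rw [Nat.cast_sub hNB.le]
      rw [hcast] at h0 h1
      have h3 := abs_add_le (∑ k ∈ Finset.range (N - B), centredIndicator a k (α k))
        (∑ k ∈ Finset.Ico (N - B) N, centredIndicator a k (α k))
      have h4 : ((N : ℝ) - B) / B + 1 = N / B := by field_simp; ring
      rw [h4] at h0
      have h5 : (N / B : ℝ) * (2 * (ε * (N - B) + C)) ≤ (N / B) * (2 * (ε * N + C)) := by
        apply mul_le_mul_of_nonneg_left _ (by positivity)
        nlinarith
      linarith

/-! ### Convergence of fronts moved by random choice. -/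

theorem intervalIntegrable_step (x : ℕ → ℝ) {b τ : ℝ} (hx : ∀ n, |x n| ≤ b) (s t : ℝ) :
    IntervalIntegrable (fun s => x ⌊s / τ⌋₊) volume s t := by
  refine (intervalIntegrable_const (c := b)).mono_fun ?_ ?_
  · have h1 : Measurable fun s : ℝ => ⌊s / τ⌋₊ := Nat.measurable_floor.comp (measurable_id.div_const τ)
    exact ((measurable_from_nat (f := x)).comp h1).aestronglyMeasurable
  · refine Eventually.of_forall fun s => ?_
    have := hx ⌊s / τ⌋₊
    simp only [Real.norm_eq_abs]
    exact this.trans (le_abs_self b)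

theorem integral_step (x : ℕ → ℝ) {b τ : ℝ} (hτ : 0 < τ) (hx : ∀ n, |x n| ≤ b) {t : ℝ} (ht : 0 ≤ t) :
    ∫ s in (0 : ℝ)..t, x ⌊s / τ⌋₊ =
      τ * ∑ n ∈ Finset.range ⌊t / τ⌋₊, x n + x ⌊t / τ⌋₊ * (t - ⌊t / τ⌋₊ * τ) := by
  have hpiece : ∀ (n : ℕ) (u : ℝ), n * τ ≤ u → u ≤ (n + 1) * τ →
      ∫ s in (n * τ : ℝ)..u, x ⌊s / τ⌋₊ = x n * (u - n * τ) := by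
    intro n u h1 h2
    have : ∫ s in (n * τ : ℝ)..u, x ⌊s / τ⌋₊ = ∫ s in (n * τ : ℝ)..u, x n := by
      rw [intervalIntegral.integral_of_le h1, intervalIntegral.integral_of_le h1,
        integral_Ioc_eq_integral_Ioo, integral_Ioc_eq_integral_Ioo]
      refine setIntegral_congr_fun measurableSet_Ioo fun s hs => ?_
      have hs0 : (0 : ℝ) ≤ s / τ := div_nonneg (le_trans (by positivity) hs.1.le) hτ.le
      have : ⌊s / τ⌋₊ = n := by
        rw [Nat.floor_eq_iff hs0, le_div_iff₀ hτ, div_lt_iff₀ hτ]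
        exact ⟨hs.1.le, lt_of_lt_of_le hs.2 h2⟩
      simp only [this]
    rw [this, intervalIntegral.integral_const, smul_eq_mul, mul_comm]
  set N := ⌊t / τ⌋₊ with hN
  have hN1 : N * τ ≤ t := by
    have := Nat.floor_le (div_nonneg ht hτ.le); rwa [le_div_iff₀ hτ] at this
  have hN2 : t ≤ (N + 1) * τ := by
    have := Nat.lt_floor_add_one (t / τ); rw [div_lt_iff₀ hτ] at this; exact this.le
  have h1 := intervalIntegral.sum_integral_adjacent_intervals (μ := volume)
    (f := fun s => x ⌊s / τ⌋₊) (a := fun n : ℕ => (n : ℝ) * τ) (n := N)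
    (fun k _ => intervalIntegrable_step x hx _ _)
  have h2 := intervalIntegral.integral_add_adjacent_intervals (μ := volume)
    (intervalIntegrable_step x (τ := τ) hx 0 (N * τ)) (intervalIntegrable_step x (τ := τ) hx (N * τ) t)
  rw [← h2, hpiece N t hN1 hN2]
  simp only [Nat.cast_zero, zero_mul] at h1
  rw [← h1, Finset.mul_sum]
  congr 1
  refine Finset.sum_congr rfl fun n _ => ?_
  have := hpiece n ((n + 1 : ℕ) * τ) (by push_cast; nlinarith) (by push_cast; exact le_rfl)
  rw [this]; push_cast; ring

/-- The error between a front moved by random choice and the integral of its speed. -/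
theorem IsEquidistributed.exists_mesh_le {a : ℕ → ℝ} (ha : IsEquidistributed a) {T b η : ℝ}
    (hT : 0 ≤ T) (hb : 0 ≤ b) (hη : 0 < η) :
    ∃ h₀ > 0, ∀ h, 0 < h → h < h₀ → ∀ α : ℕ → ℝ, (∀ n, α n ∈ Ioo (-1 : ℝ) 1) →
      (∀ N, ∑ n ∈ Finset.range N, |α (n + 1) - α n| ≤ b) → ∀ N : ℕ, N * h ≤ T →
      |2 * h * ∑ n ∈ Finset.range N, centredIndicator a n (α n)| ≤ η := by
  -- The order of choices matters: `κ` is the physical length of a block and makes the variation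
  -- term small; it bounds the number of blocks by `ρ`; then `ε` is chosen against `ρ`; only then
  -- are `C` and the mesh bound available.
  set κ := η / (8 * (b + 1)) with hκ
  have hκ0 : 0 < κ := by positivity
  set ρ := T / κ + 1 with hρ
  have hρ0 : 0 < ρ := by positivity
  set ε := η / (16 * ρ * (T + 1)) with hε
  have hε0 : 0 < ε := by positivity
  obtain ⟨C, hC, hCe⟩ := ha.sum_centredIndicator_le hε0
  refine ⟨min (η / (16 * ρ * (C + 1))) (η / (8 * (b + 1))), by positivity, ?_⟩
  intro h hh hh0 α hα hTV N hN
  have hh1 := lt_of_lt_of_le hh0 (min_le_left _ _)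
  have hh2 := lt_of_lt_of_le hh0 (min_le_right _ _)
  rw [lt_div_iff₀ (by positivity)] at hh1 hh2
  set B := ⌈κ / h⌉₊ with hB
  have hB0 : 0 < B := Nat.ceil_pos.2 (by positivity)
  have hB0' : (0 : ℝ) < B := by exact_mod_cast hB0
  have hB1 : κ / h ≤ B := Nat.le_ceil _
  have hB2 : (B : ℝ) < κ / h + 1 := Nat.ceil_lt_add_one (by positivity)
  have hB1' : κ ≤ B * h := by rwa [div_le_iff₀ hh] at hB1
  have hB2' : B * h ≤ κ + h := by
    have := mul_le_mul_of_nonneg_right hB2.le hh.le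
    rwa [add_mul, div_mul_cancel₀ _ hh.ne', one_mul] at this
  have key := sum_centredIndicator_range_le hε0.le hC hCe hα hB0 N
  have hNB : (N : ℝ) / B + 1 ≤ ρ := by
    have : (N : ℝ) / B ≤ T / κ := by
      rw [div_le_div_iff₀ hB0' hκ0]
      have h1 : (N : ℝ) * κ ≤ N * (B * h) := mul_le_mul_of_nonneg_left hB1' (by positivity)
      have h2 : (N * h) * (B : ℝ) ≤ T * B := mul_le_mul_of_nonneg_right hN hB0'.le
      nlinarith
    linarith
  rw [abs_mul, abs_of_pos (by positivity : 0 < 2 * h)]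
  have t1 : h * ((N / B + 1) * (2 * (ε * N + C))) ≤ ρ * (2 * (ε * T + C * h)) := by
    have e1 : h * ((N / B + 1) * (2 * (ε * N + C))) = (N / B + 1) * (2 * (ε * (N * h) + C * h)) := by
      ring
    rw [e1]
    have e2 : ε * (N * h) ≤ ε * T := mul_le_mul_of_nonneg_left hN hε0.le
    gcongr
  have t2 : h * (B * ∑ k ∈ Finset.range N, |α (k + 1) - α k|) ≤ (κ + h) * b := by
    have e1 : h * (B * ∑ k ∈ Finset.range N, |α (k + 1) - α k|)
      = (B * h) * ∑ k ∈ Finset.range N, |α (k + 1) - α k| := by ring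
    rw [e1]
    exact mul_le_mul hB2' (hTV N) (Finset.sum_nonneg fun _ _ => abs_nonneg _) (by positivity)
  have t3 : h * |∑ k ∈ Finset.range N, centredIndicator a k (α k)| ≤ 
      ρ * (2 * (ε * T + C * h)) + (κ + h) * b := by
    have := mul_le_mul_of_nonneg_left key hh.le
    rw [mul_add] at this
    linarith
  have u1 : ρ * ε * (T + 1) * 16 = η := by rw [hε]; field_simp
  have u2 : κ * (8 * (b + 1)) = η := by rw [hκ]; field_simp
  have u3 : 0 ≤ ρ * ε := by positivity
  have u4 : 0 ≤ h * ρ := by positivity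
  nlinarith

/-- A front moved by random choice with speeds of uniformly bounded variation converges along a
subsequence, together with its speed. -/
theorem exists_subseq_front_tendsto {lam : ℝ} (hlam : 0 < lam) {a : ℕ → ℝ}
    (ha : IsEquidistributed a) {V : ℝ → ℕ → ℝ} {m : ℝ → ℕ → ℤ} {B : ℝ}
    (hV : ∀ h, 0 < h → ∀ n, |V h n| < lam)
    (hB : ∀ h, 0 < h → ∀ N, ∑ n ∈ Finset.range N, |V h (n + 1) - V h n| ≤ B)
    (hm0 : ∀ h, 0 < h → m h 0 = 0)
    (hm : ∀ h, 0 < h → ∀ n, m h (n + 1) = m h n + if lam * a (n + 1) ≤ V h n then 1 else -1)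
    {χh speedh : ℝ → ℝ → ℝ}
    (hχ : ∀ h, 0 < h → ∀ t, χh h t = m h ⌊t / (h / lam)⌋₊ * h +
      V h ⌊t / (h / lam)⌋₊ * (t - ⌊t / (h / lam)⌋₊ * (h / lam)))
    (hspeed : ∀ h, 0 < h → ∀ t, speedh h t = V h ⌊t / (h / lam)⌋₊)
    {hs : ℕ → ℝ} (hs0 : ∀ j, 0 < hs j) (hslim : Tendsto hs atTop (𝓝 0)) :
    ∃ ι : ℕ → ℕ, StrictMono ι ∧ ∃ (χ : ℝ → ℝ) (E : Set ℝ),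
      (∃ K : NNReal, LipschitzOnWith K χ (Ici 0)) ∧
      (∀ T : ℝ, 0 < T → TendstoUniformlyOn (fun j => χh (hs (ι j))) χ atTop (Icc 0 T)) ∧
      E ⊆ Ici 0 ∧ E.Countable ∧
      ∀ t ∈ Ici (0 : ℝ) \ E, DifferentiableWithinAt ℝ χ (Ici 0) t ∧
        Tendsto (fun j => speedh (hs (ι j)) t) atTop (𝓝 (derivWithin χ (Ici 0) t)) := by
  obtain ⟨ι, hι, G, E, hE, hG⟩ := exists_subseq_tendsto_of_step
    (x := fun j n => V (hs j) n) (τ := fun j => hs j / lam) (fun j => div_pos (hs0 j) hlam)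
    (B := lam) (C := B) (fun j => (hV _ (hs0 j) 0).le) (fun j N => hB _ (hs0 j) N)
  -- Modify the limit on the exceptional set, so that it is bounded everywhere.
  set X : ℕ → ℝ → ℝ := fun j t => V (hs (ι j)) ⌊t / (hs (ι j) / lam)⌋₊ with hX
  have hXb : ∀ j t, |X j t| ≤ lam := fun j t => (hV _ (hs0 _) _).le
  have hGb : ∀ t ∉ E, |G t| ≤ lam := fun t ht =>
    le_of_tendsto (hG t ht).2.abs (Eventually.of_forall fun j => hXb j t)
  have hEnull : volume E = 0 := hE.measure_zero _
  have hae : ∀ᵐ t ∂(volume : Measure ℝ), t ∉ E := measure_eq_zero_iff_ae_notMem.1 hEnull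
  have hXm : ∀ j, AEStronglyMeasurable (X j) volume := fun j => by
    have h1 : Measurable fun s : ℝ => ⌊s / (hs (ι j) / lam)⌋₊ :=
      Nat.measurable_floor.comp (measurable_id.div_const _)
    exact ((measurable_from_nat (f := V (hs (ι j)))).comp h1).aestronglyMeasurable
  have hXi : ∀ j s t, IntervalIntegrable (X j) volume s t := fun j s t =>
    intervalIntegrable_step _ (fun n => (hV _ (hs0 _) n).le) s t
  have hGm : AEStronglyMeasurable G volume :=
    aestronglyMeasurable_of_tendsto_ae atTop hXm (hae.mono fun t ht => (hG t ht).2)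
  have hGi : ∀ s t, IntervalIntegrable G volume s t := fun s t => by
    refine (intervalIntegrable_const (c := lam)).mono_fun hGm.restrict ?_
    refine ae_restrict_of_ae (hae.mono fun t ht => ?_)
    simp only [Real.norm_eq_abs, abs_of_pos hlam]
    exact hGb t ht
  set χ : ℝ → ℝ := fun t => ∫ s in (0 : ℝ)..t, G s with hχdef
  -- Off `E` the limit speed is continuous, so the fundamental theorem of calculus applies pointwise
  -- and not only almost everywhere.
  have hderiv : ∀ t ∈ Ici (0 : ℝ) \ E, HasDerivAt χ (G t) t := fun t ht =>
    intervalIntegral.integral_hasDerivAt_right (hGi 0 t)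
      (hGm.stronglyMeasurableAtFilter) (hG t ht.2).1
  have hB0 : 0 ≤ B := by simpa using hB 1 one_pos 0
  refine ⟨ι, hι, χ, E ∩ Ici 0, ⟨⟨lam, hlam.le⟩, ?_⟩, ?_, inter_subset_right,
    hE.mono inter_subset_left, ?_⟩
  · refine LipschitzOnWith.of_dist_le_mul fun s _ t _ => ?_
    rw [Real.dist_eq, Real.dist_eq, abs_sub_comm]
    simp only [hχdef]
    rw [intervalIntegral.integral_interval_sub_left (hGi 0 t) (hGi 0 s), abs_sub_comm s t]
    have := intervalIntegral.norm_integral_le_of_norm_le_const_ae (f := G) (a := s) (b := t)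
      (C := lam) (hae.mono fun t ht _ => by rw [Real.norm_eq_abs]; exact hGb t ht)
    rwa [Real.norm_eq_abs] at this
  · intro T hT
    -- Convergence of the speeds in L¹ on [0, T] makes their integrals converge uniformly in t.
    have hint : Tendsto (fun j => ∫ s in (0 : ℝ)..T, |X j s - G s|) atTop (𝓝 0) := by
      have := intervalIntegral.tendsto_integral_filter_of_dominated_convergence
        (μ := volume) (a := 0) (b := T) (l := (atTop : Filter ℕ)) (F := fun j s => |X j s - G s|)
        (f := fun _ => (0 : ℝ)) (fun _ => 2 * lam)
        (Eventually.of_forall fun j => ((hXm j).sub hGm).norm.restrict)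
        (Eventually.of_forall fun j => hae.mono fun t ht _ => by
          rw [Real.norm_eq_abs, abs_abs]
          exact (abs_sub _ _).trans (by linarith [hXb j t, hGb t ht]))
        intervalIntegrable_const
        (hae.mono fun t ht _ => by
          have := ((hG t ht).2.sub_const (G t)).abs
          simpa using this)
      simpa using this
    rw [Metric.tendstoUniformlyOn_iff]
    intro η hη
    -- The thresholds are the speeds divided by `lam`, hence `B / lam`; the bound `N * τ ≤ T` reads
    -- `N * h ≤ T * lam`.
    obtain ⟨h₀, hh₀, hmesh⟩ := ha.exists_mesh_le (T := T * lam) (b := B / lam) (η := η / 2)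
      (by positivity) (by positivity) (by positivity)
    filter_upwards [(hslim.comp hι.tendsto_atTop).eventually (gt_mem_nhds hh₀),
      hint.eventually (gt_mem_nhds (show 0 < η / 2 by positivity))] with j hj1 hj2 t ht
    simp only [Function.comp] at hj1
    set h := hs (ι j) with hh
    have hpos : 0 < h := hs0 _
    have hτ : 0 < h / lam := div_pos hpos hlam
    set N := ⌊t / (h / lam)⌋₊ with hN
    have hNt : N * (h / lam) ≤ t := by
      have := Nat.floor_le (div_nonneg ht.1 hτ.le); rwa [le_div_iff₀ hτ] at this
    have hNh : N * h ≤ T * lam := by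
      have := mul_le_mul_of_nonneg_right (hNt.trans ht.2) hlam.le
      rwa [mul_assoc, div_mul_cancel₀ _ hlam.ne'] at this
    -- A step of ±1 is twice an indicator minus one: its mean is `V / lam` and the remainder is
    -- twice the centred indicator.
    have hmsum : ∀ n : ℕ, (m h n : ℝ) = ∑ k ∈ Finset.range n, V h k / lam +
        2 * ∑ k ∈ Finset.range n, centredIndicator a k (V h k / lam) := by
      intro n
      induction n with
      | zero => simp [hm0 h hpos]
      | succ n ih =>
        rw [hm h hpos, Finset.sum_range_succ, Finset.sum_range_succ, Int.cast_add, ih]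
        have : a (n + 1) ≤ V h n / lam ↔ lam * a (n + 1) ≤ V h n := by
          rw [le_div_iff₀ hlam, mul_comm]
        simp only [centredIndicator, this]
        split_ifs <;> push_cast <;> ring
    have hc1 : χh h t = 2 * h * ∑ k ∈ Finset.range N, centredIndicator a k (V h k / lam) +
        ∫ s in (0 : ℝ)..t, X j s := by
      rw [hχ h hpos, hX]
      simp only
      rw [integral_step (V h) hτ (fun n => (hV h hpos n).le) ht.1, ← hN, hmsum N,
        ← Finset.sum_div]
      field_simp
      ring
    have hc2 := hmesh h hpos hj1 (fun n => V h n / lam) (fun n => by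
        have := abs_lt.1 (hV h hpos n)
        rw [mem_Ioo, lt_div_iff₀ hlam, div_lt_one hlam]
        constructor <;> linarith [this.1, this.2])
      (fun N => by
        have := hB h hpos N
        have e : ∀ n, |V h (n + 1) / lam - V h n / lam| = |V h (n + 1) - V h n| / lam := fun n => by
          rw [← sub_div, abs_div, abs_of_pos hlam]
        simp only [e]
        rw [← Finset.sum_div]
        exact div_le_div_of_nonneg_right this hlam.le) N hNh
    have hc3 : |(∫ s in (0 : ℝ)..t, X j s) - χ t| ≤ ∫ s in (0 : ℝ)..T, |X j s - G s| := by
      rw [hχdef]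
      simp only
      rw [← intervalIntegral.integral_sub (hXi j 0 t) (hGi 0 t)]
      refine (intervalIntegral.abs_integral_le_integral_abs ht.1).trans ?_
      refine intervalIntegral.integral_mono_interval le_rfl ht.1 ht.2
        (Eventually.of_forall fun s => abs_nonneg _) ((hXi j 0 T).sub (hGi 0 T)).abs
    rw [dist_comm, Real.dist_eq, hc1]
    calc _ = |2 * h * ∑ k ∈ Finset.range N, centredIndicator a k (V h k / lam) +
          ((∫ s in (0 : ℝ)..t, X j s) - χ t)| := by rw [add_sub_assoc]
      _ ≤ _ := abs_add_le _ _
      _ < η := by linarith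
  · intro t ht
    have ht' : t ∈ Ici (0 : ℝ) \ E := ⟨ht.1, fun hE' => ht.2 ⟨hE', ht.1⟩⟩
    have hd := (hderiv t ht').hasDerivWithinAt (s := Ici 0)
    refine ⟨hd.differentiableWithinAt, ?_⟩
    rw [hd.derivWithin (uniqueDiffOn_Ici 0 t ht.1)]
    refine (hG t ht'.2).2.congr fun j => ?_
    rw [hspeed _ (hs0 _)]

/-! ### Riemann invariants, jump relations and driving force. -/

namespace Material

variable (M : Material)

/-- The right-moving Riemann invariant of phase 1. -/
noncomputable def invP (u : State) : ℝ := u.1 - M.c₁ * u.2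

/-- The left-moving Riemann invariant of phase 1. -/
noncomputable def invQ (u : State) : ℝ := u.1 + M.c₁ * u.2

/-- The right-moving Riemann invariant of phase 3. -/
noncomputable def invR (u : State) : ℝ := u.1 - M.c₃ * u.2

/-- The left-moving Riemann invariant of phase 3. -/
noncomputable def invS (u : State) : ℝ := u.1 + M.c₃ * u.2

theorem c₃_pos : 0 < M.c₃ := Real.sqrt_pos.2 M.k₃_pos

theorem k₁_pos : 0 < M.k₁ := M.k₃_pos.trans M.k₃_lt_k₁

theorem c₃_lt_c₁ : M.c₃ < M.c₁ := Real.sqrt_lt_sqrt M.k₃_pos.le M.k₃_lt_k₁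

theorem c₁_pos : 0 < M.c₁ := M.c₃_pos.trans M.c₃_lt_c₁

theorem k₁_eq : M.k₁ = M.c₁ ^ 2 := (Real.sq_sqrt M.k₁_pos.le).symm

theorem k₃_eq : M.k₃ = M.c₃ ^ 2 := (Real.sq_sqrt M.k₃_pos.le).symm

theorem wm_pos : 0 < M.wm := M.wM_pos.trans M.wM_lt_wm

variable {M}

theorem stress_of_le {w : ℝ} (hw : w ≤ M.wM) : M.stress w = M.k₁ * w := by simp [stress, hw]

theorem stress_of_ge {w : ℝ} (hw : M.wm ≤ w) : M.stress w = M.k₃ * w := by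
  have h1 : ¬ w ≤ M.wM := not_le.2 (M.wM_lt_wm.trans_le hw)
  rw [stress, if_neg h1]
  split_ifs with h2
  · rw [le_antisymm h2 hw]; simp
  · rfl

theorem stress_of_mem_Icc {w : ℝ} (hw : w ∈ Icc M.wM M.wm) : M.stress w =
    M.k₃ * M.wm + (M.k₁ * M.wM - M.k₃ * M.wm) * (w - M.wm) / (M.wM - M.wm) := by
  rw [stress]
  split_ifs with h1 h2
  · rw [le_antisymm h1 hw.1, mul_div_assoc, div_self (sub_ne_zero.2 M.wM_lt_wm.ne)]; ring
  · rfl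
  · exact absurd hw.2 h2

theorem not_mem_phase3_of_mem_phase1 {u : State} (hu : u ∈ M.phase1) : u ∉ M.phase3 := fun h =>
  absurd (le_trans h hu.2) (not_le.2 M.wM_lt_wm)

theorem rankineHugoniot_neg_c₁_iff {u v : State} (hu : u ∈ M.phase1) (hv : v ∈ M.phase1) :
    M.RankineHugoniot (-M.c₁) u v ↔ M.invP v = M.invP u := by
  rw [RankineHugoniot, stress_of_le hu.2, stress_of_le hv.2, invP, invP, M.k₁_eq]
  constructor
  · rintro ⟨h, -⟩; linarith
  · intro h
    have h' : v.1 - u.1 = M.c₁ * (v.2 - u.2) := by linarith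
    exact ⟨by linarith, by rw [h']; ring⟩

theorem rankineHugoniot_c₁_iff {u v : State} (hu : u ∈ M.phase1) (hv : v ∈ M.phase1) :
    M.RankineHugoniot M.c₁ u v ↔ M.invQ v = M.invQ u := by
  rw [RankineHugoniot, stress_of_le hu.2, stress_of_le hv.2, invQ, invQ, M.k₁_eq]
  constructor
  · rintro ⟨h, -⟩; linarith
  · intro h
    have h' : v.1 - u.1 = -M.c₁ * (v.2 - u.2) := by linarith
    exact ⟨by linarith, by rw [h']; ring⟩

theorem rankineHugoniot_neg_c₃_iff {u v : State} (hu : u ∈ M.phase3) (hv : v ∈ M.phase3) :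
    M.RankineHugoniot (-M.c₃) u v ↔ M.invR v = M.invR u := by
  rw [RankineHugoniot, stress_of_ge hu, stress_of_ge hv, invR, invR, M.k₃_eq]
  constructor
  · rintro ⟨h, -⟩; linarith
  · intro h
    have h' : v.1 - u.1 = M.c₃ * (v.2 - u.2) := by linarith
    exact ⟨by linarith, by rw [h']; ring⟩

theorem rankineHugoniot_c₃_iff {u v : State} (hu : u ∈ M.phase3) (hv : v ∈ M.phase3) :
    M.RankineHugoniot M.c₃ u v ↔ M.invS v = M.invS u := by
  rw [RankineHugoniot, stress_of_ge hu, stress_of_ge hv, invS, invS, M.k₃_eq]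
  constructor
  · rintro ⟨h, -⟩; linarith
  · intro h
    have h' : v.1 - u.1 = -M.c₃ * (v.2 - u.2) := by linarith
    exact ⟨by linarith, by rw [h']; ring⟩

/-- For fixed `V`, p on the left and s on the right are the incoming quantities. Eliminating the
velocities leaves two linear equations, each containing one strain and the incoming jump s - p. -/
theorem rankineHugoniot_boundary_iff {u v : State} (hu : u ∈ M.phase1) (hv : v ∈ M.phase3) {V : ℝ} :
    M.RankineHugoniot V u v ↔
      (M.c₁ + M.c₃) * ((M.c₃ - V) * v.2) = (M.invS v - M.invP u) * (M.c₁ - V) ∧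
      (M.c₁ + M.c₃) * ((M.c₁ + V) * u.2) = (M.invS v - M.invP u) * (M.c₃ + V) := by
  rw [RankineHugoniot, stress_of_le hu.2, stress_of_ge hv, invS, invP, M.k₁_eq, M.k₃_eq]
  have hc : M.c₁ + M.c₃ ≠ 0 := (add_pos M.c₁_pos M.c₃_pos).ne'
  constructor
  · rintro ⟨h1, h2⟩
    have h1' : v.1 = u.1 - V * (v.2 - u.2) := by linarith
    rw [h1'] at h2 ⊢
    exact ⟨by linear_combination h2, by linear_combination -h2⟩
  · rintro ⟨h1, h2⟩
    have h3 : V * (v.2 - u.2) + (v.1 - u.1) = 0 := by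
      apply mul_left_cancel₀ hc
      linear_combination -h1 - h2
    refine ⟨h3, ?_⟩
    have h1' : v.1 = u.1 - V * (v.2 - u.2) := by linarith
    rw [h1'] at h1 ⊢
    linear_combination h1

/-- The stress is integrated over its three affine pieces. The contributions quadratic in each
strain separately cancel and only the product survives. -/
theorem drivingForce_eq {wl wr : ℝ} (hl : wl ≤ M.wM) (hr : M.wm ≤ wr) :
    M.drivingForce wl wr = (M.k₁ - M.k₃) / 2 * (M.wM * M.wm - wl * wr) := by
  rw [drivingForce, stress_of_le hl, stress_of_ge hr]
  set A := (M.k₁ * wl + M.k₃ * wr) / 2 with hA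
  have hd : M.wM - M.wm ≠ 0 := sub_ne_zero.2 M.wM_lt_wm.ne
  set b := (M.k₁ * M.wM - M.k₃ * M.wm) / (M.wM - M.wm) with hb
  have hb' : b * (M.wM - M.wm) = M.k₁ * M.wM - M.k₃ * M.wm := div_mul_cancel₀ _ hd
  have e1 : EqOn (fun y => M.stress y - A) (fun y => M.k₁ * y - A) (uIcc wl M.wM) := by
    intro y hy
    rw [uIcc_of_le hl] at hy
    simp only [stress_of_le hy.2]
  have e2 : EqOn (fun y => M.stress y - A) (fun y => b * y + (M.k₃ * M.wm - b * M.wm - A))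
      (uIcc M.wM M.wm) := by
    intro y hy
    rw [uIcc_of_le M.wM_lt_wm.le] at hy
    simp only [stress_of_mem_Icc hy, hb]
    ring
  have e3 : EqOn (fun y => M.stress y - A) (fun y => M.k₃ * y - A) (uIcc M.wm wr) := by
    intro y hy
    rw [uIcc_of_le hr] at hy
    simp only [stress_of_ge hy.1]
  have i1 : IntervalIntegrable (fun y => M.stress y - A) volume wl M.wM :=
    (ContinuousOn.congr (by fun_prop) e1).intervalIntegrable
  have i2 : IntervalIntegrable (fun y => M.stress y - A) volume M.wM M.wm :=
    (ContinuousOn.congr (by fun_prop) e2).intervalIntegrable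
  have i3 : IntervalIntegrable (fun y => M.stress y - A) volume M.wm wr :=
    (ContinuousOn.congr (by fun_prop) e3).intervalIntegrable
  have lin : ∀ k d x y : ℝ, ∫ z in x..y, (k * z + d) = k * ((y ^ 2 - x ^ 2) / 2) + d * (y - x) := by
    intro k d x y
    rw [intervalIntegral.integral_add (by apply Continuous.intervalIntegrable; fun_prop)
      (by apply Continuous.intervalIntegrable; fun_prop), intervalIntegral.integral_const_mul,
      integral_id, intervalIntegral.integral_const, smul_eq_mul]
    ring
  rw [← intervalIntegral.integral_add_adjacent_intervals i1 (i2.trans i3),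
    ← intervalIntegral.integral_add_adjacent_intervals i2 i3,
    intervalIntegral.integral_congr e1, intervalIntegral.integral_congr e2,
    intervalIntegral.integral_congr e3]
  simp only [sub_eq_add_neg (M.k₁ * _), sub_eq_add_neg (M.k₃ * _) A]
  rw [lin, lin, lin, hA]
  linear_combination (M.wM - M.wm) / 2 * (-hb')

variable (M)

/-- The strain on the right of a subsonic phase boundary of speed `V` with incoming jump `D`. -/
noncomputable def strainRight (D V : ℝ) : ℝ := D * (M.c₁ - V) / ((M.c₁ + M.c₃) * (M.c₃ - V))

/-- The strain on the left of a phase boundary of speed `V` with incoming jump `D`. -/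
noncomputable def strainLeft (D V : ℝ) : ℝ := D * (M.c₃ + V) / ((M.c₁ + M.c₃) * (M.c₁ + V))

/-- The driving force of a subsonic phase boundary of speed `V` with incoming jump `D`. -/
noncomputable def force (D V : ℝ) : ℝ :=
  (M.k₁ - M.k₃) / 2 * (M.wM * M.wm - M.strainLeft D V * M.strainRight D V)

/-- The speed of a supersonic phase boundary with incoming jump `D` and right strain `w`. -/
noncomputable def supersonicSpeed (D w : ℝ) : ℝ :=
  (w * M.c₃ * (M.c₁ + M.c₃) - D * M.c₁) / (w * (M.c₁ + M.c₃) - D)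

variable {M}

theorem strainLeft_eq {D V w : ℝ} (hV : -M.c₃ < V)
    (h : (M.c₁ + M.c₃) * ((M.c₁ + V) * w) = D * (M.c₃ + V)) : w = M.strainLeft D V := by
  have := M.c₃_lt_c₁
  have := M.c₃_pos
  have h1 : 0 < M.c₁ + V := by linarith
  have h2 : 0 < M.c₁ + M.c₃ := by linarith
  rw [strainLeft, eq_div_iff (by positivity)]
  linarith

theorem mul_strainLeft {D V : ℝ} (hV : -M.c₃ < V) :
    (M.c₁ + M.c₃) * ((M.c₁ + V) * M.strainLeft D V) = D * (M.c₃ + V) := by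
  have := M.c₃_lt_c₁
  have := M.c₃_pos
  have h1 : 0 < M.c₁ + V := by linarith
  have h2 : 0 < M.c₁ + M.c₃ := by linarith
  rw [strainLeft]
  field_simp

theorem strainRight_eq {D V w : ℝ} (hV : V < M.c₃)
    (h : (M.c₁ + M.c₃) * ((M.c₃ - V) * w) = D * (M.c₁ - V)) : w = M.strainRight D V := by
  have := M.c₃_lt_c₁
  have := M.c₃_pos
  have h1 : 0 < M.c₃ - V := by linarith
  have h2 : 0 < M.c₁ + M.c₃ := by linarith
  rw [strainRight, eq_div_iff (by positivity)]
  linarith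

theorem mul_strainRight {D V : ℝ} (hV : V < M.c₃) :
    (M.c₁ + M.c₃) * ((M.c₃ - V) * M.strainRight D V) = D * (M.c₁ - V) := by
  have := M.c₃_lt_c₁
  have := M.c₃_pos
  have h1 : 0 < M.c₃ - V := by linarith
  have h2 : 0 < M.c₁ + M.c₃ := by linarith
  rw [strainRight]
  field_simp

theorem supersonicSpeed_eq {D w V : ℝ} (hD : D ≤ 0) (hw : 0 < w)
    (h : (M.c₁ + M.c₃) * ((M.c₃ - V) * w) = D * (M.c₁ - V)) : V = M.supersonicSpeed D w := by
  have := M.c₁_pos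
  have := M.c₃_pos
  have h1 : 0 < w * (M.c₁ + M.c₃) := by positivity
  have h2 : 0 < w * (M.c₁ + M.c₃) - D := by linarith
  rw [supersonicSpeed, eq_div_iff h2.ne']
  linarith

/-- The speed is the mean of c₃ and c₁ with weights w(c₁ + c₃) > 0 and -D ≥ 0. -/
theorem supersonicSpeed_spec {D w : ℝ} (hD : D ≤ 0) (hw : 0 < w) :
    M.supersonicSpeed D w ∈ Ico M.c₃ M.c₁ ∧
    (M.c₁ + M.c₃) * ((M.c₃ - M.supersonicSpeed D w) * w) = D * (M.c₁ - M.supersonicSpeed D w) := by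
  have := M.c₁_pos
  have := M.c₃_pos
  have := M.c₃_lt_c₁
  have h1 : 0 < w * (M.c₁ + M.c₃) := by positivity
  have h2 : 0 < w * (M.c₁ + M.c₃) - D := by linarith
  have h3 : M.supersonicSpeed D w * (w * (M.c₁ + M.c₃) - D) =
      w * M.c₃ * (M.c₁ + M.c₃) - D * M.c₁ := by
    rw [supersonicSpeed, div_mul_cancel₀ _ h2.ne']
  refine ⟨⟨?_, ?_⟩, by linarith⟩
  · rw [supersonicSpeed, le_div_iff₀ h2]; nlinarith
  · rw [supersonicSpeed, div_lt_iff₀ h2]; nlinarith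

theorem strainRight_pos {D V : ℝ} (hD : 0 < D) (hV : V ∈ Ioo (-M.c₃) M.c₃) :
    0 < M.strainRight D V := by
  have := M.c₁_pos
  have := M.c₃_pos
  have := M.c₃_lt_c₁
  have h1 : 0 < M.c₁ - V := by linarith [hV.2]
  have h2 : 0 < M.c₃ - V := by linarith [hV.2]
  rw [strainRight]; positivity

theorem strainLeft_pos {D V : ℝ} (hD : 0 < D) (hV : -M.c₃ < V) : 0 < M.strainLeft D V := by
  have := M.c₁_pos
  have := M.c₃_pos
  have := M.c₃_lt_c₁
  have h1 : 0 < M.c₃ + V := by linarith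
  have h2 : 0 < M.c₁ + V := by linarith
  rw [strainLeft]; positivity

theorem strainRight_lt {D V V' : ℝ} (hD : 0 < D) (h : V < V') (hV' : V' < M.c₃) :
    M.strainRight D V < M.strainRight D V' := by
  have := M.c₁_pos
  have := M.c₃_pos
  have := M.c₃_lt_c₁
  have h1 : 0 < M.c₃ - V := by linarith
  have h2 : 0 < M.c₃ - V' := by linarith
  have h3 : 0 < M.c₁ + M.c₃ := by linarith
  rw [strainRight, strainRight, div_lt_div_iff₀ (by positivity) (by positivity)]
  have h4 : 0 < D * (M.c₁ + M.c₃) := by positivity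
  have h5 : (M.c₁ - V) * (M.c₃ - V') < (M.c₁ - V') * (M.c₃ - V) := by nlinarith
  nlinarith

theorem strainLeft_lt {D V V' : ℝ} (hD : 0 < D) (h : V < V') (hV : -M.c₃ < V) :
    M.strainLeft D V < M.strainLeft D V' := by
  have := M.c₁_pos
  have := M.c₃_pos
  have := M.c₃_lt_c₁
  have h1 : 0 < M.c₁ + V := by linarith
  have h2 : 0 < M.c₁ + V' := by linarith
  have h3 : 0 < M.c₁ + M.c₃ := by linarith
  rw [strainLeft, strainLeft, div_lt_div_iff₀ (by positivity) (by positivity)]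
  have h4 : 0 < D * (M.c₁ + M.c₃) := by positivity
  have h5 : (M.c₃ + V) * (M.c₁ + V') < (M.c₃ + V') * (M.c₁ + V) := by nlinarith
  nlinarith

/-- For D > 0 both strains are positive and strictly increasing in the speed, and the force is a
constant minus a positive multiple of their product. -/
theorem force_lt {D V V' : ℝ} (hD : 0 < D) (h : V < V') (hV : -M.c₃ < V) (hV' : V' < M.c₃) :
    M.force D V' < M.force D V := by
  have hk : 0 < (M.k₁ - M.k₃) / 2 := by linarith [M.k₃_lt_k₁]
  rw [force, force]
  refine mul_lt_mul_of_pos_left ?_ hk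
  have := mul_lt_mul'' (strainLeft_lt hD h hV) (strainRight_lt hD h hV')
    (strainLeft_pos hD hV).le (strainRight_pos hD ⟨hV, h.trans hV'⟩).le
  linarith

end Material

/-! ### Monotonicity and solvability of the kinetic relation. -/

namespace IsDissipationFunction

variable {M : Material} {φ : ℝ → ℝ}

theorem continuousAt (hφ : IsDissipationFunction M φ) {V : ℝ} (hV : V ∈ Ioo (-M.c₃) M.c₃)
    (h0 : V ≠ 0) : ContinuousAt φ V := by
  rcases lt_or_gt_of_ne h0 with h | h
  · exact hφ.contDiff_neg.continuousOn.continuousAt (Ioo_mem_nhds hV.1 h)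
  · exact hφ.contDiff_pos.continuousOn.continuousAt
      (mem_of_superset (Ioo_mem_nhds h hV.2) Ioo_subset_Ioc_self)

theorem le_leftLim (hφ : IsDissipationFunction M φ) {V : ℝ} (hV : V ∈ Ioo (-M.c₃) 0) :
    φ V ≤ Function.leftLim φ 0 := by
  obtain ⟨l, hl⟩ := hφ.lim_zero_left
  rw [leftLim_eq_of_tendsto hl]
  refine ge_of_tendsto hl ?_
  filter_upwards [Ioo_mem_nhdsLT hV.2] with y hy
  exact hφ.monotone ⟨hV.1, by linarith [hV.2, M.c₃_pos]⟩
    ⟨by linarith [hV.1, hy.1], by linarith [hy.2, M.c₃_pos]⟩ hy.1.le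

theorem leftLim_le (hφ : IsDissipationFunction M φ) : Function.leftLim φ 0 ≤ φ 0 := by
  obtain ⟨l, hl⟩ := hφ.lim_zero_left
  rw [leftLim_eq_of_tendsto hl]
  have hc := M.c₃_pos
  refine le_of_tendsto hl ?_
  filter_upwards [Ioo_mem_nhdsLT (show -M.c₃ < 0 by linarith)] with y hy
  exact hφ.monotone ⟨hy.1, by linarith [hy.2]⟩ ⟨by linarith, by linarith⟩ hy.2.le

theorem rightLim_le (hφ : IsDissipationFunction M φ) {V : ℝ} (hV : V ∈ Ioo 0 M.c₃) :
    Function.rightLim φ 0 ≤ φ V := by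
  obtain ⟨l, hl⟩ := hφ.lim_zero_right
  rw [rightLim_eq_of_tendsto hl]
  refine le_of_tendsto hl ?_
  filter_upwards [Ioo_mem_nhdsGT hV.1] with y hy
  exact hφ.monotone ⟨by linarith [hy.1, M.c₃_pos], by linarith [hy.2, hV.2]⟩
    ⟨by linarith [hV.1, M.c₃_pos], hV.2.le⟩ hy.2.le

theorem le_rightLim (hφ : IsDissipationFunction M φ) : φ 0 ≤ Function.rightLim φ 0 := by
  obtain ⟨l, hl⟩ := hφ.lim_zero_right
  rw [rightLim_eq_of_tendsto hl]
  have hc := M.c₃_pos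
  refine ge_of_tendsto hl ?_
  filter_upwards [Ioo_mem_nhdsGT hc] with y hy
  exact hφ.monotone ⟨by linarith, by linarith⟩ ⟨by linarith [hy.1], hy.2.le⟩ hy.1.le

theorem kineticRelation_self (hφ : IsDissipationFunction M φ) (V : ℝ) :
    KineticRelation φ V (φ V) :=
  ⟨fun _ => rfl, fun h => by rw [h]; exact ⟨hφ.leftLim_le, hφ.le_rightLim⟩⟩

/-- The vertical segment that completes the graph of `φ` at 0 fits between the values on either
side, so the completed graph is still monotone. -/
theorem kineticRelation_mono (hφ : IsDissipationFunction M φ) {V V' e e' : ℝ}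
    (hV : V ∈ Ioo (-M.c₃) M.c₃) (hV' : V' ∈ Ioo (-M.c₃) M.c₃) (h : V < V')
    (he : KineticRelation φ V e) (he' : KineticRelation φ V' e') : e ≤ e' := by
  by_cases h0 : V = 0
  · rw [he'.1 (by linarith)]
    exact (he.2 h0).2.trans (hφ.rightLim_le ⟨by linarith, hV'.2⟩)
  · rw [he.1 h0]
    by_cases h0' : V' = 0
    · exact (hφ.le_leftLim ⟨hV.1, by linarith⟩).trans (he'.2 h0').1
    · rw [he'.1 h0']
      exact hφ.monotone (Ioo_subset_Ioc_self hV) (Ioo_subset_Ioc_self hV') h.le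

/-- A strictly decreasing curve meets a monotone graph at most once. -/
theorem kinetic_speed_unique (hφ : IsDissipationFunction M φ) {D V V' : ℝ} (hD : 0 < D)
    (hV : V ∈ Ioo (-M.c₃) M.c₃) (hV' : V' ∈ Ioo (-M.c₃) M.c₃)
    (he : KineticRelation φ V (M.force D V)) (he' : KineticRelation φ V' (M.force D V')) :
    V = V' := by
  rcases lt_trichotomy V V' with h | h | h
  · have := hφ.kineticRelation_mono hV hV' h he he'
    linarith [Material.force_lt hD h hV.1 hV'.2]
  · exact h
  · have := hφ.kineticRelation_mono hV' hV h he' he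
    linarith [Material.force_lt hD h hV'.1 hV.2]

/-- A decreasing force curve that starts above and ends below `φ` meets the kinetic relation. -/
theorem exists_kineticRelation (hφ : IsDissipationFunction M φ) {V₁ V₂ : ℝ} {e : ℝ → ℝ}
    (h₁ : -M.c₃ < V₁) (h₂ : V₂ < M.c₃) (h₁₂ : V₁ ≤ V₂) (hec : ContinuousOn e (Icc V₁ V₂))
    (hea : AntitoneOn e (Icc V₁ V₂)) (he₁ : φ V₁ ≤ e V₁) (he₂ : e V₂ ≤ φ V₂) :
    ∃ V ∈ Icc V₁ V₂, KineticRelation φ V (e V) := by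
  -- `φ` may jump at 0, so the intermediate value theorem does not apply. The crossing is the
  -- supremum of `S`: `φ ≤ e` to its left, `e ≤ φ` to its right, and one-sided limits are compared
  -- there.
  set S := {x ∈ Icc V₁ V₂ | φ x ≤ e x} with hS
  have hS1 : V₁ ∈ S := ⟨⟨le_rfl, h₁₂⟩, he₁⟩
  have hSb : BddAbove S := ⟨V₂, fun x hx => hx.1.2⟩
  set V := sSup S with hVdef
  have hV1 : V₁ ≤ V := le_csSup hSb hS1
  have hV2 : V ≤ V₂ := csSup_le ⟨_, hS1⟩ fun x hx => hx.1.2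
  have hmem : ∀ x ∈ Icc V₁ V₂, x ∈ Ioo (-M.c₃) M.c₃ := fun x hx =>
    ⟨h₁.trans_le hx.1, hx.2.trans_lt h₂⟩
  have hlow : ∀ x ∈ Ico V₁ V, φ x ≤ e x := by
    intro x hx
    obtain ⟨y, hy, hxy⟩ := exists_lt_of_lt_csSup ⟨_, hS1⟩ hx.2
    have hx' : x ∈ Icc V₁ V₂ := ⟨hx.1, hx.2.le.trans hV2⟩
    exact (hφ.monotone (Ioo_subset_Ioc_self (hmem x hx')) (Ioo_subset_Ioc_self (hmem y hy.1))
      hxy.le).trans (hy.2.trans (hea hx' hy.1 hxy.le))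
  have hup : ∀ x ∈ Ioc V V₂, e x ≤ φ x := by
    intro x hx
    by_contra hlt
    push Not at hlt
    exact absurd (le_csSup hSb ⟨⟨hV1.trans hx.1.le, hx.2⟩, hlt.le⟩) (not_le.2 hx.1)
  have hVI : V ∈ Icc V₁ V₂ := ⟨hV1, hV2⟩
  have hel : V₁ < V → Tendsto e (𝓝[<] V) (𝓝 (e V)) := fun h =>
    (hec V hVI).mono_left (nhdsWithin_le_iff.2 (mem_of_superset (Ioo_mem_nhdsLT h)
      fun x hx => ⟨hx.1.le, hx.2.le.trans hV2⟩))
  have her : V < V₂ → Tendsto e (𝓝[>] V) (𝓝 (e V)) := fun h =>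
    (hec V hVI).mono_left (nhdsWithin_le_iff.2 (mem_of_superset (Ioo_mem_nhdsGT h)
      fun x hx => ⟨hV1.trans hx.1.le, hx.2.le⟩))
  have hL : ∀ l, Tendsto φ (𝓝[<] V) (𝓝 l) → V₁ < V → l ≤ e V := fun l hl h =>
    le_of_tendsto_of_tendsto hl (hel h) (by
      filter_upwards [Ioo_mem_nhdsLT h] with x hx using hlow x ⟨hx.1.le, hx.2⟩)
  have hR : ∀ l, Tendsto φ (𝓝[>] V) (𝓝 l) → V < V₂ → e V ≤ l := fun l hl h =>
    le_of_tendsto_of_tendsto (her h) hl (by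
      filter_upwards [Ioo_mem_nhdsGT h] with x hx using hup x ⟨hx.1, hx.2.le⟩)
  refine ⟨V, hVI, fun h0 => ?_, fun h0 => ?_⟩
  · have hc := hφ.continuousAt (hmem V hVI) h0
    apply le_antisymm
    · rcases hV2.eq_or_lt with h | h
      · rw [h]; exact he₂
      · exact hR _ (hc.mono_left nhdsWithin_le_nhds) h
    · rcases hV1.eq_or_lt with h | h
      · rw [← h]; exact he₁
      · exact hL _ (hc.mono_left nhdsWithin_le_nhds) h
  -- At a crossing at 0 the one-sided limits place `e` on the vertical segment. If 0 is an endpoint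
  -- of the interval, one limit is not accessible and the value `φ 0` takes its place.
  · obtain ⟨l, hl⟩ := hφ.lim_zero_left
    obtain ⟨r, hr⟩ := hφ.lim_zero_right
    constructor
    · rcases hV1.eq_or_lt with h | h
      · refine hφ.leftLim_le.trans ?_
        rw [← h0, ← h]; exact he₁
      · rw [leftLim_eq_of_tendsto hl]
        exact hL l (by rw [h0]; exact hl) h
    · rcases hV2.eq_or_lt with h | h
      · refine le_trans ?_ hφ.le_rightLim
        rw [← h0, h]; exact he₂
      · rw [rightLim_eq_of_tendsto hr]
        exact hR r (by rw [h0]; exact hr) h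

end IsDissipationFunction

/-! ### Explicit and unique solution of the Riemann problem. -/

namespace Material

variable (M : Material)

/-- The state with given Riemann invariants of phase 1. -/
noncomputable def state1 (p q : ℝ) : State := ((p + q) / 2, (q - p) / (2 * M.c₁))

/-- The state with given Riemann invariants of phase 3. -/
noncomputable def state3 (r s : ℝ) : State := ((r + s) / 2, (s - r) / (2 * M.c₃))

@[simp] theorem invP_state1 (p q : ℝ) : M.invP (M.state1 p q) = p := by
  have := M.c₁_pos.ne'
  simp only [invP, state1]; field_simp; ring

@[simp] theorem invQ_state1 (p q : ℝ) : M.invQ (M.state1 p q) = q := by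
  have := M.c₁_pos.ne'
  simp only [invQ, state1]; field_simp; ring

@[simp] theorem invR_state3 (r s : ℝ) : M.invR (M.state3 r s) = r := by
  have := M.c₃_pos.ne'
  simp only [invR, state3]; field_simp; ring

@[simp] theorem invS_state3 (r s : ℝ) : M.invS (M.state3 r s) = s := by
  have := M.c₃_pos.ne'
  simp only [invS, state3]; field_simp; ring

@[simp] theorem state1_inv (u : State) : M.state1 (M.invP u) (M.invQ u) = u := by
  have := M.c₁_pos.ne'
  ext <;> simp only [invP, invQ, state1]
  · ring
  · field_simp; ring

@[simp] theorem state3_inv (u : State) : M.state3 (M.invR u) (M.invS u) = u := by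
  have := M.c₃_pos.ne'
  ext <;> simp only [invR, invS, state3]
  · ring
  · field_simp; ring

/-- The speed of the phase boundary, from the subsonic speeds `V0`. -/
noncomputable def boundarySpeed (V0 : ℝ → ℝ) (D w : ℝ) : ℝ :=
  if 0 < D then V0 D else M.supersonicSpeed D w

/-- The state on the left of the phase boundary. -/
noncomputable def boundaryLeft (p D V : ℝ) : State :=
  M.state1 p (p + 2 * M.c₁ * M.strainLeft D V)

/-- The fan containing a phase boundary, from the subsonic speeds `V0` and right strains `W`. -/
noncomputable def boundaryFan (V0 W : ℝ → ℝ) (ul ur : State) : Fan :=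
  let D := M.invS ur - M.invP ul
  let V := M.boundarySpeed V0 D ur.2
  ⟨M.boundaryLeft (M.invP ul) D V,
    if 0 < D then M.state3 (M.invS ur - 2 * M.c₃ * W D) (M.invS ur) else ur,
    -M.c₁, V, if 0 < D then M.c₃ else V⟩

variable {M}

theorem snd_boundaryLeft (p D V : ℝ) : (M.boundaryLeft p D V).2 = M.strainLeft D V := by
  have := M.c₁_pos.ne'
  simp only [boundaryLeft, state1]; field_simp; ring

/-- `riemann` is an arbitrary choice among solutions; an exact description of the set of solutions
determines it. -/
theorem riemann_eq {φ : ℝ → ℝ} {ul ur : State} {F : Fan}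
    (h : ∀ G, IsRiemannSolution M φ ul ur G ↔ G = F) : riemann M φ ul ur = F :=
  (h _).1 (Classical.epsilon_spec (p := IsRiemannSolution M φ ul ur) ⟨F, (h F).2 rfl⟩)

theorem existsUnique_of_iff {φ : ℝ → ℝ} {ul ur : State} {F : Fan}
    (h : ∀ G, IsRiemannSolution M φ ul ur G ↔ G = F) : ∃! G, IsRiemannSolution M φ ul ur G :=
  ⟨F, (h F).2 rfl, fun G hG => (h G).1 hG⟩

theorem isRiemannSolution_phase1_iff {φ : ℝ → ℝ} {ul ur : State} (hl : ul ∈ M.phase1)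
    (hr : ur ∈ M.phase1) (hm : M.state1 (M.invP ul) (M.invQ ur) ∈ M.phase1) (G : Fan) :
    IsRiemannSolution M φ ul ur G ↔
      G = ⟨M.state1 (M.invP ul) (M.invQ ur), M.state1 (M.invP ul) (M.invQ ur),
        -M.c₁, 0, M.c₁⟩ := by
  constructor
  · intro h
    cases h with
    | phase1 u _ _ hu h1 h2 =>
      rw [rankineHugoniot_neg_c₁_iff hl hu] at h1
      rw [rankineHugoniot_c₁_iff hu hr] at h2
      rw [← h1, h2, state1_inv]
    | phase3 u hl' => exact absurd hl' (not_mem_phase3_of_mem_phase1 hl)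
    | subsonic um up V _ hr' => exact absurd hr' (not_mem_phase3_of_mem_phase1 hr)
    | supersonic um V _ hr' => exact absurd hr' (not_mem_phase3_of_mem_phase1 hr)
  · rintro rfl
    exact .phase1 _ hl hr hm ((rankineHugoniot_neg_c₁_iff hl hm).2 (by simp))
      ((rankineHugoniot_c₁_iff hm hr).2 (by simp))

theorem isRiemannSolution_phase3_iff {φ : ℝ → ℝ} {ul ur : State} (hl : ul ∈ M.phase3)
    (hr : ur ∈ M.phase3) (hm : M.state3 (M.invR ul) (M.invS ur) ∈ M.phase3) (G : Fan) :
    IsRiemannSolution M φ ul ur G ↔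
      G = ⟨M.state3 (M.invR ul) (M.invS ur), M.state3 (M.invR ul) (M.invS ur),
        -M.c₃, 0, M.c₃⟩ := by
  constructor
  · intro h
    cases h with
    | phase3 u _ _ hu h1 h2 =>
      rw [rankineHugoniot_neg_c₃_iff hl hu] at h1
      rw [rankineHugoniot_c₃_iff hu hr] at h2
      rw [← h1, h2, state3_inv]
    | phase1 u hl' => exact absurd hl (not_mem_phase3_of_mem_phase1 hl')
    | subsonic um up V hl' => exact absurd hl (not_mem_phase3_of_mem_phase1 hl')
    | supersonic um V hl' => exact absurd hl (not_mem_phase3_of_mem_phase1 hl')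
  · rintro rfl
    exact .phase3 _ hl hr hm ((rankineHugoniot_neg_c₃_iff hl hm).2 (by simp))
      ((rankineHugoniot_c₃_iff hm hr).2 (by simp))

/-- The data of a subsonic phase boundary, in terms of the incoming jump. -/
theorem subsonic_data {um up : State} {V : ℝ} (hm : um ∈ M.phase1) (hp : up ∈ M.phase3)
    (hV : V ∈ Ioo (-M.c₃) M.c₃) (h : M.RankineHugoniot V um up) :
    0 < M.invS up - M.invP um ∧ um.2 = M.strainLeft (M.invS up - M.invP um) V ∧
      up.2 = M.strainRight (M.invS up - M.invP um) V := by
  rw [rankineHugoniot_boundary_iff hm hp] at h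
  refine ⟨?_, strainLeft_eq hV.1 h.2, strainRight_eq hV.2 h.1⟩
  have := M.c₁_pos
  have := M.c₃_pos
  have := M.c₃_lt_c₁
  have h1 : 0 < M.c₁ - V := by linarith [hV.2]
  have h2 : 0 < M.c₃ - V := by linarith [hV.2]
  have h3 : 0 < up.2 := M.wm_pos.trans_le hp
  have h4 : 0 < (M.invS up - M.invP um) * (M.c₁ - V) := by rw [← h.1]; positivity
  exact pos_of_mul_pos_left h4 h1.le

/-- The data of a supersonic phase boundary, in terms of the incoming jump. -/
theorem supersonic_data {um ur : State} {V : ℝ} (hm : um ∈ M.phase1) (hr : ur ∈ M.phase3)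
    (hV : V ∈ Ico M.c₃ M.c₁) (h : M.RankineHugoniot V um ur) :
    M.invS ur - M.invP um ≤ 0 ∧ um.2 = M.strainLeft (M.invS ur - M.invP um) V ∧
      V = M.supersonicSpeed (M.invS ur - M.invP um) ur.2 := by
  rw [rankineHugoniot_boundary_iff hm hr] at h
  have := M.c₁_pos
  have := M.c₃_pos
  have := M.c₃_lt_c₁
  have h1 : 0 < M.c₁ - V := by linarith [hV.2]
  have h2 : M.c₃ - V ≤ 0 := by linarith [hV.1]
  have h3 : 0 < ur.2 := M.wm_pos.trans_le hr
  have h4 : (M.invS ur - M.invP um) * (M.c₁ - V) ≤ 0 := by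
    rw [← h.1]
    exact mul_nonpos_of_nonneg_of_nonpos (by positivity) (mul_nonpos_of_nonpos_of_nonneg h2 h3.le)
  have h5 : M.invS ur - M.invP um ≤ 0 := nonpos_of_mul_nonpos_left h4 h1
  exact ⟨h5, strainLeft_eq (by linarith [hV.1]) h.2, supersonicSpeed_eq h5 h3 h.1⟩

theorem eq_boundaryLeft {u : State} {D V : ℝ} (h : u.2 = M.strainLeft D V) :
    u = M.boundaryLeft (M.invP u) D V := by
  rw [boundaryLeft, ← h]
  conv_lhs => rw [← M.state1_inv u]
  congr 1
  simp only [invP, invQ]; ring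

theorem eq_state3 {u : State} {w : ℝ} (h : u.2 = w) :
    u = M.state3 (M.invS u - 2 * M.c₃ * w) (M.invS u) := by
  rw [← h]
  conv_lhs => rw [← M.state3_inv u]
  congr 1
  simp only [invR, invS]; ring

/-- The contact discontinuities preserve p on the left and s on the right, so every solution has the
incoming jump of the data. The sign of that jump excludes one regime; in the other, uniqueness of
the speed fixes both intermediate states. -/
theorem isRiemannSolution_boundary_iff {φ : ℝ → ℝ} (hφ : IsDissipationFunction M φ)
    {V0 W : ℝ → ℝ} {ul ur : State} (hl : ul ∈ M.phase1) (hr : ur ∈ M.phase3)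
    (hV0 : 0 < M.invS ur - M.invP ul → V0 (M.invS ur - M.invP ul) ∈ Ioo (-M.c₃) M.c₃ ∧
      W (M.invS ur - M.invP ul) =
        M.strainRight (M.invS ur - M.invP ul) (V0 (M.invS ur - M.invP ul)) ∧
      KineticRelation φ (V0 (M.invS ur - M.invP ul))
        (M.force (M.invS ur - M.invP ul) (V0 (M.invS ur - M.invP ul))))
    (hm : (M.boundaryFan V0 W ul ur).um ∈ M.phase1)
    (hp : (M.boundaryFan V0 W ul ur).up ∈ M.phase3) (G : Fan) :
    IsRiemannSolution M φ ul ur G ↔ G = M.boundaryFan V0 W ul ur := by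
  have hu2 := snd_boundaryLeft (M := M)
  rw [boundaryFan] at hm hp ⊢
  simp only at hm hp ⊢
  set D := M.invS ur - M.invP ul with hD
  by_cases h0 : 0 < D
  · obtain ⟨hVm, hW, hK⟩ := hV0 h0
    simp only [if_pos h0, boundarySpeed] at hm hp ⊢
    constructor
    · intro h
      cases h with
      | phase1 u _ hr' => exact absurd hr (not_mem_phase3_of_mem_phase1 hr')
      | phase3 u hl' => exact absurd hl' (not_mem_phase3_of_mem_phase1 hl)
      | subsonic um up V _ _ hm' hp' hV h1 h2 h3 hk =>
        obtain ⟨-, e2, e3⟩ := subsonic_data hm' hp' hV h2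
        rw [rankineHugoniot_neg_c₁_iff hl hm'] at h1
        rw [rankineHugoniot_c₃_iff hp' hr] at h3
        rw [h1, ← h3, ← hD] at e2 e3
        rw [drivingForce_eq hm'.2 hp', e2, e3] at hk
        have hVV : V = V0 D := hφ.kinetic_speed_unique h0 hV hVm hk hK
        rw [hVV] at e2 e3
        have f1 := eq_boundaryLeft e2
        have f2 := eq_state3 (M := M) (e3.trans hW.symm)
        rw [h1] at f1
        rw [← h3] at f2
        rw [← f1, ← f2, hVV]
      | supersonic um V _ _ hm' hV h1 h2 =>
        have := (supersonic_data hm' hr hV h2).1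
        rw [rankineHugoniot_neg_c₁_iff hl hm'] at h1
        rw [h1] at this
        linarith
    · rintro rfl
      refine .subsonic _ _ _ hl hr hm hp hVm ((rankineHugoniot_neg_c₁_iff hl hm).2 ?_)
        ((rankineHugoniot_boundary_iff hm hp).2 ?_) ((rankineHugoniot_c₃_iff hp hr).2 ?_) ?_
      · simp [boundaryLeft]
      · have e3 : (M.state3 (M.invS ur - 2 * M.c₃ * W D) (M.invS ur)).2
            = M.strainRight D (V0 D) := by
          have := M.c₃_pos.ne'
          rw [← hW]; simp only [state3]; field_simp; ring
        rw [e3, hu2, invS_state3]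
        have e4 : M.invP (M.boundaryLeft (M.invP ul) D (V0 D)) = M.invP ul := by
          simp [boundaryLeft]
        rw [e4, ← hD]
        exact ⟨mul_strainRight hVm.2, mul_strainLeft hVm.1⟩
      · simp
      · rw [drivingForce_eq hm.2 hp, hu2]
        have e3 : (M.state3 (M.invS ur - 2 * M.c₃ * W D) (M.invS ur)).2
            = M.strainRight D (V0 D) := by
          have := M.c₃_pos.ne'
          rw [← hW]; simp only [state3]; field_simp; ring
        rw [e3]
        exact hK
  · have hD0 : D ≤ 0 := not_lt.1 h0
    have hw : 0 < ur.2 := M.wm_pos.trans_le hr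
    have hs := supersonicSpeed_spec (M := M) hD0 hw
    simp only [if_neg h0, boundarySpeed] at hm hp ⊢
    constructor
    · intro h
      cases h with
      | phase1 u _ hr' => exact absurd hr (not_mem_phase3_of_mem_phase1 hr')
      | phase3 u hl' => exact absurd hl' (not_mem_phase3_of_mem_phase1 hl)
      | subsonic um up V _ _ hm' hp' hV h1 h2 h3 hk =>
        have := (subsonic_data hm' hp' hV h2).1
        rw [rankineHugoniot_neg_c₁_iff hl hm'] at h1
        rw [rankineHugoniot_c₃_iff hp' hr] at h3
        rw [h1, ← h3] at this
        linarith
      | supersonic um V _ _ hm' hV h1 h2 =>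
        obtain ⟨-, e2, e3⟩ := supersonic_data hm' hr hV h2
        rw [rankineHugoniot_neg_c₁_iff hl hm'] at h1
        rw [h1, ← hD] at e2 e3
        have f1 := eq_boundaryLeft e2
        rw [h1] at f1
        rw [← e3, ← f1]
    · rintro rfl
      refine .supersonic _ _ hl hr hm hs.1 ((rankineHugoniot_neg_c₁_iff hl hm).2 ?_)
        ((rankineHugoniot_boundary_iff hm hr).2 ?_)
      · simp [boundaryLeft]
      · have e4 : M.invP (M.boundaryLeft (M.invP ul) D (M.supersonicSpeed D ur.2)) = M.invP ul := by
          simp [boundaryLeft]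
        rw [hu2, e4, ← hD]
        exact ⟨hs.2, mul_strainLeft (by linarith [hs.1.1, M.c₃_pos])⟩

end Material

/-! ### Lipschitz dependence of the phase boundary on the incoming jump. -/

/-- The subsonic speeds `V0` and right strains `W` of the phase boundary, as Lipschitz functions of
the incoming jump in `I`, extended to supersonic jumps. -/
structure IsLocalSolver (M : Material) (φ : ℝ → ℝ) (I : Set ℝ) (C : ℝ) (V0 W : ℝ → ℝ) : Prop where
  lip_speed : ∀ D ∈ I, ∀ D' ∈ I, |V0 D - V0 D'| ≤ C * |D - D'|
  lip_strain : ∀ D ∈ I, ∀ D' ∈ I, |W D - W D'| ≤ C * |D - D'|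
  speed_mem : ∀ D ∈ I, 0 < D → V0 D ∈ Ioo (-M.c₃) M.c₃
  strain_eq : ∀ D ∈ I, 0 < D → W D = M.strainRight D (V0 D)
  kinetic : ∀ D ∈ I, 0 < D → KineticRelation φ (V0 D) (M.force D (V0 D))
  speed_of_nonpos : ∀ D ∈ I, D ≤ 0 → V0 D = M.c₃

/-- The interval contains only negative jumps, so the subsonic clauses are vacuous and constants
serve. -/
theorem exists_localSolver_of_neg (M : Material) (φ : ℝ → ℝ) {D₀ : ℝ} (hD₀ : D₀ < 0) (w₀ : ℝ) :
    IsLocalSolver M φ (Icc (D₀ - -D₀ / 2) (D₀ + -D₀ / 2)) 0 (fun _ => M.c₃) (fun _ => w₀) where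
  lip_speed D _ D' _ := by simp
  lip_strain D _ D' _ := by simp
  speed_mem D hD h := by linarith [hD.2]
  strain_eq D hD h := by linarith [hD.2]
  kinetic D hD h := by linarith [hD.2]
  speed_of_nonpos D _ _ := rfl

theorem Material.continuousOn_force (M : Material) (D : ℝ) {V₁ V₂ : ℝ} (h₁ : -M.c₃ < V₁)
    (h₂ : V₂ < M.c₃) : ContinuousOn (M.force D) (Icc V₁ V₂) := by
  have hc := M.c₃_lt_c₁
  have hc3 := M.c₃_pos
  unfold Material.force Material.strainLeft Material.strainRight
  refine continuousOn_const.mul (continuousOn_const.sub (ContinuousOn.mul ?_ ?_))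
  · refine ContinuousOn.div (by fun_prop) (by fun_prop) fun V hV => ?_
    have h1 : 0 < M.c₁ + V := by linarith [hV.1]
    have h2 : 0 < M.c₁ + M.c₃ := by linarith
    positivity
  · refine ContinuousOn.div (by fun_prop) (by fun_prop) fun V hV => ?_
    have h1 : 0 < M.c₃ - V := by linarith [hV.2]
    have h2 : 0 < M.c₁ + M.c₃ := by linarith
    positivity

/-- Two subsonic solutions with nearby incoming jumps have nearby speeds. -/
theorem IsDissipationFunction.speed_sub_le {M : Material} {φ : ℝ → ℝ}
    (hφ : IsDissipationFunction M φ) {d D D' V V' V₂ : ℝ} (hd : 0 < d)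
    (hD : D ∈ Icc (d / 2) (2 * d)) (hD' : D' ∈ Icc (d / 2) (2 * d))
    (hV : -M.c₃ < V) (hVV : V < V') (hV' : V' ≤ V₂) (hV₂ : V₂ < M.c₃)
    (he : KineticRelation φ V (M.force D V)) (he' : KineticRelation φ V' (M.force D' V')) :
    V' - V ≤ 64 * M.c₁ ^ 2 * ((M.c₁ - V₂) / (M.c₃ - V₂)) / (d * (M.c₁ - M.c₃)) * |D - D'| := by
  have hc := M.c₃_lt_c₁
  have hc3 := M.c₃_pos
  have hk : 0 < (M.k₁ - M.k₃) / 2 := by linarith [M.k₃_lt_k₁]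
  -- Only monotonicity of `φ` enters: the driving force at the larger speed is not smaller, although
  -- for a fixed jump it would decrease strictly. The difference must come from the change of the
  -- jump.
  have hmono := hφ.kineticRelation_mono ⟨hV, by linarith⟩ ⟨by linarith, by linarith⟩ hVV he he'
  rw [Material.force, Material.force, mul_le_mul_iff_right₀ hk] at hmono
  set s := M.c₁ + M.c₃ with hs
  have hs0 : 0 < s := by linarith
  have p1 : 0 < M.c₁ + V := by linarith
  have p2 : 0 < M.c₁ + V' := by linarith
  have p3 : 0 < M.c₃ - V := by linarith
  have p4 : 0 < M.c₃ - V' := by linarith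
  have p5 : 0 < M.c₃ - V₂ := by linarith
  have p6 : 0 < M.c₃ + V := by linarith
  -- The product of the strains is D²fg/(c₁ + c₃)². Here f ≥ 1 and g ≤ 1 both increase with the
  -- speed, g at a rate at least (c₁ - c₃)/(4c₁²), and f is bounded by its value `F` at `V₂`.
  set f := (M.c₁ - V) / (M.c₃ - V) with hf
  set f' := (M.c₁ - V') / (M.c₃ - V') with hf'
  set F := (M.c₁ - V₂) / (M.c₃ - V₂) with hF
  set g := (M.c₃ + V) / (M.c₁ + V) with hg
  set g' := (M.c₃ + V') / (M.c₁ + V') with hg'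
  have e1 : M.strainLeft D V * M.strainRight D V = D ^ 2 * (f * g) / s ^ 2 := by
    rw [Material.strainLeft, Material.strainRight, hf, hg, ← hs]; field_simp
  have e2 : M.strainLeft D' V' * M.strainRight D' V' = D' ^ 2 * (f' * g') / s ^ 2 := by
    rw [Material.strainLeft, Material.strainRight, hf', hg', ← hs]; field_simp
  rw [e1, e2] at hmono
  have h1 : D' ^ 2 * (f' * g') ≤ D ^ 2 * (f * g) := by
    have : D' ^ 2 * (f' * g') / s ^ 2 ≤ D ^ 2 * (f * g) / s ^ 2 := by linarith
    rwa [div_le_div_iff_of_pos_right (by positivity)] at this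
  have hff' : f ≤ f' := by
    rw [hf, hf', div_le_div_iff₀ p3 p4]; nlinarith
  have hfF : f ≤ F := by
    rw [hf, hF, div_le_div_iff₀ p3 p5]; nlinarith
  have hf1 : 1 ≤ f := by rw [hf, one_le_div p3]; linarith
  have hg0 : 0 < g := by positivity
  have hg1 : g ≤ 1 := by rw [hg, div_le_one p1]; linarith
  have hgg : (M.c₁ - M.c₃) * (V' - V) / (4 * M.c₁ ^ 2) ≤ g' - g := by
    have : g' - g = (M.c₁ - M.c₃) * (V' - V) / ((M.c₁ + V) * (M.c₁ + V')) := by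
      rw [hg, hg']; field_simp; ring
    rw [this]
    apply div_le_div_of_nonneg_left (mul_nonneg (by linarith) (by linarith)) (by positivity)
    nlinarith
  have hgg0 : 0 ≤ g' - g := le_trans
    (div_nonneg (mul_nonneg (by linarith) (by linarith)) (by positivity)) hgg
  clear_value f f' F g g'
  have h2 : g' - g ≤ f' * g' - f * g := by
    have q1 := mul_le_mul_of_nonneg_right (hf1.trans hff') hgg0
    have q2 := mul_le_mul_of_nonneg_right hff' hg0.le
    linarith
  have h3 : D' ^ 2 * (f' * g' - f * g) ≤ (D ^ 2 - D' ^ 2) * (f * g) := by linarith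
  have h4 : (D ^ 2 - D' ^ 2) * (f * g) ≤ |D - D'| * (4 * d) * F := by
    have a1 : D ^ 2 - D' ^ 2 ≤ |D - D'| * (4 * d) := by
      have : D ^ 2 - D' ^ 2 = (D - D') * (D + D') := by ring
      rw [this]
      apply mul_le_mul (le_abs_self _) (by linarith [hD.2, hD'.2]) (by linarith [hD.1, hD'.1])
        (abs_nonneg _)
    have a2 : f * g ≤ F := (mul_le_of_le_one_right (by linarith) hg1).trans hfF
    have a3 : 0 ≤ f * g := by positivity
    calc (D ^ 2 - D' ^ 2) * (f * g) ≤ (|D - D'| * (4 * d)) * (f * g) :=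
          mul_le_mul_of_nonneg_right a1 a3
      _ ≤ _ := mul_le_mul_of_nonneg_left a2 (by positivity)
  have h5 : (d / 2) ^ 2 * ((M.c₁ - M.c₃) * (V' - V) / (4 * M.c₁ ^ 2)) ≤ |D - D'| * (4 * d) * F := by
    have b1 : (d / 2) ^ 2 ≤ D' ^ 2 := pow_le_pow_left₀ (by positivity) hD'.1 2
    have b2 : 0 ≤ (M.c₁ - M.c₃) * (V' - V) / (4 * M.c₁ ^ 2) :=
      div_nonneg (mul_nonneg (by linarith) (by linarith)) (by positivity)
    calc _ ≤ D' ^ 2 * (f' * g' - f * g) :=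
          mul_le_mul b1 (hgg.trans h2) b2 (by positivity)
      _ ≤ _ := h3.trans h4
  have hc13 : 0 < M.c₁ - M.c₃ := by linarith
  have hc1 := M.c₁_pos
  rw [div_mul_eq_mul_div, le_div_iff₀ (by positivity)]
  have h6 : (d / 2) ^ 2 * ((M.c₁ - M.c₃) * (V' - V) / (4 * M.c₁ ^ 2)) * (16 * M.c₁ ^ 2 / d) =
      (V' - V) * (d * (M.c₁ - M.c₃)) := by field_simp; ring
  have h7 : |D - D'| * (4 * d) * F * (16 * M.c₁ ^ 2 / d) = 64 * M.c₁ ^ 2 * F * |D - D'| := by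
    field_simp; ring
  rw [← h6, ← h7]
  exact mul_le_mul_of_nonneg_right h5 (by positivity)

/-- Two fixed speeds around `V₀` bracket a crossing strictly, and the bracket persists for nearby
jumps. Existence follows from `exists_kineticRelation`, the Lipschitz bound from `speed_sub_le`. The
bracket also keeps the speed away from c₃, where the right strain is singular. -/
theorem exists_localSolver_of_pos {M : Material} {φ : ℝ → ℝ} (hφ : IsDissipationFunction M φ)
    {D₀ V₀ : ℝ} (hD₀ : 0 < D₀) (hV₀ : V₀ ∈ Ioo (-M.c₃) M.c₃)
    (he₀ : KineticRelation φ V₀ (M.force D₀ V₀)) :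
    ∃ (V0 W : ℝ → ℝ) (η C : ℝ), 0 < η ∧ 0 ≤ C ∧
      IsLocalSolver M φ (Icc (D₀ - η) (D₀ + η)) C V0 W ∧
      W D₀ = M.strainRight D₀ V₀ ∧ V0 D₀ = V₀ := by
  have hc := M.c₃_lt_c₁
  have hc3 := M.c₃_pos
  -- The midpoints between `V₀` and the two ends of the subsonic range.
  set V₁ := (V₀ - M.c₃) / 2 with hV₁
  set V₂ := (V₀ + M.c₃) / 2 with hV₂
  have h₁ : -M.c₃ < V₁ := by linarith [hV₀.1]
  have h₂ : V₂ < M.c₃ := by linarith [hV₀.2]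
  have h₁₀ : V₁ < V₀ := by linarith [hV₀.1]
  have h₂₀ : V₀ < V₂ := by linarith [hV₀.2]
  have hcont : ∀ V, Continuous fun D => M.force D V := fun V => by
    unfold Material.force Material.strainLeft Material.strainRight
    simp only [div_eq_mul_inv]
    fun_prop
  have hev : ∀ᶠ D in 𝓝 D₀, φ V₁ < M.force D V₁ ∧ M.force D V₂ < φ V₂ ∧ D ∈ Ioo (D₀ / 2) (2 * D₀) := by
    refine ((hcont V₁).continuousAt.eventually (lt_mem_nhds ?_)).and
      (((hcont V₂).continuousAt.eventually (gt_mem_nhds ?_)).and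
      (Ioo_mem_nhds (by linarith) (by linarith)))
    · exact lt_of_le_of_lt (hφ.kineticRelation_mono ⟨h₁, by linarith⟩ hV₀ h₁₀
        (hφ.kineticRelation_self V₁) he₀) (Material.force_lt hD₀ h₁₀ h₁ hV₀.2)
    · exact lt_of_lt_of_le (Material.force_lt hD₀ h₂₀ hV₀.1 h₂) (hφ.kineticRelation_mono hV₀
        ⟨by linarith, h₂⟩ h₂₀ he₀ (hφ.kineticRelation_self V₂))
  obtain ⟨η, hη, hball⟩ := Metric.nhds_basis_closedBall.eventually_iff.1 hev
  rw [Real.closedBall_eq_Icc] at hball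
  have hex : ∀ D, ∃ V, D ∈ Icc (D₀ - η) (D₀ + η) →
      V ∈ Icc V₁ V₂ ∧ KineticRelation φ V (M.force D V) := by
    intro D
    by_cases hD : D ∈ Icc (D₀ - η) (D₀ + η)
    · obtain ⟨a1, a2, a3⟩ := hball hD
      have hDpos : 0 < D := by linarith [a3.1]
      obtain ⟨V, hV, hk⟩ := hφ.exists_kineticRelation h₁ h₂ (by linarith)
        (M.continuousOn_force D h₁ h₂) (fun x hx y hy hxy => by
          rcases hxy.eq_or_lt with rfl | hlt
          · exact le_rfl
          · exact (Material.force_lt hDpos hlt (h₁.trans_le hx.1) (hy.2.trans_lt h₂)).le)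
        a1.le a2.le
      exact ⟨V, fun _ => ⟨hV, hk⟩⟩
    · exact ⟨0, fun h => absurd h hD⟩
  choose V0 hV0 using hex
  set F := (M.c₁ - V₂) / (M.c₃ - V₂) with hF
  have hc13 : 0 < M.c₁ - M.c₃ := by linarith
  have hc1 := M.c₁_pos
  have p5 : 0 < M.c₃ - V₂ := by linarith
  have hF0 : 0 < F := div_pos (by linarith) p5
  set C₀ := 64 * M.c₁ ^ 2 * F / (D₀ * (M.c₁ - M.c₃)) with hC₀
  have hC₀0 : 0 ≤ C₀ := by positivity
  have hlip : ∀ D ∈ Icc (D₀ - η) (D₀ + η), ∀ D' ∈ Icc (D₀ - η) (D₀ + η),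
      |V0 D - V0 D'| ≤ C₀ * |D - D'| := by
    intro D hD D' hD'
    have b1 := (hball hD).2.2
    have b2 := (hball hD').2.2
    obtain ⟨c1, c2⟩ := hV0 D hD
    obtain ⟨d1, d2⟩ := hV0 D' hD'
    rcases lt_trichotomy (V0 D) (V0 D') with h | h | h
    · rw [abs_of_neg (by linarith), neg_sub]
      exact hφ.speed_sub_le hD₀ (Ioo_subset_Icc_self b1) (Ioo_subset_Icc_self b2)
        (h₁.trans_le c1.1) h d1.2 h₂ c2 d2
    · rw [h]; simp; positivity
    · rw [abs_of_pos (by linarith), abs_sub_comm]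
      exact hφ.speed_sub_le hD₀ (Ioo_subset_Icc_self b2) (Ioo_subset_Icc_self b1)
        (h₁.trans_le d1.1) h c1.2 h₂ d2 c2
  set G := (M.c₁ - M.c₃) / (M.c₃ - V₂) ^ 2 with hG
  have hG0 : 0 ≤ G := by positivity
  set C₁ := (F + 2 * D₀ * (G * C₀)) / (M.c₁ + M.c₃) with hC₁
  have hC₁0 : 0 ≤ C₁ := by positivity
  have hmemD₀ : D₀ ∈ Icc (D₀ - η) (D₀ + η) := ⟨by linarith, by linarith⟩
  have hVD₀ : V0 D₀ = V₀ := by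
    obtain ⟨c1, c2⟩ := hV0 D₀ hmemD₀
    exact hφ.kinetic_speed_unique hD₀ ⟨h₁.trans_le c1.1, c1.2.trans_lt h₂⟩ hV₀ c2 he₀
  refine ⟨V0, fun D => M.strainRight D (V0 D), η, C₀ + C₁, hη, by positivity,
    ⟨?_, ?_, ?_, ?_, ?_, ?_⟩, by simp only [hVD₀], hVD₀⟩
  · intro D hD D' hD'
    have : 0 ≤ C₁ * |D - D'| := by positivity
    linarith [hlip D hD D' hD']
  · intro D hD D' hD'
    have b2 := (hball hD').2.2
    have hVl := hlip D hD D' hD'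
    obtain ⟨c1, -⟩ := hV0 D hD
    obtain ⟨d1, -⟩ := hV0 D' hD'
    set V := V0 D
    set V' := V0 D'
    have p3 : 0 < M.c₃ - V := by linarith [c1.2]
    have p4 : 0 < M.c₃ - V' := by linarith [d1.2]
    have e1 : ∀ D V, M.strainRight D V = D * ((M.c₁ - V) / (M.c₃ - V)) / (M.c₁ + M.c₃) := by
      intro D V
      rw [Material.strainRight, mul_comm (M.c₁ + M.c₃), ← div_div, mul_div_assoc]
    simp only [e1]
    rw [← sub_div, abs_div, abs_of_pos (by linarith : 0 < M.c₁ + M.c₃)]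
    have hfF : |(M.c₁ - V) / (M.c₃ - V)| ≤ F := by
      rw [abs_of_pos (div_pos (by linarith) p3), hF, div_le_div_iff₀ p3 p5]; nlinarith [c1.2]
    have hff : |(M.c₁ - V) / (M.c₃ - V) - (M.c₁ - V') / (M.c₃ - V')| ≤ G * |V - V'| := by
      have : (M.c₁ - V) / (M.c₃ - V) - (M.c₁ - V') / (M.c₃ - V') =
          (M.c₁ - M.c₃) / ((M.c₃ - V) * (M.c₃ - V')) * (V - V') := by field_simp; ring
      rw [this, abs_mul, abs_of_pos (by positivity : 0 < (M.c₁ - M.c₃) / ((M.c₃ - V) * (M.c₃ - V')))]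
      apply mul_le_mul_of_nonneg_right _ (abs_nonneg _)
      rw [hG]
      apply div_le_div_of_nonneg_left hc13.le (by positivity)
      nlinarith [c1.2, d1.2]
    have h3 : |D * ((M.c₁ - V) / (M.c₃ - V)) - D' * ((M.c₁ - V') / (M.c₃ - V'))| ≤
        (F + 2 * D₀ * (G * C₀)) * |D - D'| := by
      have e : D * ((M.c₁ - V) / (M.c₃ - V)) - D' * ((M.c₁ - V') / (M.c₃ - V')) =
        (D - D') * ((M.c₁ - V) / (M.c₃ - V)) +
          D' * ((M.c₁ - V) / (M.c₃ - V) - (M.c₁ - V') / (M.c₃ - V')) := by ring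
      rw [e]
      refine (abs_add_le _ _).trans ?_
      rw [abs_mul, abs_mul, abs_of_pos (by linarith [b2.1] : 0 < D')]
      have t1 : |D - D'| * |(M.c₁ - V) / (M.c₃ - V)| ≤ |D - D'| * F :=
        mul_le_mul_of_nonneg_left hfF (abs_nonneg _)
      have t2 : G * |V - V'| ≤ G * (C₀ * |D - D'|) := mul_le_mul_of_nonneg_left hVl hG0
      have t3 : D' * |(M.c₁ - V) / (M.c₃ - V) - (M.c₁ - V') / (M.c₃ - V')| ≤
          (2 * D₀) * (G * (C₀ * |D - D'|)) :=
        mul_le_mul b2.2.le (hff.trans t2) (abs_nonneg _) (by linarith)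
      linarith
    calc _ ≤ (F + 2 * D₀ * (G * C₀)) * |D - D'| / (M.c₁ + M.c₃) :=
          div_le_div_of_nonneg_right h3 (by linarith)
      _ = C₁ * |D - D'| := by rw [hC₁]; ring
      _ ≤ _ := by
          have : 0 ≤ C₀ * |D - D'| := by positivity
          linarith
  · intro D hD _
    obtain ⟨c1, -⟩ := hV0 D hD
    exact ⟨h₁.trans_le c1.1, c1.2.trans_lt h₂⟩
  · intro D _ _; rfl
  · intro D hD _
    exact (hV0 D hD).2
  · intro D hD h0
    linarith [(hball hD).2.2.1]

/-! ### The sonic case: the right strain near the speed c₃. -/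

theorem ContDiffOn.exists_abs_sub_le {f : ℝ → ℝ} {a b : ℝ} (hf : ContDiffOn ℝ 1 f (Icc a b)) :
    ∃ L : ℝ, 0 ≤ L ∧ ∀ x ∈ Icc a b, ∀ y ∈ Icc a b, |f x - f y| ≤ L * |x - y| := by
  obtain ⟨K, hK⟩ := (hf.locallyLipschitzOn (convex_Icc a b)).exists_lipschitzOnWith_of_compact
    isCompact_Icc
  exact ⟨K, K.2, fun x hx y hy => by simpa [Real.dist_eq] using hK.dist_le_mul x hx y hy⟩

/-- The difference quotient at the right endpoint of a `C²` function is Lipschitz. -/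
theorem exists_lipschitz_slope {f : ℝ → ℝ} {a b : ℝ} (ha : a < b) {a' : ℝ} (ha' : a < a')
    (hf : ContDiffOn ℝ 2 f (Ioc a b)) :
    ∃ (θ : ℝ → ℝ) (L : ℝ), 0 ≤ L ∧ θ b = derivWithin f (Iic b) b ∧
      (∀ x ∈ Icc a' b, f b - f x = θ x * (b - x)) ∧
      ∀ x ∈ Icc a' b, ∀ y ∈ Icc a' b, |θ x - θ y| ≤ L * |x - y| := by
  set g := derivWithin f (Ioc a b) with hg
  have h2 : ContDiffOn ℝ (1 + 1) f (Ioc a b) := by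
    rw [one_add_one_eq_two]; exact hf
  rw [contDiffOn_succ_iff_derivWithin (uniqueDiffOn_Ioc a b)] at h2
  have hsub : Icc a' b ⊆ Ioc a b := fun x hx => ⟨ha'.trans_le hx.1, hx.2⟩
  have hfd : ∀ x ∈ Ioc a b, HasDerivWithinAt f (g x) (Ioc a b) x := fun x hx =>
    (h2.1 x hx).hasDerivWithinAt
  obtain ⟨L, hL, hgL⟩ := (h2.2.2.mono hsub).exists_abs_sub_le
  have hd : derivWithin f (Iic b) b = g b := by
    refine HasDerivWithinAt.derivWithin ?_ (uniqueDiffWithinAt_Iic b)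
    exact (hfd b ⟨ha, le_rfl⟩).mono_of_mem_nhdsWithin (Ioc_mem_nhdsLE ha)
  set θ : ℝ → ℝ := fun x => if x < b then (f b - f x) / (b - x) else g b with hθ
  -- The slope is the mean over t in [0, 1] of the derivative at x + t(b - x). Writing it as an
  -- increment `F 1 - F 0` lets the mean value inequality, applied to the difference of two such
  -- functions, carry the Lipschitz bound over from the derivative.
  have hex : ∀ x ∈ Icc a' b, ∃ F : ℝ → ℝ, F 1 - F 0 = θ x ∧ ∀ t ∈ Icc (0 : ℝ) 1,
      HasDerivWithinAt F (g (x + t * (b - x))) (Icc 0 1) t := by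
    intro x hx
    rcases hx.2.lt_or_eq with h | h
    · have hbx : b - x ≠ 0 := by linarith
      refine ⟨fun t => f (x + t * (b - x)) / (b - x), ?_, fun t ht => ?_⟩
      · simp only [hθ, if_pos h]
        rw [← sub_div]; ring_nf
      · have hmem : ∀ t ∈ Icc (0 : ℝ) 1, x + t * (b - x) ∈ Ioc a b := fun t ht =>
          hsub ⟨by nlinarith [ht.1, hx.1], by nlinarith [ht.2]⟩
        have hl : HasDerivWithinAt (fun t : ℝ => x + t * (b - x)) (b - x) (Icc 0 1) t := by
          have := ((hasDerivAt_id t).mul_const (b - x)).const_add x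
          simpa using this.hasDerivWithinAt
        have := ((hfd _ (hmem t ht)).comp t hl hmem).div_const (b - x)
        rwa [mul_div_assoc, div_self hbx, mul_one] at this
    · refine ⟨fun t => t * g b, by simp [hθ, h], fun t _ => ?_⟩
      rw [h, sub_self, mul_zero, add_zero]
      simpa using ((hasDerivAt_id t).mul_const (g b)).hasDerivWithinAt
  refine ⟨θ, L, hL, by simp [hθ, hd], fun x hx => ?_, fun x hx y hy => ?_⟩
  · rcases hx.2.lt_or_eq with h | h
    · simp only [hθ, if_pos h]
      rw [div_mul_cancel₀ _ (by linarith)]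
    · simp [h]
  · obtain ⟨F, hF, hF'⟩ := hex x hx
    obtain ⟨G, hG, hG'⟩ := hex y hy
    have := norm_image_sub_le_of_norm_deriv_le_segment_01' (f := fun t => F t - G t)
      (C := L * |x - y|) (fun t ht => (hF' t ht).sub (hG' t ht)) (fun t ht => by
        rw [Real.norm_eq_abs]
        refine (hgL _ ⟨by nlinarith [ht.1, hx.1, hx.2], by nlinarith [ht.2, hx.2]⟩ _
          ⟨by nlinarith [ht.1, hy.1, hy.2], by nlinarith [ht.2, hy.2]⟩).trans ?_
        apply mul_le_mul_of_nonneg_left _ hL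
        have e : x + t * (b - x) - (y + t * (b - y)) = (1 - t) * (x - y) := by ring
        rw [e, abs_mul, abs_of_nonneg (by linarith [ht.2])]
        exact mul_le_of_le_one_left (abs_nonneg _) (by linarith [ht.1]))
    rw [Real.norm_eq_abs] at this
    convert this using 2
    linarith

theorem exists_mul_abs_sub_le {f g : ℝ → ℝ} {a b Lf Lg : ℝ} (hLf : 0 ≤ Lf) (hLg : 0 ≤ Lg)
    (hf : ∀ x ∈ Icc a b, ∀ y ∈ Icc a b, |f x - f y| ≤ Lf * |x - y|)
    (hg : ∀ x ∈ Icc a b, ∀ y ∈ Icc a b, |g x - g y| ≤ Lg * |x - y|) :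
    ∃ L : ℝ, 0 ≤ L ∧ ∀ x ∈ Icc a b, ∀ y ∈ Icc a b, |f x * g x - f y * g y| ≤ L * |x - y| := by
  rcases lt_or_ge b a with hab | hab
  · exact ⟨0, le_rfl, fun x hx => absurd (hx.1.trans hx.2) (not_le.2 hab)⟩
  have hb : b ∈ Icc a b := ⟨hab, le_rfl⟩
  have bound : ∀ {h : ℝ → ℝ} {L : ℝ}, 0 ≤ L →
      (∀ x ∈ Icc a b, ∀ y ∈ Icc a b, |h x - h y| ≤ L * |x - y|) →
      ∀ x ∈ Icc a b, |h x| ≤ |h b| + L * (b - a) := by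
    intro h L hL hh x hx
    have h1 := hh x hx b hb
    have h2 : |x - b| ≤ b - a := by rw [abs_sub_comm, abs_of_nonneg (by linarith [hx.2])]; linarith [hx.1]
    have h3 := mul_le_mul_of_nonneg_left h2 hL
    have h4 := abs_sub_abs_le_abs_sub (h x) (h b)
    linarith
  have hab' : 0 ≤ b - a := by linarith
  refine ⟨(|g b| + Lg * (b - a)) * Lf + (|f b| + Lf * (b - a)) * Lg, by positivity,
    fun x hx y hy => ?_⟩
  have e : f x * g x - f y * g y = g x * (f x - f y) + f y * (g x - g y) := by ring
  rw [e]
  refine (abs_add_le _ _).trans ?_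
  rw [abs_mul, abs_mul]
  have t1 := mul_le_mul (bound hLg hg x hx) (hf x hx y hy) (abs_nonneg _) (by positivity)
  have t2 := mul_le_mul (bound hLf hf y hy) (hg x hx y hy) (abs_nonneg _) (by positivity)
  linarith

theorem continuousOn_of_abs_sub_le {f : ℝ → ℝ} {s : Set ℝ} {L : ℝ} (hL : 0 ≤ L)
    (hf : ∀ x ∈ s, ∀ y ∈ s, |f x - f y| ≤ L * |x - y|) : ContinuousOn f s :=
  (LipschitzOnWith.of_dist_le_mul (K := ⟨L, hL⟩) fun x hx y hy => by
    rw [Real.dist_eq, Real.dist_eq]; exact hf x hx y hy).continuousOn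

theorem abs_sqrt_sub_sqrt_le {a b m : ℝ} (hm : 0 < m) (ha : m ^ 2 ≤ a) (hb : m ^ 2 ≤ b) :
    |√a - √b| ≤ |a - b| / (2 * m) := by
  have h1 : m ≤ √a := Real.le_sqrt_of_sq_le ha
  have h2 : m ≤ √b := Real.le_sqrt_of_sq_le hb
  have e : a - b = (√a - √b) * (√a + √b) := by
    have e1 := Real.sq_sqrt ((sq_nonneg m).trans ha)
    have e2 := Real.sq_sqrt ((sq_nonneg m).trans hb)
    linear_combination e2 - e1
  rw [le_div_iff₀ (by positivity), e, abs_mul, abs_of_nonneg (by positivity : 0 ≤ √a + √b)]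
  exact mul_le_mul_of_nonneg_left (by linarith) (abs_nonneg _)

/-- At V = c₃ the second term of `psiMax` vanishes. The value is the driving force of a boundary
whose left strain is zero. -/
theorem IsDissipationFunction.apply_c₃ {M : Material} {φ : ℝ → ℝ}
    (hφ : IsDissipationFunction M φ) : φ M.c₃ = (M.k₁ - M.k₃) / 2 * (M.wM * M.wm) := by
  have hc := M.c₃_pos
  have h1 : Tendsto φ (𝓝[<] M.c₃) (𝓝 (φ M.c₃)) :=
    (hφ.contDiff_pos.continuousOn M.c₃ ⟨hc, le_rfl⟩).mono_left
      (nhdsWithin_le_iff.2 (mem_of_superset (Ioo_mem_nhdsLT hc) Ioo_subset_Ioc_self))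
  rw [tendsto_nhds_unique h1 hφ.lim_c₃, Material.psiMax, M.k₃_eq]
  simp; ring

/-- The right strain of a subsonic phase boundary close to the sonic speed, as a function of the
speed. -/
theorem IsDissipationFunction.exists_sonic_strain {M : Material} {φ : ℝ → ℝ}
    (hφ : IsDissipationFunction M φ) {w₀ : ℝ} (hw₀ : 0 < w₀)
    (hw : w₀ = √(derivWithin φ (Iic M.c₃) M.c₃ / M.c₃)) :
    ∃ (ω : ℝ → ℝ) (ρ L : ℝ), 0 < ρ ∧ ρ ≤ M.c₃ / 2 ∧ 0 ≤ L ∧ ω M.c₃ = w₀ ∧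
      (∀ V ∈ Icc (M.c₃ - ρ) M.c₃, w₀ / 2 ≤ ω V) ∧
      (∀ V ∈ Icc (M.c₃ - ρ) M.c₃, ∀ V' ∈ Icc (M.c₃ - ρ) M.c₃, |ω V - ω V'| ≤ L * |V - V'|) ∧
      ∀ V ∈ Icc (M.c₃ - ρ) M.c₃, φ V = (M.k₁ - M.k₃) / 2 *
        (M.wM * M.wm - ω V ^ 2 * ((M.c₃ - V) * (M.c₃ + V) / ((M.c₁ - V) * (M.c₁ + V)))) := by
  have hc := M.c₃_lt_c₁
  have hc3 := M.c₃_pos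
  have hc1 := M.c₁_pos
  have hk : 0 < M.k₁ - M.k₃ := by linarith [M.k₃_lt_k₁]
  obtain ⟨θ, L₁, hL₁, hθ0, hθ, hθL⟩ := exists_lipschitz_slope hc3
    (half_pos hc3) hφ.contDiff_pos
  -- In the kinetic relation the left strain is the right strain times (c₃² - V²)/(c₁² - V²).
  -- Subtracting the relation at c₃ and dividing by c₃ - V gives the squared right strain as `θ V *
  -- A V`.
  set A : ℝ → ℝ := fun V => 2 / (M.k₁ - M.k₃) * ((M.c₁ - V) * (M.c₁ + V)) / (M.c₃ + V) with hA
  have hAc : ContDiffOn ℝ 1 A (Icc (M.c₃ / 2) M.c₃) := by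
    refine ContDiffOn.div (by fun_prop) (by fun_prop) fun V hV => ?_
    have : 0 < M.c₃ + V := by linarith [hV.1]
    exact this.ne'
  obtain ⟨L₂, hL₂, hAL⟩ := hAc.exists_abs_sub_le
  obtain ⟨L₃, hL₃, hg⟩ := exists_mul_abs_sub_le hL₁ hL₂ hθL hAL
  have hd : 0 < derivWithin φ (Iic M.c₃) M.c₃ / M.c₃ := by
    rw [hw] at hw₀; exact Real.sqrt_pos.1 hw₀
  have hw2 : w₀ ^ 2 = derivWithin φ (Iic M.c₃) M.c₃ / M.c₃ := by rw [hw, Real.sq_sqrt hd.le]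
  have hk' : M.k₁ - M.k₃ = (M.c₁ - M.c₃) * (M.c₁ + M.c₃) := by rw [M.k₁_eq, M.k₃_eq]; ring
  have h13 : 0 < M.c₁ - M.c₃ := by linarith
  -- This is where the prescribed value of `w₀` is needed: the strain determined by the kinetic
  -- relation tends to it at the sonic speed.
  have hgc : θ M.c₃ * A M.c₃ = w₀ ^ 2 := by
    rw [hθ0, hw2, hA]
    simp only [hk']
    field_simp
    ring
  -- Small enough for `θ V * A V` to stay above a quarter of its sonic value, so that the square
  -- root is Lipschitz.
  set ρ := min (M.c₃ / 2) (w₀ ^ 2 / (2 * (L₃ + 1))) with hρ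
  have hρ1 : ρ ≤ M.c₃ / 2 := min_le_left _ _
  have hρ2 : ρ ≤ w₀ ^ 2 / (2 * (L₃ + 1)) := min_le_right _ _
  have hρ0 : 0 < ρ := lt_min (by positivity) (by positivity)
  have hsub : ∀ V ∈ Icc (M.c₃ - ρ) M.c₃, V ∈ Icc (M.c₃ / 2) M.c₃ := fun V hV =>
    ⟨by linarith [hV.1], hV.2⟩
  have hcm : M.c₃ ∈ Icc (M.c₃ / 2) M.c₃ := ⟨by linarith, le_rfl⟩
  have hlow : ∀ V ∈ Icc (M.c₃ - ρ) M.c₃, (w₀ / 2) ^ 2 ≤ θ V * A V := by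
    intro V hV
    have h1 := hg V (hsub V hV) M.c₃ hcm
    rw [hgc] at h1
    have h2 : |V - M.c₃| ≤ ρ := by
      rw [abs_sub_comm, abs_of_nonneg (by linarith [hV.2])]; linarith [hV.1]
    have h3 := mul_le_mul_of_nonneg_left h2 hL₃
    have h4 : (L₃ + 1) * ρ ≤ w₀ ^ 2 / 2 := by
      have := mul_le_mul_of_nonneg_left hρ2 (by linarith : 0 ≤ L₃ + 1)
      refine this.trans (le_of_eq ?_)
      field_simp
    have h5 := (abs_le.1 h1).1
    nlinarith
  refine ⟨fun V => √(θ V * A V), ρ, L₃ / w₀, hρ0, hρ1, by positivity, ?_, ?_, ?_, ?_⟩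
  · simp only [hgc]; exact Real.sqrt_sq hw₀.le
  · intro V hV
    exact Real.le_sqrt_of_sq_le (hlow V hV)
  · intro V hV V' hV'
    refine (abs_sqrt_sub_sqrt_le (half_pos hw₀) (hlow V hV) (hlow V' hV')).trans ?_
    rw [mul_div_cancel₀ _ two_ne_zero, div_mul_eq_mul_div]
    exact div_le_div_of_nonneg_right (hg V (hsub V hV) V' (hsub V' hV')) hw₀.le
  · intro V hV
    simp only
    rw [Real.sq_sqrt ((sq_nonneg _).trans (hlow V hV))]
    have h1 := hθ V (hsub V hV)
    rw [hφ.apply_c₃] at h1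
    have p1 : 0 < M.c₁ - V := by linarith [hV.2]
    have p2 : 0 < M.c₁ + V := by linarith [(hsub V hV).1]
    have p3 : 0 < M.c₃ + V := by linarith [(hsub V hV).1]
    have h2 : (M.k₁ - M.k₃) / 2 * (θ V * A V *
        ((M.c₃ - V) * (M.c₃ + V) / ((M.c₁ - V) * (M.c₁ + V)))) = θ V * (M.c₃ - V) := by
      rw [hA]; simp only; field_simp
    rw [mul_sub, h2]
    linarith

/-- The jump is written as a function of the speed, D = ω(V)(c₁ + c₃)(c₃ - V)/(c₁ - V). Near c₃ this
function expands distances by a fixed factor, so its inverse is Lipschitz, and the strain ω(V(D))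
extends without singularity to D = 0. -/
theorem exists_localSolver_of_sonic {M : Material} {φ : ℝ → ℝ} (hφ : IsDissipationFunction M φ)
    {w₀ : ℝ} (hw₀ : 0 < w₀) (hw : w₀ = √(derivWithin φ (Iic M.c₃) M.c₃ / M.c₃)) :
    ∃ (V0 W : ℝ → ℝ) (η C : ℝ), 0 < η ∧ 0 ≤ C ∧
      IsLocalSolver M φ (Icc (0 - η) (0 + η)) C V0 W ∧ W 0 = w₀ := by
  have hc := M.c₃_lt_c₁
  have hc3 := M.c₃_pos
  have hc1 := M.c₁_pos
  obtain ⟨ω, ρ₁, L, hρ₁0, hρ₁, hL, hω0, hωl, hωL, hωφ⟩ := hφ.exists_sonic_strain hw₀ hw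
  set s := M.c₁ + M.c₃ with hs
  have hs0 : 0 < s := by linarith
  set δ := M.c₁ - M.c₃ with hδ
  have hδ0 : 0 < δ := by linarith
  set κ := s * δ / M.c₁ ^ 2 with hκ
  have hκ0 : 0 < κ := by positivity
  -- The factor `ℓ` expands distances by at least `κ`. The radius makes `ℓ` so small that the
  -- variation of `ω` consumes at most half of this expansion.
  set ρ := min ρ₁ (w₀ * κ * δ / (4 * s * (L + 1))) with hρdef
  have hρ0 : 0 < ρ := lt_min hρ₁0 (by positivity)
  have hρle : ρ ≤ ρ₁ := min_le_left _ _
  have hρ2 : ρ ≤ w₀ * κ * δ / (4 * s * (L + 1)) := min_le_right _ _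
  rw [le_div_iff₀ (by positivity)] at hρ2
  set J := Icc (M.c₃ - ρ) M.c₃ with hJ
  have hsub : ∀ V ∈ J, V ∈ Icc (M.c₃ - ρ₁) M.c₃ := fun V hV => ⟨by linarith [hV.1], hV.2⟩
  have hcJ : M.c₃ ∈ J := ⟨by linarith, le_rfl⟩
  set ℓ : ℝ → ℝ := fun V => s * (M.c₃ - V) / (M.c₁ - V) with hℓ
  have hp : ∀ V ∈ J, 0 < M.c₁ - V ∧ 0 < V ∧ 0 ≤ M.c₃ - V := fun V hV =>
    ⟨by linarith [hV.2], by linarith [hV.1], by linarith [hV.2]⟩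
  have hℓ1 : ∀ V ∈ J, ∀ V' ∈ J, κ * |V - V'| ≤ |ℓ V - ℓ V'| := by
    intro V hV V' hV'
    obtain ⟨a1, a2, a3⟩ := hp V hV
    obtain ⟨b1, b2, b3⟩ := hp V' hV'
    have e : ℓ V - ℓ V' = s * δ / ((M.c₁ - V) * (M.c₁ - V')) * (V' - V) := by
      rw [hℓ]; simp only; rw [hδ]; field_simp; ring
    rw [e, abs_mul, abs_of_pos (by positivity : 0 < s * δ / ((M.c₁ - V) * (M.c₁ - V'))),
      abs_sub_comm V']
    apply mul_le_mul_of_nonneg_right _ (abs_nonneg _)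
    apply div_le_div_of_nonneg_left (by positivity) (by positivity)
    nlinarith
  have hℓ2 : ∀ V ∈ J, 0 ≤ ℓ V ∧ ℓ V ≤ s * ρ / δ := by
    intro V hV
    obtain ⟨a1, a2, a3⟩ := hp V hV
    refine ⟨by simp only [hℓ]; positivity, ?_⟩
    simp only [hℓ]
    apply div_le_div₀ (by positivity) _ hδ0 (by linarith [hV.2])
    exact mul_le_mul_of_nonneg_left (by linarith [hV.1]) hs0.le
  set Dv : ℝ → ℝ := fun V => ω V * ℓ V with hDv
  have hsmall : s * ρ / δ * L ≤ w₀ * κ / 4 := by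
    rw [div_mul_eq_mul_div, div_le_iff₀ hδ0]
    nlinarith [mul_pos hs0 hρ0]
  have hDlow : ∀ V ∈ J, ∀ V' ∈ J, w₀ * κ / 4 * |V - V'| ≤ |Dv V - Dv V'| := by
    intro V hV V' hV'
    have e : Dv V - Dv V' = ω V * (ℓ V - ℓ V') + ℓ V' * (ω V - ω V') := by
      simp only [hDv]; ring
    have h1 := hωl V (hsub V hV)
    have h2 := hωL V (hsub V hV) V' (hsub V' hV')
    have h3 := hℓ1 V hV V' hV'
    obtain ⟨h4, h5⟩ := hℓ2 V' hV'
    have t1 : w₀ / 2 * (κ * |V - V'|) ≤ |ω V * (ℓ V - ℓ V')| := by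
      rw [abs_mul, abs_of_nonneg (by linarith : 0 ≤ ω V)]
      exact mul_le_mul h1 h3 (by positivity) (by linarith)
    have t2 : |ℓ V' * (ω V - ω V')| ≤ w₀ * κ / 4 * |V - V'| := by
      rw [abs_mul, abs_of_nonneg h4]
      calc ℓ V' * |ω V - ω V'| ≤ (s * ρ / δ) * (L * |V - V'|) :=
            mul_le_mul h5 h2 (abs_nonneg _) (by positivity)
        _ = (s * ρ / δ * L) * |V - V'| := by ring
        _ ≤ _ := mul_le_mul_of_nonneg_right hsmall (abs_nonneg _)
    have t3 := abs_sub_abs_le_abs_add (ω V * (ℓ V - ℓ V')) (ℓ V' * (ω V - ω V'))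
    rw [e]
    linarith
  have hℓc : ContinuousOn ℓ J := by
    refine ContinuousOn.div (by fun_prop) (by fun_prop) fun V hV => (hp V hV).1.ne'
  have hDc : ContinuousOn Dv J :=
    ((continuousOn_of_abs_sub_le hL hωL).mono hsub).mul hℓc
  have hDc₃ : Dv M.c₃ = 0 := by simp [hDv, hℓ]
  set η := Dv (M.c₃ - ρ) with hη
  have hlJ : M.c₃ - ρ ∈ J := ⟨le_rfl, by linarith⟩
  have hη0 : 0 < η := by
    have h1 := hωl _ (hsub _ hlJ)
    have h2 : 0 < ℓ (M.c₃ - ρ) := by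
      simp only [hℓ]
      exact div_pos (mul_pos hs0 (by linarith)) (hp _ hlJ).1
    exact mul_pos (by linarith) h2
  have hivt := intermediate_value_Icc' (show M.c₃ - ρ ≤ M.c₃ by linarith) hDc
  rw [hDc₃, ← hη] at hivt
  have hex : ∀ D, ∃ V, D ∈ Icc 0 η → V ∈ J ∧ Dv V = D := by
    intro D
    by_cases hD : D ∈ Icc 0 η
    · obtain ⟨V, hV, h⟩ := hivt hD
      exact ⟨V, fun _ => ⟨hV, h⟩⟩
    · exact ⟨0, fun h => absurd h hD⟩
  choose v hv using hex
  -- Truncating the jump at zero extends the speed by c₃, and the strain by `w₀`, to supersonic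
  -- jumps; truncation does not increase distances.
  have hmax : ∀ D ∈ Icc (0 - η) (0 + η), max D 0 ∈ Icc 0 η := fun D hD =>
    ⟨le_max_right _ _, max_le (by linarith [hD.2]) hη0.le⟩
  have hv0 : v 0 = M.c₃ := by
    obtain ⟨h1, h2⟩ := hv 0 ⟨le_rfl, hη0.le⟩
    have := hDlow _ h1 _ hcJ
    rw [h2, hDc₃, sub_self, abs_zero] at this
    have h3 : |v 0 - M.c₃| ≤ 0 := nonpos_of_mul_nonpos_right this (by positivity)
    linarith [abs_nonpos_iff.1 h3]
  have hvL : ∀ D ∈ Icc (0 - η) (0 + η), ∀ D' ∈ Icc (0 - η) (0 + η),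
      |v (max D 0) - v (max D' 0)| ≤ 4 / (w₀ * κ) * |D - D'| := by
    intro D hD D' hD'
    obtain ⟨h1, h2⟩ := hv _ (hmax D hD)
    obtain ⟨h3, h4⟩ := hv _ (hmax D' hD')
    have h5 := hDlow _ h1 _ h3
    rw [h2, h4] at h5
    have h6 : |max D 0 - max D' 0| ≤ |D - D'| := abs_max_sub_max_le_abs D D' 0
    rw [div_mul_eq_mul_div, le_div_iff₀ (by positivity)]
    linarith
  have hvJ : ∀ D ∈ Icc (0 - η) (0 + η), v (max D 0) ∈ J := fun D hD => (hv _ (hmax D hD)).1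
  have hpos : ∀ D ∈ Icc (0 - η) (0 + η), 0 < D → 0 < M.c₃ - v (max D 0) ∧
      M.strainRight D (v (max D 0)) = ω (v (max D 0)) := by
    intro D hD h0
    obtain ⟨h1, h2⟩ := hv _ (hmax D hD)
    obtain ⟨a1, a2, a3⟩ := hp _ h1
    rw [max_eq_left h0.le] at h2 a1 a2 a3 ⊢
    have a4 : 0 < M.c₃ - v D := by
      refine a3.lt_of_ne fun h => h0.ne' ?_
      rw [← h2]; simp [hDv, hℓ, ← h]
    refine ⟨a4, ?_⟩
    have hgen : ∀ V, 0 < M.c₁ - V → 0 < M.c₃ - V → M.strainRight (Dv V) V = ω V := by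
      intro V b1 b2
      rw [Material.strainRight, ← hs]
      simp only [hDv, hℓ]
      field_simp
    have := hgen (v D) a1 a4
    rwa [h2] at this
  refine ⟨fun D => v (max D 0), fun D => ω (v (max D 0)), η,
    4 / (w₀ * κ) + L * (4 / (w₀ * κ)), hη0, by positivity, ⟨?_, ?_, ?_, ?_, ?_, ?_⟩, ?_⟩
  · intro D hD D' hD'
    have h1 := hvL D hD D' hD'
    have : 0 ≤ L * (4 / (w₀ * κ)) * |D - D'| := by positivity
    linarith
  · intro D hD D' hD'
    have h1 := hvL D hD D' hD'
    have h2 := hωL _ (hsub _ (hvJ D hD)) _ (hsub _ (hvJ D' hD'))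
    have h3 := mul_le_mul_of_nonneg_left h1 hL
    have : 0 ≤ (4 / (w₀ * κ)) * |D - D'| := by positivity
    linarith
  · intro D hD h0
    have := (hpos D hD h0).1
    have := (hp _ (hvJ D hD)).2.1
    exact ⟨by linarith, by linarith⟩
  · intro D hD h0
    exact (hpos D hD h0).2.symm
  · intro D hD h0
    have h1 := hωφ _ (hsub _ (hvJ D hD))
    obtain ⟨h2, h3⟩ := hpos D hD h0
    obtain ⟨a1, a2, a3⟩ := hp _ (hvJ D hD)
    set V := v (max D 0) with hV
    refine ⟨fun _ => ?_, fun h => absurd h a2.ne'⟩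
    rw [h1, Material.force]
    have h4 : M.strainLeft D V = M.strainRight D V * ((M.c₃ - V) * (M.c₃ + V) /
        ((M.c₁ - V) * (M.c₁ + V))) := by
      have : 0 < M.c₁ + V := by linarith
      rw [Material.strainLeft, Material.strainRight, ← hs]
      field_simp
    rw [h4, h3]; ring
  · intro D hD h0
    simp only [max_eq_right h0, hv0]
  · simp only [max_self, hv0, hω0]

/-- The last two equalities say that the strains computed at the reference jump are those of the
reference states, so that boxes can be centred there. A supersonic boundary with zero jump has speed
c₃, so the characteristic assumption applies to it. -/
theorem exists_localSolver {M : Material} {φ : ℝ → ℝ} (hφ : IsDissipationFunction M φ)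
    {uLs uRs : State} {Fs : Fan} (huL : uLs ∈ M.phase1) (huR : uRs ∈ M.phase3)
    (hFs : IsRiemannSolution M φ uLs uRs Fs) (hum : Fs.um = uLs) (hup : Fs.up = uRs)
    (hchar : Fs.V = M.c₃ →
      uLs.2 = 0 ∧ uRs.2 = √(derivWithin φ (Iic M.c₃) M.c₃ / M.c₃)) :
    ∃ (V0 W : ℝ → ℝ) (η C : ℝ), 0 < η ∧ 0 ≤ C ∧
      IsLocalSolver M φ (Icc (M.invS uRs - M.invP uLs - η) (M.invS uRs - M.invP uLs + η)) C V0 W ∧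
      W (M.invS uRs - M.invP uLs) = uRs.2 ∧
      M.strainLeft (M.invS uRs - M.invP uLs)
        (M.boundarySpeed V0 (M.invS uRs - M.invP uLs) uRs.2) = uLs.2 := by
  have hw : 0 < uRs.2 := M.wm_pos.trans_le huR
  cases hFs with
  | phase1 u _ hr => exact absurd huR (Material.not_mem_phase3_of_mem_phase1 hr)
  | phase3 u hl => exact absurd hl (Material.not_mem_phase3_of_mem_phase1 huL)
  | subsonic um up V _ _ hm hp hV h1 h2 h3 hk =>
    simp only at hum hup
    subst hum hup
    obtain ⟨e1, e2, e3⟩ := Material.subsonic_data hm hp hV h2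
    rw [Material.drivingForce_eq hm.2 hp, e2, e3] at hk
    obtain ⟨V0, W, η, C, hη, hC, hsol, hW, hV0⟩ := exists_localSolver_of_pos hφ e1 hV hk
    refine ⟨V0, W, η, C, hη, hC, hsol, hW.trans e3.symm, ?_⟩
    rw [Material.boundarySpeed, if_pos e1, hV0, ← e2]
  | supersonic um V _ _ hm hV h1 h2 =>
    simp only at hum hchar
    subst hum
    obtain ⟨e1, e2, e3⟩ := Material.supersonic_data hm huR hV h2
    have hVs : ∀ V0, M.boundarySpeed V0 (M.invS uRs - M.invP um) uRs.2 = V := fun V0 => by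
      rw [Material.boundarySpeed, if_neg (not_lt.2 e1), ← e3]
    rcases e1.lt_or_eq with h | h
    · exact ⟨_, _, _, 0, by linarith, le_rfl, exists_localSolver_of_neg M φ h uRs.2, rfl,
        by rw [hVs, ← e2]⟩
    · have hVc : V = M.c₃ := by
        have hc := M.c₁_pos
        have hc3 := M.c₃_pos
        rw [e3, h, Material.supersonicSpeed]
        field_simp
        ring
      obtain ⟨V0, W, η, C, hη, hC, hsol, hW⟩ := exists_localSolver_of_sonic hφ hw (hchar hVc).2
      refine ⟨V0, W, η, C, hη, hC, ?_, ?_, by rw [hVs, ← e2]⟩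
      · rw [h]; exact hsol
      · rw [h]; exact hW

/-! ### A box of Riemann invariants that the scheme preserves. -/

namespace Material

variable {M : Material}

/-- The excess of a supersonic boundary speed over the sonic speed. -/
noncomputable def excessSpeed (M : Material) (D w : ℝ) : ℝ :=
  max (-D) 0 * (M.c₁ - M.c₃) / (w * (M.c₁ + M.c₃) + max (-D) 0)

theorem supersonicSpeed_eq_add {D w : ℝ} (hD : D ≤ 0) (hw : 0 < w) :
    M.supersonicSpeed D w = M.c₃ + M.excessSpeed D w := by
  have := M.c₁_pos
  have := M.c₃_pos
  have h1 : 0 < w * (M.c₁ + M.c₃) := by positivity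
  rw [supersonicSpeed, excessSpeed, max_eq_left (by linarith)]
  have h2 : w * (M.c₁ + M.c₃) + -D ≠ 0 := by linarith
  have h3 : w * (M.c₁ + M.c₃) - D ≠ 0 := by linarith
  rw [← sub_eq_add_neg]
  field_simp
  ring

/-- The excess is homogeneous enough in the jump that its dependence on the strain keeps the factor
`max (-D) 0`. This weight is what later makes the absorbed r-waves summable. -/
theorem excessSpeed_sub_le {D D' w w' m : ℝ} (hm : 0 < m) (hw : m ≤ w) (hw' : m ≤ w') :
    |M.excessSpeed D w - M.excessSpeed D' w'| ≤
      (M.c₁ - M.c₃) / (m * (M.c₁ + M.c₃)) * |D - D'| +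
      (M.c₁ - M.c₃) / (m ^ 2 * (M.c₁ + M.c₃)) * (max (-D) 0 * |w - w'|) := by
  have hc1 := M.c₁_pos
  have hc3 := M.c₃_pos
  have hδ : 0 < M.c₁ - M.c₃ := by linarith [M.c₃_lt_c₁]
  set δ := M.c₁ - M.c₃
  set s := M.c₁ + M.c₃ with hs
  have hs0 : 0 < s := by linarith
  set x := max (-D) 0 with hx
  set y := max (-D') 0 with hy
  have hx0 : 0 ≤ x := le_max_right _ _
  have hy0 : 0 ≤ y := le_max_right _ _
  have hxy : |x - y| ≤ |D - D'| := by
    have := abs_max_sub_max_le_abs (-D) (-D') 0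
    rwa [neg_sub_neg, abs_sub_comm D'] at this
  have hwp : 0 < w := hm.trans_le hw
  have hwp' : 0 < w' := hm.trans_le hw'
  have e : M.excessSpeed D w - M.excessSpeed D' w' =
      δ * (w * s) / ((w * s + x) * (w' * s + y)) * (x - y) +
      - (δ * s / ((w * s + x) * (w' * s + y)) * (x * (w - w'))) := by
    have h1 : 0 < w * s + x := by positivity
    have h2 : 0 < w' * s + y := by positivity
    rw [excessSpeed, excessSpeed]
    change x * δ / (w * s + x) - y * δ / (w' * s + y) = _
    field_simp
    ring
  rw [e]
  refine (abs_add_le _ _).trans (add_le_add ?_ ?_)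
  · rw [abs_mul, abs_of_nonneg (by positivity : 0 ≤ δ * (w * s) / ((w * s + x) * (w' * s + y)))]
    refine mul_le_mul ?_ hxy (abs_nonneg _) (by positivity)
    have h3 : δ * (w * s) / ((w * s + x) * (w' * s + y)) ≤ δ * (w * s) / ((w * s) * (m * s)) := by
      apply div_le_div_of_nonneg_left (by positivity) (by positivity)
      apply mul_le_mul (by linarith) _ (by positivity) (by positivity)
      nlinarith
    refine h3.trans (le_of_eq ?_)
    field_simp
  · rw [abs_neg, abs_mul, abs_mul x, abs_of_nonneg hx0,
      abs_of_nonneg (by positivity : 0 ≤ δ * s / ((w * s + x) * (w' * s + y)))]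
    refine mul_le_mul_of_nonneg_right ?_ (by positivity)
    have h3 : δ * s / ((w * s + x) * (w' * s + y)) ≤ δ * s / ((m * s) * (m * s)) := by
      apply div_le_div_of_nonneg_left (by positivity) (by positivity)
      apply mul_le_mul (by nlinarith) (by nlinarith) (by positivity) (by positivity)
    refine h3.trans (le_of_eq ?_)
    field_simp

theorem strainLeft_sub_le {D D' V V' : ℝ} (hV : -M.c₃ < V) (hV' : -M.c₃ < V') :
    |M.strainLeft D V - M.strainLeft D' V'| ≤
      1 / (M.c₁ + M.c₃) * (|D - D'| + |D'| / (M.c₁ - M.c₃) * |V - V'|) := by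
  have hc1 := M.c₁_pos
  have hc3 := M.c₃_pos
  have hδ : 0 < M.c₁ - M.c₃ := by linarith [M.c₃_lt_c₁]
  have h1 : 0 < M.c₁ + V := by linarith
  have h2 : 0 < M.c₁ + V' := by linarith
  have h3 : 0 < M.c₃ + V := by linarith
  have hs0 : 0 < M.c₁ + M.c₃ := by linarith
  have e : M.strainLeft D V - M.strainLeft D' V' = 1 / (M.c₁ + M.c₃) *
      ((M.c₃ + V) / (M.c₁ + V) * (D - D') +
        D' * ((M.c₁ - M.c₃) / ((M.c₁ + V) * (M.c₁ + V'))) * (V - V')) := by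
    rw [strainLeft, strainLeft]; field_simp; ring
  rw [e, abs_mul, abs_of_pos (by positivity : 0 < 1 / (M.c₁ + M.c₃))]
  apply mul_le_mul_of_nonneg_left _ (by positivity)
  refine (abs_add_le _ _).trans (add_le_add ?_ ?_)
  · rw [abs_mul, abs_of_pos (by positivity : 0 < (M.c₃ + V) / (M.c₁ + V))]
    exact mul_le_of_le_one_left (abs_nonneg _) ((div_le_one h1).2 (by linarith))
  · rw [abs_mul, abs_mul, abs_of_pos (by positivity : 0 < (M.c₁ - M.c₃) / ((M.c₁ + V) * (M.c₁ + V')))]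
    apply mul_le_mul_of_nonneg_right _ (abs_nonneg _)
    rw [div_eq_mul_inv |D'|]
    apply mul_le_mul_of_nonneg_left _ (abs_nonneg _)
    rw [div_le_iff₀ (by positivity), ← div_eq_inv_mul, le_div_iff₀ hδ]
    nlinarith

end Material

/-- A neighbourhood of a phase boundary, in Riemann invariants, that is stable under its
interactions with small waves. -/
structure IsStableBox (M : Material) (φ V0 W : ℝ → ℝ) (p₀ q₀ r₀ s₀ ε εq εr C : ℝ) : Prop where
  pos : 0 < ε
  le_q : ε ≤ εq
  le_r : ε ≤ εr
  nonneg : 0 ≤ C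
  mem1 : ∀ p q, |p - p₀| ≤ ε → |q - q₀| ≤ εq → M.state1 p q ∈ M.phase1
  mem3 : ∀ r s, |r - r₀| ≤ εr → |s - s₀| ≤ ε → M.state3 r s ∈ M.phase3
  left : ∀ p r s, |p - p₀| ≤ ε → |r - r₀| ≤ εr → |s - s₀| ≤ ε →
    |p + 2 * M.c₁ * M.strainLeft (s - p)
      (M.boundarySpeed V0 (s - p) ((s - r) / (2 * M.c₃))) - q₀| ≤ εq
  right : ∀ p s, |p - p₀| ≤ ε → |s - s₀| ≤ ε → |s - 2 * M.c₃ * W (s - p) - r₀| ≤ εr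
  speed_mem : ∀ p s, |p - p₀| ≤ ε → |s - s₀| ≤ ε → 0 < s - p → V0 (s - p) ∈ Ioo (-M.c₃) M.c₃
  strain_eq : ∀ p s, |p - p₀| ≤ ε → |s - s₀| ≤ ε → 0 < s - p →
    W (s - p) = M.strainRight (s - p) (V0 (s - p))
  kinetic : ∀ p s, |p - p₀| ≤ ε → |s - s₀| ≤ ε → 0 < s - p →
    KineticRelation φ (V0 (s - p)) (M.force (s - p) (V0 (s - p)))
  lip_strain : ∀ p s p' s', |p - p₀| ≤ ε → |s - s₀| ≤ ε → |p' - p₀| ≤ ε → |s' - s₀| ≤ ε →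
    |W (s - p) - W (s' - p')| ≤ C * |(s - p) - (s' - p')|
  lip_speed : ∀ p r s p' r' s', |p - p₀| ≤ ε → |r - r₀| ≤ εr → |s - s₀| ≤ ε →
    |p' - p₀| ≤ ε → |r' - r₀| ≤ εr → |s' - s₀| ≤ ε →
    |M.boundarySpeed V0 (s - p) ((s - r) / (2 * M.c₃)) -
      M.boundarySpeed V0 (s' - p') ((s' - r') / (2 * M.c₃))| ≤
    C * (|(s - p) - (s' - p')| + max (-(s - p)) 0 * |(s - r) / (2 * M.c₃) - (s' - r') / (2 * M.c₃)|)

-- The radii are determined without circularity: emitted r-values depend on p and s alone, which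
-- fixes `εr`; emitted q-values depend on p, s and r, which then fixes `εq`. Both are multiples of
-- `ε`, so a small `ε` keeps the strains in their phases, the reference strains being interior.
set_option maxHeartbeats 1000000 in
theorem IsLocalSolver.exists_stableBox {M : Material} {φ V0 W : ℝ → ℝ} {uLs uRs : State} {η C : ℝ}
    (hη : 0 < η) (hC : 0 ≤ C) (huL : uLs ∈ M.phase1) (hwL : uLs.2 < M.wM) (hwR : M.wm < uRs.2)
    (h : IsLocalSolver M φ
      (Icc (M.invS uRs - M.invP uLs - η) (M.invS uRs - M.invP uLs + η)) C V0 W)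
    (hW : W (M.invS uRs - M.invP uLs) = uRs.2)
    (hV : M.strainLeft (M.invS uRs - M.invP uLs)
      (M.boundarySpeed V0 (M.invS uRs - M.invP uLs) uRs.2) = uLs.2) :
    ∃ ε εq εr C' : ℝ, IsStableBox M φ V0 W (M.invP uLs) (M.invQ uLs) (M.invR uRs) (M.invS uRs)
      ε εq εr C' := by
  have hc1 := M.c₁_pos
  have hc3 := M.c₃_pos
  have hδ : 0 < M.c₁ - M.c₃ := by linarith [M.c₃_lt_c₁]
  have hs0 : 0 < M.c₁ + M.c₃ := by linarith
  have hwm := M.wm_pos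
  set p₀ := M.invP uLs with hp₀
  set q₀ := M.invQ uLs with hq₀
  set r₀ := M.invR uRs with hr₀
  set s₀ := M.invS uRs with hs₀
  set D₀ := s₀ - p₀ with hD₀
  set w₀ := uRs.2 with hw₀
  have hw₀eq : w₀ = (s₀ - r₀) / (2 * M.c₃) := by
    simp only [hs₀, hr₀, Material.invS, Material.invR]; field_simp; ring
  have hwLeq : q₀ = p₀ + 2 * M.c₁ * uLs.2 := by
    simp only [hq₀, hp₀, Material.invQ, Material.invP]; ring
  set I := Icc (D₀ - η) (D₀ + η) with hI
  -- The boundary speed is Lipschitz.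
  set C₁ := (M.c₁ - M.c₃) / (M.wm * (M.c₁ + M.c₃)) with hC₁
  set C₂ := (M.c₁ - M.c₃) / (M.wm ^ 2 * (M.c₁ + M.c₃)) with hC₂
  have hC₁0 : 0 ≤ C₁ := by positivity
  have hC₂0 : 0 ≤ C₂ := by positivity
  -- The excess vanishes for D ≥ 0 and `V0` equals c₃ for D ≤ 0, so one sum covers both regimes and
  -- the estimate crosses D = 0 without cases.
  have hsplit : ∀ D ∈ I, ∀ w, M.wm ≤ w → M.boundarySpeed V0 D w = V0 D + M.excessSpeed D w := by
    intro D hD w hw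
    rw [Material.boundarySpeed]
    split_ifs with h0
    · rw [Material.excessSpeed, max_eq_right (by linarith)]; simp
    · rw [Material.supersonicSpeed_eq_add (not_lt.1 h0) (hwm.trans_le hw),
        h.speed_of_nonpos D hD (not_lt.1 h0)]
  have hVl : ∀ D ∈ I, ∀ D' ∈ I, ∀ w, M.wm ≤ w → ∀ w', M.wm ≤ w' →
      |M.boundarySpeed V0 D w - M.boundarySpeed V0 D' w'| ≤
        (C + C₁ + C₂) * (|D - D'| + max (-D) 0 * |w - w'|) := by
    intro D hD D' hD' w hw w' hw'
    rw [hsplit D hD w hw, hsplit D' hD' w' hw']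
    have h1 := h.lip_speed D hD D' hD'
    have h2 := Material.excessSpeed_sub_le (M := M) (D := D) (D' := D') hwm hw hw'
    rw [← hC₁, ← hC₂] at h2
    have e : V0 D + M.excessSpeed D w - (V0 D' + M.excessSpeed D' w') =
      (V0 D - V0 D') + (M.excessSpeed D w - M.excessSpeed D' w') := by ring
    rw [e]
    refine (abs_add_le _ _).trans ?_
    have h3 : 0 ≤ max (-D) 0 * |w - w'| := mul_nonneg (le_max_right _ _) (abs_nonneg _)
    have h4 : 0 ≤ C₂ * |D - D'| := by positivity
    have h5 : 0 ≤ (C + C₁) * (max (-D) 0 * |w - w'|) := by positivity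
    linarith
  have hVpos : ∀ D ∈ I, ∀ w, M.wm ≤ w → -M.c₃ < M.boundarySpeed V0 D w := by
    intro D hD w hw
    rw [Material.boundarySpeed]
    split_ifs with h0
    · exact (h.speed_mem D hD h0).1
    · have := (Material.supersonicSpeed_spec (M := M) (not_lt.1 h0) (hwm.trans_le hw)).1.1
      linarith
  have hDI : D₀ ∈ I := ⟨by linarith, by linarith⟩
  -- Radii, as multiples of `ε`.
  set Kr := 1 + 4 * M.c₃ * C with hKr
  set Kw := (1 + Kr) / (2 * M.c₃) with hKw
  set CV := (C + C₁ + C₂) with hCV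
  set KV := CV * (2 + (max (-D₀) 0) * Kw) with hKV
  set KL := 1 / (M.c₁ + M.c₃) * (2 + |D₀| / (M.c₁ - M.c₃) * KV) with hKL
  set Kq := 1 + 2 * M.c₁ * KL with hKq
  set Kl := (Kq + 1) / (2 * M.c₁) with hKl
  have hm0 : 0 ≤ max (-D₀) 0 := le_max_right _ _
  have hKr1 : 1 ≤ Kr := by have : 0 ≤ 4 * M.c₃ * C := by positivity
                           linarith
  have hKw0 : 0 < Kw := by positivity
  have hCV0 : 0 ≤ CV := by positivity
  have hKV0 : 0 ≤ KV := by positivity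
  have hKL0 : 0 ≤ KL := by positivity
  have hKq1 : 1 ≤ Kq := by have : 0 ≤ 2 * M.c₁ * KL := by positivity
                           linarith
  have hKl0 : 0 < Kl := by positivity
  have hL1 : 0 < M.wM - uLs.2 := by linarith
  have hL2 : 0 < uLs.2 + 1 := by linarith [huL.1]
  have hR1 : 0 < w₀ - M.wm := by linarith
  -- The first bound keeps the jump in the interval of the local solver, the second keeps phase 3
  -- above `wm`, the last two keep phase 1 between -1 and `wM`.
  obtain ⟨ε, hε0, hε1, hε2, hε3, hε4⟩ : ∃ ε : ℝ, 0 < ε ∧ 2 * ε ≤ η ∧ Kw * ε ≤ w₀ - M.wm ∧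
      Kl * ε ≤ M.wM - uLs.2 ∧ Kl * ε < uLs.2 + 1 := by
    refine ⟨min (min (η / 2) ((w₀ - M.wm) / Kw)) (min ((M.wM - uLs.2) / Kl)
      ((uLs.2 + 1) / (2 * Kl))), by positivity, ?_, ?_, ?_, ?_⟩
    · have := (min_le_left (min (η / 2) ((w₀ - M.wm) / Kw)) (min ((M.wM - uLs.2) / Kl)
        ((uLs.2 + 1) / (2 * Kl)))).trans (min_le_left _ _)
      linarith
    · rw [← le_div_iff₀' hKw0]
      exact (min_le_left _ _).trans (min_le_right _ _)
    · rw [← le_div_iff₀' hKl0]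
      exact (min_le_right _ _).trans (min_le_left _ _)
    · rw [← lt_div_iff₀' hKl0]
      refine ((min_le_right _ _).trans (min_le_right _ _)).trans_lt ?_
      exact div_lt_div_of_pos_left hL2 hKl0 (by linarith)
  have hDm : ∀ p s, |p - p₀| ≤ ε → |s - s₀| ≤ ε → |s - p - D₀| ≤ 2 * ε := by
    intro p s hp hs
    have e : s - p - D₀ = (s - s₀) - (p - p₀) := by rw [hD₀]; ring
    rw [e]
    exact (abs_sub _ _).trans (by linarith)
  have hDmem : ∀ p s, |p - p₀| ≤ ε → |s - s₀| ≤ ε → s - p ∈ I := by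
    intro p s hp hs
    have := abs_le.1 (hDm p s hp hs)
    exact ⟨by linarith [this.1], by linarith [this.2]⟩
  have hwm' : ∀ r s, |r - r₀| ≤ Kr * ε → |s - s₀| ≤ ε → |(s - r) / (2 * M.c₃) - w₀| ≤ Kw * ε := by
    intro r s hr hs
    have e : (s - r) / (2 * M.c₃) - w₀ = ((s - s₀) - (r - r₀)) / (2 * M.c₃) := by
      rw [hw₀eq]; ring
    rw [e, abs_div, abs_of_pos (by positivity : 0 < 2 * M.c₃), hKw, div_mul_eq_mul_div]
    apply div_le_div_of_nonneg_right _ (by positivity)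
    exact (abs_sub _ _).trans (by linarith)
  have hwge : ∀ r s, |r - r₀| ≤ Kr * ε → |s - s₀| ≤ ε → M.wm ≤ (s - r) / (2 * M.c₃) := by
    intro r s hr hs
    have := (abs_le.1 (hwm' r s hr hs)).1
    linarith
  refine ⟨ε, Kq * ε, Kr * ε, max C CV, hε0, by nlinarith, by nlinarith, hC.trans (le_max_left _ _),
    ?_, ?_, ?_, ?_, ?_, ?_, ?_, ?_, ?_⟩
  · intro p q hp hq
    have e : (q - p) / (2 * M.c₁) - uLs.2 = ((q - q₀) - (p - p₀)) / (2 * M.c₁) := by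
      rw [hwLeq]; field_simp; ring
    have h1 : |(q - p) / (2 * M.c₁) - uLs.2| ≤ Kl * ε := by
      rw [e, abs_div, abs_of_pos (by positivity : 0 < 2 * M.c₁), hKl, div_mul_eq_mul_div]
      apply div_le_div_of_nonneg_right _ (by positivity)
      exact (abs_sub _ _).trans (by linarith)
    rw [abs_le] at h1
    exact ⟨by simp only [Material.state1]; linarith [h1.1],
      by simp only [Material.state1]; linarith [h1.2]⟩
  · intro r s hr hs
    exact hwge r s hr hs
  · intro p r s hp hr hs
    have hw := hwge r s hr hs
    have hD := hDmem p s hp hs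
    have v1 := hVl D₀ hDI (s - p) hD w₀ hwR.le _ hw
    have v2 : |M.boundarySpeed V0 (s - p) ((s - r) / (2 * M.c₃)) - M.boundarySpeed V0 D₀ w₀| ≤
        KV * ε := by
      rw [abs_sub_comm]
      refine v1.trans ?_
      rw [hKV, mul_assoc]
      apply mul_le_mul_of_nonneg_left _ hCV0
      rw [abs_sub_comm D₀, abs_sub_comm w₀]
      have a1 := mul_le_mul_of_nonneg_left (hwm' r s hr hs) hm0
      have a2 := hDm p s hp hs
      linarith
    have v3 := Material.strainLeft_sub_le (D := s - p) (D' := D₀) (hVpos _ hD _ hw)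
      (hVpos _ hDI _ hwR.le)
    have v4 : |M.strainLeft (s - p) (M.boundarySpeed V0 (s - p) ((s - r) / (2 * M.c₃))) - uLs.2| ≤
        KL * ε := by
      rw [← hV]
      refine v3.trans ?_
      rw [hKL, mul_assoc]
      apply mul_le_mul_of_nonneg_left _ (by positivity)
      have a1 := mul_le_mul_of_nonneg_left v2 (by positivity : 0 ≤ |D₀| / (M.c₁ - M.c₃))
      have a2 := hDm p s hp hs
      linarith
    have e : p + 2 * M.c₁ * M.strainLeft (s - p)
        (M.boundarySpeed V0 (s - p) ((s - r) / (2 * M.c₃))) - q₀ = (p - p₀) + 2 * M.c₁ *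
        (M.strainLeft (s - p) (M.boundarySpeed V0 (s - p) ((s - r) / (2 * M.c₃))) - uLs.2) := by
      rw [hwLeq]; ring
    rw [e]
    refine (abs_add_le _ _).trans ?_
    rw [abs_mul, abs_of_pos (by positivity : 0 < 2 * M.c₁)]
    have a1 := mul_le_mul_of_nonneg_left v4 (by positivity : 0 ≤ 2 * M.c₁)
    linarith
  · intro p s hp hs
    have h1 := h.lip_strain _ (hDmem p s hp hs) _ hDI
    rw [hW] at h1
    have e : s - 2 * M.c₃ * W (s - p) - r₀ = (s - s₀) - 2 * M.c₃ * (W (s - p) - w₀) := by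
      have : r₀ = s₀ - 2 * M.c₃ * w₀ := by rw [hw₀eq]; field_simp; ring
      rw [this]; ring
    rw [e]
    refine (abs_sub _ _).trans ?_
    rw [abs_mul, abs_of_pos (by positivity : 0 < 2 * M.c₃)]
    have a1 := mul_le_mul_of_nonneg_left (hDm p s hp hs) hC
    have a2 := mul_le_mul_of_nonneg_left (h1.trans a1) (by positivity : 0 ≤ 2 * M.c₃)
    linarith
  · intro p s hp hs h0
    exact h.speed_mem _ (hDmem p s hp hs) h0
  · intro p s hp hs h0
    exact h.strain_eq _ (hDmem p s hp hs) h0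
  · intro p s hp hs h0
    exact h.kinetic _ (hDmem p s hp hs) h0
  · intro p s p' s' hp hs hp' hs'
    refine (h.lip_strain _ (hDmem p s hp hs) _ (hDmem p' s' hp' hs')).trans ?_
    exact mul_le_mul_of_nonneg_right (le_max_left _ _) (abs_nonneg _)
  · intro p r s p' r' s' hp hr hs hp' hr' hs'
    refine (hVl _ (hDmem p s hp hs) _ (hDmem p' s' hp' hs') _ (hwge r s hr hs) _
      (hwge r' s' hr' hs')).trans ?_
    refine mul_le_mul_of_nonneg_right (le_max_right _ _) ?_
    have : 0 ≤ max (-(s - p)) 0 := le_max_right _ _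
    positivity

/-! ### The scheme as a dynamics of four sequences seen from the boundary. -/

/-- Remove the first entry of a sequence. -/
def seqTail (x : ℕ → ℝ) (k : ℕ) : ℝ := x (k + 1)

/-- Add a first entry to a sequence. -/
def seqCons (c : ℝ) (x : ℕ → ℝ) : ℕ → ℝ
  | 0 => c
  | k + 1 => x k

/-- The values of Glimm's scheme at one time, in Riemann invariants, seen from the phase boundary
at the node `m`: the sequences run away from the boundary. -/
structure Frame where
  m : ℤ
  p : ℕ → ℝ
  q : ℕ → ℝ
  r : ℕ → ℝ
  s : ℕ → ℝ

namespace Frame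

/-- The jump of the incoming invariants at the boundary. -/
def jump (F : Frame) : ℝ := F.s 0 - F.p 0

/-- The strain in the cell on the right of the boundary. -/
noncomputable def strain (M : Material) (F : Frame) : ℝ := (F.s 0 - F.r 0) / (2 * M.c₃)

/-- The speed of the boundary. -/
noncomputable def speed (M : Material) (V0 : ℝ → ℝ) (F : Frame) : ℝ :=
  M.boundarySpeed V0 F.jump (F.strain M)

/-- The left-moving invariant emitted by the boundary. -/
noncomputable def emitLeft (M : Material) (V0 : ℝ → ℝ) (F : Frame) : ℝ :=
  F.p 0 + 2 * M.c₁ * M.strainLeft F.jump (F.speed M V0)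

/-- The right-moving invariant emitted by the boundary. -/
noncomputable def emitRight (M : Material) (W : ℝ → ℝ) (F : Frame) : ℝ :=
  F.s 0 - 2 * M.c₃ * W F.jump

/-- One step of the scheme, with sampling speed `b`. -/
noncomputable def step (M : Material) (V0 W : ℝ → ℝ) (b : ℝ) (F : Frame) : Frame where
  m := F.m + if b ≤ F.speed M V0 then 1 else -1
  -- Entries are indexed from the new node. A tail means that the boundary has absorbed the first
  -- wave of the family; a cons means that an emitted value has entered the cells.
  p := if F.speed M V0 < b ∧ b ≤ M.c₁ then seqTail F.p else F.p
  q := if -M.c₁ < b ∧ b ≤ F.speed M V0 then seqCons (F.emitLeft M V0) F.q else F.q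
  r := if F.speed M V0 < b ∧ b ≤ M.c₃ then seqCons (F.emitRight M W) F.r
    else if M.c₃ < b ∧ b ≤ F.speed M V0 then seqTail F.r else F.r
  s := if -M.c₃ < b ∧ b ≤ F.speed M V0 then seqTail F.s else F.s

/-- The values lie in a given box. -/
def InBox (F : Frame) (p₀ q₀ r₀ s₀ ε εq εr : ℝ) : Prop :=
  ∀ k, |F.p k - p₀| ≤ ε ∧ |F.q k - q₀| ≤ εq ∧ |F.r k - r₀| ≤ εr ∧ |F.s k - s₀| ≤ ε

/-- The frame describes the cell values `g`. -/
def Represents (M : Material) (F : Frame) (g : ℤ → State) : Prop :=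
  ∀ k : ℕ, g (F.m - 2 - 2 * k) = M.state1 (F.p k) (F.q k) ∧
    g (F.m + 2 * k) = M.state3 (F.r k) (F.s k)

end Frame

section Box

variable {M : Material} {φ V0 W : ℝ → ℝ} {p₀ q₀ r₀ s₀ ε εq εr C : ℝ}

/-- This dichotomy links the regime to the sign of the jump throughout the box; in particular
emission into phase 3, which needs a speed below c₃, happens only for positive jumps. -/
theorem IsStableBox.speed_cases (B : IsStableBox M φ V0 W p₀ q₀ r₀ s₀ ε εq εr C) {F : Frame}
    (hF : F.InBox p₀ q₀ r₀ s₀ ε εq εr) :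
    (0 < F.jump ∧ F.speed M V0 ∈ Ioo (-M.c₃) M.c₃) ∨
      (F.jump ≤ 0 ∧ F.speed M V0 ∈ Ico M.c₃ M.c₁) := by
  obtain ⟨hp, -, hr, hs⟩ := hF 0
  rcases lt_or_ge 0 F.jump with h | h
  · refine Or.inl ⟨h, ?_⟩
    rw [Frame.speed, Material.boundarySpeed, if_pos h]
    exact B.speed_mem _ _ hp hs h
  · refine Or.inr ⟨h, ?_⟩
    rw [Frame.speed, Material.boundarySpeed, if_neg (not_lt.2 h)]
    exact (Material.supersonicSpeed_spec h (M.wm_pos.trans_le (B.mem3 _ _ hr hs))).1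

theorem IsStableBox.speed_mem_Ioo (B : IsStableBox M φ V0 W p₀ q₀ r₀ s₀ ε εq εr C) {F : Frame}
    (hF : F.InBox p₀ q₀ r₀ s₀ ε εq εr) : F.speed M V0 ∈ Ioo (-M.c₃) M.c₁ := by
  have := M.c₃_pos
  have := M.c₃_lt_c₁
  rcases B.speed_cases hF with ⟨-, h⟩ | ⟨-, h⟩
  · exact ⟨h.1, by linarith [h.2]⟩
  · exact ⟨by linarith [h.1], h.2⟩

/-- Old values are only moved, and the two kinds of new values obey `left` and `right`, whose bounds
need nothing but membership in the box. Hence the box is invariant for all times with no loss. -/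
theorem IsStableBox.step_inBox (B : IsStableBox M φ V0 W p₀ q₀ r₀ s₀ ε εq εr C) {F : Frame}
    (hF : F.InBox p₀ q₀ r₀ s₀ ε εq εr) (b : ℝ) :
    (F.step M V0 W b).InBox p₀ q₀ r₀ s₀ ε εq εr := by
  obtain ⟨hp, hq, hr, hs⟩ := hF 0
  intro k
  refine ⟨?_, ?_, ?_, ?_⟩
  · simp only [Frame.step]
    split_ifs
    · exact (hF (k + 1)).1
    · exact (hF k).1
  · simp only [Frame.step]
    split_ifs
    · cases k with
      | zero => exact B.left _ _ _ hp hr hs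
      | succ k => exact (hF k).2.1
    · exact (hF k).2.1
  · simp only [Frame.step]
    split_ifs
    · cases k with
      | zero => exact B.right _ _ hp hs
      | succ k => exact (hF k).2.2.1
    · exact (hF (k + 1)).2.2.1
    · exact (hF k).2.2.1
  · simp only [Frame.step]
    split_ifs
    · exact (hF (k + 1)).2.2.2
    · exact (hF k).2.2.2

theorem IsStableBox.phase1_iff (B : IsStableBox M φ V0 W p₀ q₀ r₀ s₀ ε εq εr C) {F : Frame}
    (hF : F.InBox p₀ q₀ r₀ s₀ ε εq εr) (i j : ℕ) (G : Fan) :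
    IsRiemannSolution M φ (M.state1 (F.p i) (F.q i)) (M.state1 (F.p j) (F.q j)) G ↔
      G = ⟨M.state1 (F.p i) (F.q j), M.state1 (F.p i) (F.q j), -M.c₁, 0, M.c₁⟩ := by
  have := Material.isRiemannSolution_phase1_iff (M := M) (φ := φ)
    (B.mem1 _ _ (hF i).1 (hF i).2.1) (B.mem1 _ _ (hF j).1 (hF j).2.1)
    (by simpa using B.mem1 _ _ (hF i).1 (hF j).2.1) G
  simpa using this

theorem IsStableBox.phase3_iff (B : IsStableBox M φ V0 W p₀ q₀ r₀ s₀ ε εq εr C) {F : Frame}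
    (hF : F.InBox p₀ q₀ r₀ s₀ ε εq εr) (i j : ℕ) (G : Fan) :
    IsRiemannSolution M φ (M.state3 (F.r i) (F.s i)) (M.state3 (F.r j) (F.s j)) G ↔
      G = ⟨M.state3 (F.r i) (F.s j), M.state3 (F.r i) (F.s j), -M.c₃, 0, M.c₃⟩ := by
  have := Material.isRiemannSolution_phase3_iff (M := M) (φ := φ)
    (B.mem3 _ _ (hF i).2.2.1 (hF i).2.2.2) (B.mem3 _ _ (hF j).2.2.1 (hF j).2.2.2)
    (by simpa using B.mem3 _ _ (hF i).2.2.1 (hF j).2.2.2) G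
  simpa using this

/-- The Riemann solution at the phase boundary. -/
noncomputable def Frame.fan (M : Material) (V0 W : ℝ → ℝ) (F : Frame) : Fan :=
  ⟨M.state1 (F.p 0) (F.emitLeft M V0),
    if 0 < F.jump then M.state3 (F.emitRight M W) (F.s 0) else M.state3 (F.r 0) (F.s 0),
    -M.c₁, F.speed M V0, if 0 < F.jump then M.c₃ else F.speed M V0⟩

theorem Frame.fan_eq (F : Frame) : F.fan M V0 W =
    M.boundaryFan V0 W (M.state1 (F.p 0) (F.q 0)) (M.state3 (F.r 0) (F.s 0)) := by
  simp only [Material.boundaryFan, Material.invP_state1, Material.invS_state3, Frame.fan]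
  rfl

theorem IsStableBox.fan_um_mem (B : IsStableBox M φ V0 W p₀ q₀ r₀ s₀ ε εq εr C) {F : Frame}
    (hF : F.InBox p₀ q₀ r₀ s₀ ε εq εr) : (F.fan M V0 W).um ∈ M.phase1 := by
  obtain ⟨hp, hq, hr, hs⟩ := hF 0
  exact B.mem1 _ _ hp (B.left _ _ _ hp hr hs)

theorem IsStableBox.fan_up_mem (B : IsStableBox M φ V0 W p₀ q₀ r₀ s₀ ε εq εr C) {F : Frame}
    (hF : F.InBox p₀ q₀ r₀ s₀ ε εq εr) : (F.fan M V0 W).up ∈ M.phase3 := by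
  obtain ⟨hp, hq, hr, hs⟩ := hF 0
  simp only [Frame.fan]
  split_ifs
  · exact B.mem3 _ _ (B.right _ _ hp hs) hs
  · exact B.mem3 _ _ hr hs

theorem IsStableBox.boundary_iff (B : IsStableBox M φ V0 W p₀ q₀ r₀ s₀ ε εq εr C)
    (hφ : IsDissipationFunction M φ) {F : Frame} (hF : F.InBox p₀ q₀ r₀ s₀ ε εq εr) (G : Fan) :
    IsRiemannSolution M φ (M.state1 (F.p 0) (F.q 0)) (M.state3 (F.r 0) (F.s 0)) G ↔
      G = F.fan M V0 W := by
  obtain ⟨hp, hq, hr, hs⟩ := hF 0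
  have h1 := B.fan_um_mem hF
  have h2 := B.fan_up_mem hF
  rw [Frame.fan_eq] at h1 h2 ⊢
  refine Material.isRiemannSolution_boundary_iff hφ (B.mem1 _ _ hp hq) (B.mem3 _ _ hr hs) ?_ h1 h2 G
  simp only [Material.invP_state1, Material.invS_state3]
  exact fun h0 => ⟨B.speed_mem _ _ hp hs h0, B.strain_eq _ _ hp hs h0, B.kinetic _ _ hp hs h0⟩

theorem Fan.eval_sample (F : Fan) (ul ur : State) {h lam a : ℝ} (hh : 0 < h) (hlam : 0 < lam) :
    F.eval ul ur (h / lam) (a * h) = if lam * a ≤ F.sl then ul else if lam * a ≤ F.V then F.um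
      else if lam * a ≤ F.sr then F.up else ur := by
  have key : ∀ c : ℝ, a * h ≤ c * (h / lam) ↔ lam * a ≤ c := by
    intro c
    rw [← mul_div_assoc, le_div_iff₀ hlam]
    constructor
    · intro hle; nlinarith
    · intro hle; nlinarith
  simp only [Fan.eval, key]

/-- Linearity of the phase decouples the sampling: p is decided by the wave of speed c₁ and q by the
wave of speed -c₁. -/
theorem IsStableBox.sample_phase1 (B : IsStableBox M φ V0 W p₀ q₀ r₀ s₀ ε εq εr C) {F : Frame}
    (hF : F.InBox p₀ q₀ r₀ s₀ ε εq εr) {h lam a : ℝ} (hh : 0 < h) (hlam : 0 < lam) (i j : ℕ) :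
    (riemann M φ (M.state1 (F.p i) (F.q i)) (M.state1 (F.p j) (F.q j))).eval
      (M.state1 (F.p i) (F.q i)) (M.state1 (F.p j) (F.q j)) (h / lam) (a * h) =
    M.state1 (if lam * a ≤ M.c₁ then F.p i else F.p j)
      (if lam * a ≤ -M.c₁ then F.q i else F.q j) := by
  have := M.c₁_pos
  rw [Material.riemann_eq (B.phase1_iff hF i j), Fan.eval_sample _ _ _ hh hlam]
  simp only
  split_ifs <;> first | rfl | (exfalso; linarith)

theorem IsStableBox.sample_phase3 (B : IsStableBox M φ V0 W p₀ q₀ r₀ s₀ ε εq εr C) {F : Frame}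
    (hF : F.InBox p₀ q₀ r₀ s₀ ε εq εr) {h lam a : ℝ} (hh : 0 < h) (hlam : 0 < lam) (i j : ℕ) :
    (riemann M φ (M.state3 (F.r i) (F.s i)) (M.state3 (F.r j) (F.s j))).eval
      (M.state3 (F.r i) (F.s i)) (M.state3 (F.r j) (F.s j)) (h / lam) (a * h) =
    M.state3 (if lam * a ≤ M.c₃ then F.r i else F.r j)
      (if lam * a ≤ -M.c₃ then F.s i else F.s j) := by
  have := M.c₃_pos
  rw [Material.riemann_eq (B.phase3_iff hF i j), Fan.eval_sample _ _ _ hh hlam]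
  simp only
  split_ifs <;> first | rfl | (exfalso; linarith)

/-- One formula serves both regimes: for a supersonic boundary a sample on its right exceeds c₃, so
the branch with the emitted value is never taken. -/
theorem IsStableBox.sample_boundary (B : IsStableBox M φ V0 W p₀ q₀ r₀ s₀ ε εq εr C)
    (hφ : IsDissipationFunction M φ) {F : Frame} (hF : F.InBox p₀ q₀ r₀ s₀ ε εq εr)
    {h lam a : ℝ} (hh : 0 < h) (hlam : 0 < lam) :
    (riemann M φ (M.state1 (F.p 0) (F.q 0)) (M.state3 (F.r 0) (F.s 0))).eval
      (M.state1 (F.p 0) (F.q 0)) (M.state3 (F.r 0) (F.s 0)) (h / lam) (a * h) =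
    if lam * a ≤ F.speed M V0 then
      M.state1 (F.p 0) (if lam * a ≤ -M.c₁ then F.q 0 else F.emitLeft M V0)
    else M.state3 (if lam * a ≤ M.c₃ then F.emitRight M W else F.r 0) (F.s 0) := by
  have := M.c₁_pos
  have := M.c₃_pos
  have := M.c₃_lt_c₁
  rw [Material.riemann_eq (B.boundary_iff hφ hF), Fan.eval_sample _ _ _ hh hlam]
  rcases B.speed_cases hF with ⟨h1, h2, h3⟩ | ⟨h1, h2, h3⟩
  · simp only [Frame.fan, if_pos h1]
    split_ifs <;> first | rfl | (exfalso; linarith)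
  · simp only [Frame.fan, if_neg (not_lt.2 h1)]
    split_ifs <;> first | rfl | (exfalso; linarith)

/-- Glimm's scheme, seen from the phase boundary. -/
theorem IsStableBox.step_represents (B : IsStableBox M φ V0 W p₀ q₀ r₀ s₀ ε εq εr C)
    (hφ : IsDissipationFunction M φ) {F : Frame} (hF : F.InBox p₀ q₀ r₀ s₀ ε εq εr)
    {u₀ : ℝ → State} {a : ℕ → ℝ} {h lam : ℝ} (hh : 0 < h) (hlam : 0 < lam) {n : ℕ}
    (hg : F.Represents M (glimmGrid M φ u₀ lam a h n)) :
    (F.step M V0 W (lam * a (n + 1))).Represents M (glimmGrid M φ u₀ lam a h (n + 1)) := by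
  have hc1 := M.c₁_pos
  have hc3 := M.c₃_pos
  have hc := M.c₃_lt_c₁
  obtain ⟨hVl, hVr⟩ := B.speed_mem_Ioo hF
  set g := glimmGrid M φ u₀ lam a h n with hgdef
  set b := lam * a (n + 1) with hb
  have hsucc : ∀ m, glimmGrid M φ u₀ lam a h (n + 1) m =
      (riemann M φ (g (m - 1)) (g (m + 1))).eval (g (m - 1)) (g (m + 1)) (h / lam)
        (a (n + 1) * h) := fun m => rfl
  have hL : ∀ k : ℕ, ∀ m : ℤ, m = F.m - 2 - 2 * k → g m = M.state1 (F.p k) (F.q k) :=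
    fun k m hm => by rw [hm]; exact (hg k).1
  have hR : ∀ k : ℕ, ∀ m : ℤ, m = F.m + 2 * k → g m = M.state3 (F.r k) (F.s k) :=
    fun k m hm => by rw [hm]; exact (hg k).2
  intro k
  -- The node moves right if the sample falls left of the boundary, and left otherwise. The first
  -- cell on the node's new far side comes from the boundary fan, all others from problems inside
  -- one phase.
  by_cases hbV : b ≤ F.speed M V0
  · have hn : ¬ (F.speed M V0 < b ∧ b ≤ M.c₁) := fun hh => absurd hbV (not_le.2 hh.1)
    have hn' : ¬ (F.speed M V0 < b ∧ b ≤ M.c₃) := fun hh => absurd hbV (not_le.2 hh.1)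
    simp only [Frame.step, if_neg hn, if_neg hn', hbV, and_true]
    constructor
    · cases k with
      | zero =>
        rw [hsucc, hL 0 _ (by push_cast; ring), hR 0 _ (by push_cast; ring),
          B.sample_boundary hφ hF hh hlam, if_pos hbV]
        by_cases h1 : b ≤ -M.c₁
        · rw [if_pos h1, if_neg (not_lt.2 h1)]
        · rw [if_neg h1, if_pos (not_le.1 h1)]; rfl
      | succ k =>
        rw [hsucc, hL (k + 1) _ (by push_cast; ring), hL k _ (by push_cast; ring),
          B.sample_phase1 hF hh hlam, if_pos (by linarith)]
        by_cases h1 : b ≤ -M.c₁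
        · rw [if_pos h1, if_neg (not_lt.2 h1)]
        · rw [if_neg h1, if_pos (not_le.1 h1)]; rfl
    · rw [hsucc, hR k _ (by push_cast; ring), hR (k + 1) _ (by push_cast; ring),
        B.sample_phase3 hF hh hlam]
      congr 1
      · by_cases h1 : b ≤ M.c₃
        · rw [if_pos h1, if_neg (not_lt.2 h1)]
        · rw [if_neg h1, if_pos (not_le.1 h1)]; rfl
      · by_cases h1 : b ≤ -M.c₃
        · rw [if_pos h1, if_neg (not_lt.2 h1)]
        · rw [if_neg h1, if_pos (not_le.1 h1)]; rfl
  · have hbV' : F.speed M V0 < b := not_le.1 hbV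
    simp only [Frame.step, hbV, hbV', and_false, true_and, if_false]
    constructor
    · rw [hsucc, hL (k + 1) _ (by push_cast; ring), hL k _ (by ring),
        B.sample_phase1 hF hh hlam]
      congr 1
      · split_ifs <;> rfl
      · rw [if_neg (by linarith)]
    · cases k with
      | zero =>
        rw [hsucc, hL 0 _ (by push_cast; ring), hR 0 _ (by push_cast; ring),
          B.sample_boundary hφ hF hh hlam, if_neg hbV]
        congr 1
        split_ifs <;> rfl
      | succ k =>
        rw [hsucc, hR k _ (by push_cast; ring), hR (k + 1) _ (by push_cast; ring),
          B.sample_phase3 hF hh hlam]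
        congr 1
        · split_ifs <;> rfl
        · rw [if_neg (by linarith)]

end Box

/-! ### Bounded variation in time of the boundary speed. -/

/-- The evolution of a frame under the scheme. -/
noncomputable def Frame.evolve (M : Material) (V0 W : ℝ → ℝ) (b : ℕ → ℝ) (F : Frame) : ℕ → Frame
  | 0 => F
  | n + 1 => (Frame.evolve M V0 W b F n).step M V0 W (b (n + 1))

/-- The total variation of a sequence is at most `L`. -/
def SeqVariationLE (x : ℕ → ℝ) (L : ℝ) : Prop :=
  ∀ K, ∑ k ∈ Finset.range K, |x (k + 1) - x k| ≤ L

theorem SeqVariationLE.nonneg {x : ℕ → ℝ} {L : ℝ} (h : SeqVariationLE x L) : 0 ≤ L := by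
  simpa using h 0

/-- The budget drops by exactly the change of the first entry, so the changes seen at the boundary
over all times are paid from the initial variation. -/
theorem SeqVariationLE.tail {x : ℕ → ℝ} {L : ℝ} (h : SeqVariationLE x L) :
    SeqVariationLE (seqTail x) (L - |seqTail x 0 - x 0|) := fun K => by
  have := h (K + 1)
  rw [Finset.sum_range_succ'] at this
  simp only [seqTail]
  linarith

theorem SeqVariationLE.cons {x : ℕ → ℝ} {L : ℝ} (h : SeqVariationLE x L) (c : ℝ) :
    SeqVariationLE (seqCons c x) (L + |x 0 - c|) := fun K => by
  cases K with
  | zero => simpa using add_nonneg h.nonneg (abs_nonneg _)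
  | succ K =>
    rw [Finset.sum_range_succ']
    exact add_le_add_left (h K) _

section Variation

variable {M : Material} {φ V0 W : ℝ → ℝ} {p₀ q₀ r₀ s₀ ε εq εr C : ℝ}

theorem IsStableBox.evolve_inBox (B : IsStableBox M φ V0 W p₀ q₀ r₀ s₀ ε εq εr C) {F : Frame}
    (hF : F.InBox p₀ q₀ r₀ s₀ ε εq εr) (b : ℕ → ℝ) (n : ℕ) :
    (F.evolve M V0 W b n).InBox p₀ q₀ r₀ s₀ ε εq εr := by
  induction n with
  | zero => exact hF
  | succ n ih => exact B.step_inBox ih _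

/-- No p-wave is ever emitted: the first entry changes only by absorption, which uses up variation
of the sequence. -/
theorem Frame.sum_p_le {F : Frame} {L : ℝ} (h : SeqVariationLE F.p L) (b : ℕ → ℝ) (n : ℕ) :
    ∑ k ∈ Finset.range n, |(F.evolve M V0 W b (k + 1)).p 0 - (F.evolve M V0 W b k).p 0| ≤ L := by
  have key : SeqVariationLE (F.evolve M V0 W b n).p (L - ∑ k ∈ Finset.range n,
      |(F.evolve M V0 W b (k + 1)).p 0 - (F.evolve M V0 W b k).p 0|) := by
    induction n with
    | zero => simpa [Frame.evolve] using h
    | succ n ih =>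
      rw [Finset.sum_range_succ, ← sub_sub]
      generalize (∑ k ∈ Finset.range n,
        |(F.evolve M V0 W b (k + 1)).p 0 - (F.evolve M V0 W b k).p 0|) = S at ih ⊢
      simp only [Frame.evolve, Frame.step]
      split_ifs
      · exact ih.tail
      · simpa using ih
  linarith [key.nonneg]

theorem Frame.sum_s_le {F : Frame} {L : ℝ} (h : SeqVariationLE F.s L) (b : ℕ → ℝ) (n : ℕ) :
    ∑ k ∈ Finset.range n, |(F.evolve M V0 W b (k + 1)).s 0 - (F.evolve M V0 W b k).s 0| ≤ L := by
  have key : SeqVariationLE (F.evolve M V0 W b n).s (L - ∑ k ∈ Finset.range n,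
      |(F.evolve M V0 W b (k + 1)).s 0 - (F.evolve M V0 W b k).s 0|) := by
    induction n with
    | zero => simpa [Frame.evolve] using h
    | succ n ih =>
      rw [Finset.sum_range_succ, ← sub_sub]
      generalize (∑ k ∈ Finset.range n,
        |(F.evolve M V0 W b (k + 1)).s 0 - (F.evolve M V0 W b k).s 0|) = S at ih ⊢
      simp only [Frame.evolve, Frame.step]
      split_ifs
      · exact ih.tail
      · simpa using ih
  linarith [key.nonneg]

theorem Frame.sum_jump_le {F : Frame} {L : ℝ} (hp : SeqVariationLE F.p L)
    (hs : SeqVariationLE F.s L) (b : ℕ → ℝ) (n : ℕ) :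
    ∑ k ∈ Finset.range n,
      |(F.evolve M V0 W b (k + 1)).jump - (F.evolve M V0 W b k).jump| ≤ 2 * L := by
  have h1 := Frame.sum_p_le (M := M) (V0 := V0) (W := W) hp b n
  have h2 := Frame.sum_s_le (M := M) (V0 := V0) (W := W) hs b n
  have h3 : ∑ k ∈ Finset.range n,
      |(F.evolve M V0 W b (k + 1)).jump - (F.evolve M V0 W b k).jump| ≤
      ∑ k ∈ Finset.range n, (|(F.evolve M V0 W b (k + 1)).s 0 - (F.evolve M V0 W b k).s 0| +
        |(F.evolve M V0 W b (k + 1)).p 0 - (F.evolve M V0 W b k).p 0|) := by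
    refine Finset.sum_le_sum fun k _ => ?_
    simp only [Frame.jump]
    rw [sub_sub_sub_comm]
    exact abs_sub _ _
  rw [Finset.sum_add_distrib] at h3
  linarith

/-- The waves absorbed by the boundary, weighted by the negative part of the incoming jump. -/
theorem IsStableBox.sum_absorbed_le (B : IsStableBox M φ V0 W p₀ q₀ r₀ s₀ ε εq εr C) {F : Frame}
    (hF : F.InBox p₀ q₀ r₀ s₀ ε εq εr) {L : ℝ} (hp : SeqVariationLE F.p L)
    (hr : SeqVariationLE F.r L) (hs : SeqVariationLE F.s L) (b : ℕ → ℝ) (n : ℕ) :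
    ∑ k ∈ Finset.range n, max (-(F.evolve M V0 W b k).jump) 0 *
        |(F.evolve M V0 W b (k + 1)).r 0 - (F.evolve M V0 W b k).r 0| ≤
      (|s₀ - p₀| + 2 * ε) * L + (L + 2 * εr + (L + 2 * M.c₃ * (C * (2 * L)))) * (2 * L) := by
  have hc3 := M.c₃_pos
  have hC := B.nonneg
  set G := F.evolve M V0 W b with hG
  have hbox : ∀ k, (G k).InBox p₀ q₀ r₀ s₀ ε εq εr := fun k => B.evolve_inBox hF b k
  have hL0 := hp.nonneg
  have hJ := fun n => Frame.sum_jump_le (M := M) (V0 := V0) (W := W) hp hs b n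
  have hS := fun n => Frame.sum_s_le (M := M) (V0 := V0) (W := W) hs b n
  rw [← hG] at hJ hS
  -- The value that a subsonic boundary would emit has bounded variation in time, in whichever
  -- regime the boundary is, being Lipschitz in p and s.
  have hR : ∀ n, ∑ k ∈ Finset.range n, |(G (k + 1)).emitRight M W - (G k).emitRight M W| ≤
      L + 2 * M.c₃ * (C * (2 * L)) := by
    intro n
    have h1 : ∑ k ∈ Finset.range n, |(G (k + 1)).emitRight M W - (G k).emitRight M W| ≤
        ∑ k ∈ Finset.range n, (|(G (k + 1)).s 0 - (G k).s 0| +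
          2 * M.c₃ * (C * |(G (k + 1)).jump - (G k).jump|)) := by
      refine Finset.sum_le_sum fun k _ => ?_
      have h2 := B.lip_strain _ _ _ _ (hbox (k + 1) 0).1 (hbox (k + 1) 0).2.2.2 (hbox k 0).1
        (hbox k 0).2.2.2
      have e : (G (k + 1)).emitRight M W - (G k).emitRight M W =
        ((G (k + 1)).s 0 - (G k).s 0) - 2 * M.c₃ * (W (G (k + 1)).jump - W (G k).jump) := by
        simp only [Frame.emitRight]; ring
      rw [e]
      refine (abs_sub _ _).trans ?_
      rw [abs_mul, abs_of_pos (by positivity : 0 < 2 * M.c₃)]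
      exact add_le_add le_rfl (mul_le_mul_of_nonneg_left h2 (by positivity))
    rw [Finset.sum_add_distrib, ← Finset.mul_sum, ← Finset.mul_sum] at h1
    have h3 := mul_le_mul_of_nonneg_left (mul_le_mul_of_nonneg_left (hJ n) hC)
      (by positivity : 0 ≤ 2 * M.c₃)
    linarith [hS n]
  set Lmax := L + 2 * εr + (L + 2 * M.c₃ * (C * (2 * L))) with hLmax
  have hεr : 0 ≤ εr := (B.pos.le).trans B.le_r
  have hε := B.pos
  -- Two potentials are followed. The variation of r plus the mismatch between its first entry and
  -- the emitted value grows only when the emitted value changes, hence is at most `Lmax`. The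
  -- variation of r weighted by `max (-D) 0`, plus what has been absorbed, grows only when D
  -- changes, by at most `Lmax` times that change.
  have key : ∀ n, ∃ Λ, SeqVariationLE (G n).r Λ ∧
      Λ + |(G n).r 0 - (G n).emitRight M W| ≤
        L + 2 * εr + ∑ k ∈ Finset.range n, |(G (k + 1)).emitRight M W - (G k).emitRight M W| ∧
      max (-(G n).jump) 0 * Λ + ∑ k ∈ Finset.range n, max (-(G k).jump) 0 *
          |(G (k + 1)).r 0 - (G k).r 0| ≤
        (|s₀ - p₀| + 2 * ε) * L +
          Lmax * ∑ k ∈ Finset.range n, |(G (k + 1)).jump - (G k).jump| := by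
    intro n
    induction n with
    | zero =>
      refine ⟨L, hr, ?_, ?_⟩
      · obtain ⟨a1, a2, a3, a4⟩ := hbox 0 0
        have h1 := B.right _ _ a1 a4
        have e : (G 0).r 0 - (G 0).emitRight M W =
          ((G 0).r 0 - r₀) - ((G 0).s 0 - 2 * M.c₃ * W ((G 0).s 0 - (G 0).p 0) - r₀) := by
          simp only [Frame.emitRight, Frame.jump]; ring
        rw [e]
        have h2 := abs_sub ((G 0).r 0 - r₀)
          ((G 0).s 0 - 2 * M.c₃ * W ((G 0).s 0 - (G 0).p 0) - r₀)
        simp only [Finset.range_zero, Finset.sum_empty]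
        linarith
      · obtain ⟨a1, a2, a3, a4⟩ := hbox 0 0
        simp only [Finset.range_zero, Finset.sum_empty, mul_zero, add_zero]
        apply mul_le_mul_of_nonneg_right _ hL0
        have h1 := neg_abs_le (s₀ - p₀)
        rw [abs_le] at a1 a4
        apply max_le
        · simp only [Frame.jump]; linarith [a1.2, a4.1]
        · positivity
    | succ n ih =>
      obtain ⟨Λ, h1, h2, h3⟩ := ih
      have hΛ0 := h1.nonneg
      -- the new variation, in each of the three cases
      have hnew : ∃ Λ', SeqVariationLE (G (n + 1)).r Λ' ∧
          Λ' + |(G (n + 1)).r 0 - (G n).emitRight M W| ≤ Λ + |(G n).r 0 - (G n).emitRight M W| ∧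
          max (-(G n).jump) 0 * Λ' + max (-(G n).jump) 0 * |(G (n + 1)).r 0 - (G n).r 0| ≤
            max (-(G n).jump) 0 * Λ := by
        have hstep : (G (n + 1)).r = ((G n).step M V0 W (b (n + 1))).r := rfl
        rw [hstep]
        simp only [Frame.step]
        split_ifs with c1 c2
        · refine ⟨_, h1.cons _, ?_, ?_⟩
          · simp [seqCons]
          · have hj : 0 < (G n).jump := by
              rcases B.speed_cases (hbox n) with ⟨hj, -⟩ | ⟨-, hj⟩
              · exact hj
              · exact absurd (hj.1.trans_lt c1.1) (not_lt.2 c1.2)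
            rw [max_eq_right (by linarith)]
            simp
        · refine ⟨_, h1.tail, ?_, ?_⟩
          · have := abs_sub_le (seqTail (G n).r 0) ((G n).r 0) ((G n).emitRight M W)
            linarith
          · rw [mul_sub]; linarith
        · exact ⟨Λ, h1, le_rfl, by simp⟩
      obtain ⟨Λ', k1, k2, k3⟩ := hnew
      have hΛ'0 := k1.nonneg
      have hbd : Λ' + |(G (n + 1)).r 0 - (G (n + 1)).emitRight M W| ≤ L + 2 * εr +
          ∑ k ∈ Finset.range (n + 1), |(G (k + 1)).emitRight M W - (G k).emitRight M W| := by
        rw [Finset.sum_range_succ]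
        have := abs_sub_le ((G (n + 1)).r 0) ((G n).emitRight M W) ((G (n + 1)).emitRight M W)
        rw [abs_sub_comm ((G n).emitRight M W)] at this
        linarith
      refine ⟨Λ', k1, hbd, ?_⟩
      rw [Finset.sum_range_succ, Finset.sum_range_succ, mul_add]
      have hΛ' : Λ' ≤ Lmax := by
        have := hR (n + 1)
        have := abs_nonneg ((G (n + 1)).r 0 - (G (n + 1)).emitRight M W)
        linarith
      have hmax : max (-(G (n + 1)).jump) 0 ≤
          max (-(G n).jump) 0 + |(G (n + 1)).jump - (G n).jump| := by
        have := (abs_le.1 (abs_max_sub_max_le_abs (-(G (n + 1)).jump) (-(G n).jump) 0)).2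
        rw [neg_sub_neg, abs_sub_comm] at this
        linarith
      have m1 := mul_le_mul_of_nonneg_right hmax hΛ'0
      have m2 := mul_le_mul_of_nonneg_left hΛ' (abs_nonneg ((G (n + 1)).jump - (G n).jump))
      linarith
  obtain ⟨Λ, h1, -, h3⟩ := key n
  have hLmax0 : 0 ≤ Lmax := by positivity
  have h4 := mul_le_mul_of_nonneg_left (hJ n) hLmax0
  have h5 : 0 ≤ max (-(G n).jump) 0 * Λ := mul_nonneg (le_max_right _ _) h1.nonneg
  linarith

/-- The boundary speeds have uniformly bounded variation. -/
theorem IsStableBox.exists_sum_speed_le (B : IsStableBox M φ V0 W p₀ q₀ r₀ s₀ ε εq εr C) (L : ℝ) :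
    ∃ K : ℝ, ∀ F : Frame, F.InBox p₀ q₀ r₀ s₀ ε εq εr → SeqVariationLE F.p L →
      SeqVariationLE F.r L → SeqVariationLE F.s L → ∀ (b : ℕ → ℝ) (n : ℕ),
      ∑ k ∈ Finset.range n,
        |(F.evolve M V0 W b (k + 1)).speed M V0 - (F.evolve M V0 W b k).speed M V0| ≤ K := by
  have hc3 := M.c₃_pos
  have hC := B.nonneg
  have hε := B.pos
  set A := (|s₀ - p₀| + 2 * ε) * L + (L + 2 * εr + (L + 2 * M.c₃ * (C * (2 * L)))) * (2 * L) with hA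
  refine ⟨C * (2 * L + 1 / (2 * M.c₃) * ((|s₀ - p₀| + 2 * ε) * L + A)), ?_⟩
  intro F hF hp hr hs b n
  have h1 := Frame.sum_jump_le (M := M) (V0 := V0) (W := W) hp hs b n
  have h2 := Frame.sum_s_le (M := M) (V0 := V0) (W := W) hs b n
  have h3 := B.sum_absorbed_le hF hp hr hs b n
  rw [← hA] at h3
  set G := F.evolve M V0 W b with hG
  have hbox : ∀ k, (G k).InBox p₀ q₀ r₀ s₀ ε εq εr := fun k => B.evolve_inBox hF b k
  have hterm : ∑ k ∈ Finset.range n, |(G (k + 1)).speed M V0 - (G k).speed M V0| ≤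
      ∑ k ∈ Finset.range n, C * (|(G (k + 1)).jump - (G k).jump| + 1 / (2 * M.c₃) *
        ((|s₀ - p₀| + 2 * ε) * |(G (k + 1)).s 0 - (G k).s 0| +
          max (-(G k).jump) 0 * |(G (k + 1)).r 0 - (G k).r 0|)) := by
    refine Finset.sum_le_sum fun k _ => ?_
    obtain ⟨a1, a2, a3, a4⟩ := hbox k 0
    obtain ⟨b1, b2, b3, b4⟩ := hbox (k + 1) 0
    have h4 := B.lip_speed _ _ _ _ _ _ a1 a3 a4 b1 b3 b4
    rw [abs_sub_comm]
    refine h4.trans ?_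
    apply mul_le_mul_of_nonneg_left _ hC
    rw [abs_sub_comm]
    refine add_le_add le_rfl ?_
    have e : ((G k).s 0 - (G k).r 0) / (2 * M.c₃) -
        ((G (k + 1)).s 0 - (G (k + 1)).r 0) / (2 * M.c₃) = - (1 / (2 * M.c₃) *
        (((G (k + 1)).s 0 - (G k).s 0) - ((G (k + 1)).r 0 - (G k).r 0))) := by ring
    rw [e, abs_neg, abs_mul, abs_of_pos (by positivity : 0 < 1 / (2 * M.c₃)), mul_left_comm]
    apply mul_le_mul_of_nonneg_left _ (by positivity)
    have hm0 : 0 ≤ max (-(G k).jump) 0 := le_max_right _ _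
    have hm1 : max (-(G k).jump) 0 ≤ |s₀ - p₀| + 2 * ε := by
      -- The weight is bounded in the box, so the s-part of the strain variation needs only the
      -- plain variation of s; the r-part keeps its weight.
      have h1 := neg_abs_le (s₀ - p₀)
      rw [abs_le] at a1 a4
      apply max_le
      · simp only [Frame.jump]; linarith [a1.2, a4.1]
      · positivity
    have m1 := mul_le_mul_of_nonneg_left (abs_sub ((G (k + 1)).s 0 - (G k).s 0)
      ((G (k + 1)).r 0 - (G k).r 0)) hm0
    have m2 := mul_le_mul_of_nonneg_right hm1 (abs_nonneg ((G (k + 1)).s 0 - (G k).s 0))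
    refine m1.trans ?_
    rw [mul_add]
    linarith
  refine hterm.trans ?_
  rw [← Finset.mul_sum, Finset.sum_add_distrib, ← Finset.mul_sum, Finset.sum_add_distrib,
    ← Finset.mul_sum]
  apply mul_le_mul_of_nonneg_left _ hC
  refine add_le_add h1 (mul_le_mul_of_nonneg_left (add_le_add ?_ h3) (by positivity))
  exact mul_le_mul_of_nonneg_left h2 (by positivity)

end Variation

/-! ### Cell means of the initial data. -/

section CellMean

variable {f : ℝ → State} {u : State} {δ : ℝ}

/-- A value differs from any other by at most the variation. Averaging this over a set of measure at
least one bounds the value by the integral plus the variation. -/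
theorem norm_sub_le_of_bvNorm_lt {s : Set ℝ} (hs : MeasurableSet s) (hvol : 1 ≤ volume s)
    (hf : bvNorm (fun x => f x - u) s < ENNReal.ofReal δ) {x : ℝ} (hx : x ∈ s) :
    ‖f x - u‖ ≤ δ := by
  have hδ : 0 < δ := by
    by_contra h
    rw [ENNReal.ofReal_of_nonpos (not_lt.1 h)] at hf
    exact not_lt_bot hf
  set g : ℝ → State := fun x => f x - u with hg
  have h1 : ∀ y ∈ s, ‖g x‖ₑ - eVariationOn g s ≤ ‖g y‖ₑ := fun y hy => by
    rw [tsub_le_iff_right]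
    calc ‖g x‖ₑ = ‖g y + (g x - g y)‖ₑ := by congr 1; abel
      _ ≤ ‖g y‖ₑ + ‖g x - g y‖ₑ := enorm_add_le _ _
      _ ≤ _ := by
        rw [← edist_eq_enorm_sub]
        exact add_le_add le_rfl (eVariationOn.edist_le g hx hy)
  have h2 : ‖g x‖ₑ - eVariationOn g s ≤ ∫⁻ y in s, ‖g y‖ₑ :=
    calc ‖g x‖ₑ - eVariationOn g s = (‖g x‖ₑ - eVariationOn g s) * 1 := (mul_one _).symm
      _ ≤ (‖g x‖ₑ - eVariationOn g s) * volume s := by gcongr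
      _ = ∫⁻ y in s, (‖g x‖ₑ - eVariationOn g s) := (setLIntegral_const _ _).symm
      _ ≤ _ := setLIntegral_mono' hs h1
  rw [tsub_le_iff_right] at h2
  have h3 := h2.trans hf.le
  rwa [← ofReal_norm, ENNReal.ofReal_le_ofReal_iff hδ.le] at h3

theorem eVariationOn_le_of_bvNorm_lt {s : Set ℝ}
    (hf : bvNorm (fun x => f x - u) s < ENNReal.ofReal δ) :
    eVariationOn f s ≤ ENNReal.ofReal δ := by
  have h : eVariationOn (fun x => f x - u) s = eVariationOn f s := by
    simp only [eVariationOn, edist_sub_right]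
  rw [← h]
  exact (self_le_add_left _ _).trans hf.le

/-- A bounded function of bounded variation on the right half-line is integrable on intervals. -/
theorem intervalIntegrable_of_eVariationOn_le {c : ℝ} (hf : ∀ x ∈ Ioi (0 : ℝ), ‖f x‖ ≤ c)
    (hv : eVariationOn f (Ioi 0) ≤ ENNReal.ofReal δ) {a b : ℝ} (ha : 0 ≤ a) (hb : 0 ≤ b) :
    IntervalIntegrable f volume a b := by
  have hmeas : ∀ g : State → ℝ, LipschitzWith 1 g →
      AEMeasurable (fun x => g (f x)) (volume.restrict (Ioi 0)) := fun g hg => by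
    have hlb : LocallyBoundedVariationOn f (Ioi 0) :=
      BoundedVariationOn.locallyBoundedVariationOn
        (ne_top_of_le_ne_top ENNReal.ofReal_ne_top hv)
    obtain ⟨p, q, hp, hq, hpq⟩ :=
      (hg.comp_locallyBoundedVariationOn hlb).exists_monotoneOn_sub_monotoneOn
    have := (aemeasurable_restrict_of_monotoneOn (μ := volume) measurableSet_Ioi hp).sub
      (aemeasurable_restrict_of_monotoneOn (μ := volume) measurableSet_Ioi hq)
    rw [← hpq] at this
    exact this
  have hsm : AEStronglyMeasurable f (volume.restrict (Ioi 0)) :=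
    ((hmeas Prod.fst LipschitzWith.prod_fst).prodMk
      (hmeas Prod.snd LipschitzWith.prod_snd)).aestronglyMeasurable
  have hsub : uIoc a b ⊆ Ioi 0 := fun x hx => (le_min ha hb).trans_lt hx.1
  rw [intervalIntegrable_iff]
  refine IntegrableOn.of_bound (by simp [uIoc])
    (hsm.mono_measure (Measure.restrict_mono hsub le_rfl)) c ?_
  rw [ae_restrict_iff' measurableSet_uIoc]
  exact ae_of_all _ fun x hx => hf x (hsub hx)

/-- The mean value over the `k`-th cell of length `2h` of the right half-line. -/
noncomputable def cellMean (f : ℝ → State) (h : ℝ) (k : ℕ) : State :=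
  (1 / (2 * h)) • ∫ y in (2 * k * h : ℝ)..((2 * k + 2) * h : ℝ), f y

theorem cellMean_eq (f : ℝ → State) (h : ℝ) (k : ℕ) :
    cellMean f h k = (1 / (2 * h)) • ∫ y in (0 : ℝ)..(2 * h), f (y + 2 * k * h) := by
  rw [cellMean, intervalIntegral.integral_comp_add_right]
  congr 2 <;> ring

theorem norm_cellMean_sub_le
    (hi : ∀ a b : ℝ, 0 ≤ a → 0 ≤ b → IntervalIntegrable f volume a b)
    (hf : ∀ x ∈ Ioi (0 : ℝ), ‖f x - u‖ ≤ δ) {h : ℝ} (hh : 0 < h) (k : ℕ) :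
    ‖cellMean f h k - u‖ ≤ δ := by
  have h0 : (0 : ℝ) ≤ 2 * k * h := by positivity
  have h1 : (0 : ℝ) ≤ (2 * k + 2) * h := by positivity
  have e : cellMean f h k - u =
      (1 / (2 * h)) • ∫ y in (2 * k * h : ℝ)..((2 * k + 2) * h : ℝ), (f y - u) := by
    rw [intervalIntegral.integral_sub (hi _ _ h0 h1) intervalIntegrable_const,
      intervalIntegral.integral_const, smul_sub, smul_smul, cellMean]
    rw [show 1 / (2 * h) * ((2 * k + 2) * h - 2 * k * h) = 1 by field_simp; ring, one_smul]
  have hn := intervalIntegral.norm_integral_le_of_norm_le_const (f := fun y => f y - u) (C := δ)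
    (a := 2 * k * h) (b := (2 * k + 2) * h) (fun y hy => hf y ((le_min h0 h1).trans_lt hy.1))
  rw [show (2 * k + 2) * h - 2 * k * h = 2 * h by ring, abs_of_pos (by positivity)] at hn
  rw [e, norm_smul, Real.norm_of_nonneg (by positivity), one_div, inv_mul_le_iff₀ (by positivity)]
  linarith

/-- Consecutive means differ by the average over y of increments between y + 2kh and y + 2(k + 1)h.
For each fixed y these increments sum to at most the variation of the data. -/
theorem sum_norm_cellMean_le
    (hi : ∀ a b : ℝ, 0 ≤ a → 0 ≤ b → IntervalIntegrable f volume a b)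
    (hδ : 0 ≤ δ) (hv : eVariationOn f (Ioi 0) ≤ ENNReal.ofReal δ) {h : ℝ} (hh : 0 < h) (K : ℕ) :
    ∑ k ∈ Finset.range K, ‖cellMean f h (k + 1) - cellMean f h k‖ ≤ δ := by
  have hik : ∀ k : ℕ, IntervalIntegrable (fun y => f (y + 2 * k * h)) volume 0 (2 * h) :=
    fun k => by
    have := (hi (2 * k * h) ((2 * k + 2) * h) (by positivity) (by positivity)).comp_add_right
      (2 * k * h)
    convert this using 1 <;> ring
  have hik' : ∀ k : ℕ, IntervalIntegrable
      (fun y => ‖f (y + 2 * (k + 1 : ℕ) * h) - f (y + 2 * k * h)‖) volume 0 (2 * h) :=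
    fun k => ((hik (k + 1)).sub (hik k)).norm
  have hpt : ∀ y ∈ Ioc 0 (2 * h),
      ∑ k ∈ Finset.range K, ‖f (y + 2 * (k + 1 : ℕ) * h) - f (y + 2 * k * h)‖ ≤ δ := fun y hy => by
    have h1 := (eVariationOn.sum_le (f := f) (s := Ioi 0) (n := K) (u := fun k : ℕ => y + 2 * k * h)
      (fun i j hij => by
        have : (i : ℝ) ≤ j := by exact_mod_cast hij
        simp only; gcongr)
      (fun i => by
        have := hy.1
        simp only [mem_Ioi]; positivity)).trans hv
    simp only [edist_eq_enorm_sub, ← ofReal_norm] at h1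
    rw [← ENNReal.ofReal_sum_of_nonneg (fun _ _ => norm_nonneg _),
      ENNReal.ofReal_le_ofReal_iff hδ] at h1
    exact h1
  calc ∑ k ∈ Finset.range K, ‖cellMean f h (k + 1) - cellMean f h k‖
      ≤ ∑ k ∈ Finset.range K, 1 / (2 * h) *
          ∫ y in (0 : ℝ)..(2 * h), ‖f (y + 2 * (k + 1 : ℕ) * h) - f (y + 2 * k * h)‖ := by
        refine Finset.sum_le_sum fun k _ => ?_
        rw [cellMean_eq, cellMean_eq, ← smul_sub,
          ← intervalIntegral.integral_sub (hik (k + 1)) (hik k), norm_smul,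
          Real.norm_of_nonneg (by positivity)]
        gcongr
        exact intervalIntegral.norm_integral_le_integral_norm (by positivity)
    _ = 1 / (2 * h) * ∫ y in (0 : ℝ)..(2 * h),
          ∑ k ∈ Finset.range K, ‖f (y + 2 * (k + 1 : ℕ) * h) - f (y + 2 * k * h)‖ := by
        rw [← Finset.mul_sum, intervalIntegral.integral_finsetSum fun k _ => hik' k]
    _ ≤ 1 / (2 * h) * ∫ y in (0 : ℝ)..(2 * h), δ := by
        gcongr
        rw [intervalIntegral.integral_of_le (by positivity),
          intervalIntegral.integral_of_le (by positivity)]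
        refine setIntegral_mono_on ?_ (integrableOn_const measure_Ioc_lt_top.ne) measurableSet_Ioc hpt
        rw [← intervalIntegrable_iff_integrableOn_Ioc_of_le (by positivity)]
        have := IntervalIntegrable.sum (Finset.range K) fun k _ => hik' k
        rwa [Finset.sum_fn] at this
    _ = δ := by
        rw [intervalIntegral.integral_const, smul_eq_mul]
        field_simp
        ring

/-- The cell means of data of small `bvNorm` on the right half-line. -/
theorem cellMean_bounds (hf : bvNorm (fun x => f x - u) (Ioi 0) < ENNReal.ofReal δ) {h : ℝ}
    (hh : 0 < h) : (∀ k, ‖cellMean f h k - u‖ ≤ δ) ∧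
      ∀ K, ∑ k ∈ Finset.range K, ‖cellMean f h (k + 1) - cellMean f h k‖ ≤ δ := by
  have h1 : ∀ x ∈ Ioi (0 : ℝ), ‖f x - u‖ ≤ δ := fun x hx =>
    norm_sub_le_of_bvNorm_lt measurableSet_Ioi (by simp) hf hx
  have h2 := eVariationOn_le_of_bvNorm_lt hf
  have hδ : 0 ≤ δ := (norm_nonneg _).trans (h1 1 (by simp))
  have hi : ∀ a b : ℝ, 0 ≤ a → 0 ≤ b → IntervalIntegrable f volume a b := fun a b ha hb =>
    intervalIntegrable_of_eVariationOn_le (c := ‖u‖ + δ) (fun x hx => by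
      have := norm_add_le u (f x - u)
      rw [add_sub_cancel] at this
      linarith [h1 x hx]) h2 ha hb
  exact ⟨norm_cellMean_sub_le hi h1 hh, sum_norm_cellMean_le hi hδ h2 hh⟩

/-- Reflection reduces the left half-line to the right one, with cells numbered away from the origin
as in a frame. -/
theorem bvNorm_comp_neg (f : ℝ → State) :
    bvNorm (fun x => f (-x)) (Ioi 0) = bvNorm f (Iio 0) := by
  rw [bvNorm, bvNorm]
  congr 1
  · have := (Measure.measurePreserving_neg (volume : Measure ℝ)).setLIntegral_comp_preimage_emb
      (MeasurableEquiv.neg ℝ).measurableEmbedding (fun x => ‖f x‖ₑ) (Iio 0)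
    rw [← this]
    simp
  · have := eVariationOn.comp_eq_of_antitoneOn f (t := Ioi (0 : ℝ)) (fun x => -x)
      (fun x _ y _ hxy => neg_le_neg hxy)
    rw [show (fun x : ℝ => -x) '' Ioi 0 = Iio 0 by simp] at this
    exact this

theorem cauchyData_mean_right (uL uR : ℝ → State) {h : ℝ} (hh : 0 < h) (k : ℕ) :
    (1 / (2 * h)) • ∫ y in (2 * k * h : ℝ)..((2 * k + 2) * h : ℝ), cauchyData uL uR y =
      cellMean uR h k := by
  have h0 : (0 : ℝ) ≤ 2 * k * h := by positivity
  rw [cellMean]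
  congr 1
  refine intervalIntegral.integral_congr fun y hy => ?_
  rw [uIcc_of_le (by nlinarith)] at hy
  rw [cauchyData, if_neg (not_lt.2 (h0.trans hy.1))]

theorem cauchyData_mean_left (uL uR : ℝ → State) {h : ℝ} (hh : 0 < h) (k : ℕ) :
    (1 / (2 * h)) • ∫ y in (-((2 * k + 2) * h) : ℝ)..(-(2 * k * h) : ℝ), cauchyData uL uR y =
      cellMean (fun x => uL (-x)) h k := by
  have h0 : (0 : ℝ) ≤ 2 * k * h := by positivity
  rw [cellMean, ← intervalIntegral.integral_comp_neg]
  congr 1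
  -- Half-open intervals leave out the origin, where the Cauchy data take the right-hand value.
  rw [intervalIntegral.integral_of_le (by nlinarith), intervalIntegral.integral_of_le (by nlinarith)]
  refine setIntegral_congr_fun measurableSet_Ioc fun y hy => ?_
  rw [cauchyData, if_pos (by linarith [hy.1])]

end CellMean

/-! ### The frame at time zero. -/

section InitialFrame

variable {M : Material} {φ V0 W : ℝ → ℝ} {p₀ q₀ r₀ s₀ ε εq εr C : ℝ}

theorem Material.abs_inv_sub_le (M : Material) {u v : State} {d : ℝ} (h : ‖u - v‖ ≤ d) :
    |M.invP u - M.invP v| ≤ (1 + M.c₁) * d ∧ |M.invQ u - M.invQ v| ≤ (1 + M.c₁) * d ∧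
      |M.invR u - M.invR v| ≤ (1 + M.c₁) * d ∧ |M.invS u - M.invS v| ≤ (1 + M.c₁) * d := by
  have hc1 := M.c₁_pos
  have hc3 := M.c₃_pos
  have hc := M.c₃_lt_c₁
  rw [Prod.norm_def, max_le_iff] at h
  simp only [Prod.fst_sub, Prod.snd_sub, Real.norm_eq_abs] at h
  obtain ⟨h1, h2⟩ := h
  have key : ∀ c : ℝ, |c| ≤ M.c₁ →
      |(u.1 + c * u.2) - (v.1 + c * v.2)| ≤ (1 + M.c₁) * d := fun c hcc => by
    calc |(u.1 + c * u.2) - (v.1 + c * v.2)| = |(u.1 - v.1) + c * (u.2 - v.2)| := by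
          congr 1; ring
      _ ≤ |u.1 - v.1| + |c * (u.2 - v.2)| := abs_add_le _ _
      _ = |u.1 - v.1| + |c| * |u.2 - v.2| := by rw [abs_mul]
      _ ≤ d + M.c₁ * d := add_le_add h1 (mul_le_mul hcc h2 (abs_nonneg _) hc1.le)
      _ = _ := by ring
  refine ⟨?_, ?_, ?_, ?_⟩
  · have := key (-M.c₁) (by rw [abs_neg, abs_of_pos hc1])
    simpa only [Material.invP, neg_mul, ← sub_eq_add_neg] using this
  · exact key M.c₁ (abs_of_pos hc1).le
  · have := key (-M.c₃) (by rw [abs_neg, abs_of_pos hc3]; exact hc.le)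
    simpa only [Material.invR, neg_mul, ← sub_eq_add_neg] using this
  · exact key M.c₃ (by rw [abs_of_pos hc3]; exact hc.le)

/-- The frame of the cell means of the initial data. -/
noncomputable def initialFrame (M : Material) (uL uR : ℝ → State) (h : ℝ) : Frame where
  m := 0
  p k := M.invP (cellMean (fun x => uL (-x)) h k)
  q k := M.invQ (cellMean (fun x => uL (-x)) h k)
  r k := M.invR (cellMean uR h k)
  s k := M.invS (cellMean uR h k)

theorem initialFrame_represents (uL uR : ℝ → State) (lam : ℝ) (a : ℕ → ℝ) {h : ℝ} (hh : 0 < h) :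
    (initialFrame M uL uR h).Represents M
      (glimmGrid M φ (cauchyData uL uR) lam a h 0) := by
  intro k
  simp only [initialFrame, Material.state1_inv, Material.state3_inv]
  rw [← cauchyData_mean_left uL uR hh, ← cauchyData_mean_right uL uR hh]
  constructor
  · rw [glimmGrid]
    push_cast
    congr 2 <;> ring
  · rw [glimmGrid]
    push_cast
    congr 2 <;> ring

theorem initialFrame_bounds {uL uR : ℝ → State} {uLs uRs : State} {δ : ℝ}
    (hδ : bvNorm (fun x => uL x - uLs) (Iio 0) + bvNorm (fun x => uR x - uRs) (Ioi 0)
      < ENNReal.ofReal δ) {h : ℝ} (hh : 0 < h) {d : ℝ} (hd : (1 + M.c₁) * δ ≤ d)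
    {εq εr : ℝ} (hq : d ≤ εq) (hr : d ≤ εr) :
    (initialFrame M uL uR h).InBox (M.invP uLs) (M.invQ uLs) (M.invR uRs) (M.invS uRs) d εq εr ∧
      SeqVariationLE (initialFrame M uL uR h).p d ∧ SeqVariationLE (initialFrame M uL uR h).r d ∧
      SeqVariationLE (initialFrame M uL uR h).s d := by
  have hc1 := M.c₁_pos
  have hL : bvNorm (fun x => uL (-x) - uLs) (Ioi 0) < ENNReal.ofReal δ := by
    rw [bvNorm_comp_neg (fun x => uL x - uLs)]
    exact (self_le_add_right _ _).trans_lt hδ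
  have hR := (self_le_add_left _ _).trans_lt hδ
  obtain ⟨l1, l2⟩ := cellMean_bounds (f := fun x => uL (-x)) hL hh
  obtain ⟨r1, r2⟩ := cellMean_bounds (f := uR) hR hh
  have hvar : ∀ (I : State → ℝ) (f : ℝ → State),
      (∀ u v : State, |I u - I v| ≤ (1 + M.c₁) * ‖u - v‖) →
      (∀ K, ∑ k ∈ Finset.range K, ‖cellMean f h (k + 1) - cellMean f h k‖ ≤ δ) →
      SeqVariationLE (fun k => I (cellMean f h k)) d := fun I f hI hf K =>
    calc ∑ k ∈ Finset.range K, |I (cellMean f h (k + 1)) - I (cellMean f h k)|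
        ≤ ∑ k ∈ Finset.range K, (1 + M.c₁) * ‖cellMean f h (k + 1) - cellMean f h k‖ :=
          Finset.sum_le_sum fun k _ => hI _ _
      _ ≤ (1 + M.c₁) * δ := by
          rw [← Finset.mul_sum]
          exact mul_le_mul_of_nonneg_left (hf K) (by positivity)
      _ ≤ d := hd
  refine ⟨fun k => ?_, hvar M.invP _ (fun u v => (M.abs_inv_sub_le le_rfl).1) l2,
    hvar M.invR _ (fun u v => (M.abs_inv_sub_le le_rfl).2.2.1) r2,
    hvar M.invS _ (fun u v => (M.abs_inv_sub_le le_rfl).2.2.2) r2⟩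
  have hl := M.abs_inv_sub_le (l1 k)
  have hr' := M.abs_inv_sub_le (r1 k)
  exact ⟨hl.1.trans hd, (hl.2.1.trans hd).trans hq, (hr'.2.2.1.trans hd).trans hr,
    hr'.2.2.2.trans hd⟩

end InitialFrame

/-! ### The phase boundary of the approximate solutions, and the conclusion. -/

theorem Fan.eval_mem {F : Fan} {ul ur : State} {S : Set State} (hl : ul ∈ S) (hm : F.um ∈ S)
    (hp : F.up ∈ S) (hr : ur ∈ S) (t x : ℝ) : F.eval ul ur t x ∈ S := by
  rw [Fan.eval]
  split_ifs <;> assumption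

theorem Fan.eval_mem_left {F : Fan} {ul ur : State} {S : Set State} (hl : ul ∈ S) (hm : F.um ∈ S)
    {t x : ℝ} (hx : x ≤ F.V * t) : F.eval ul ur t x ∈ S := by
  rw [Fan.eval, if_pos hx]
  split_ifs <;> assumption

theorem Fan.eval_mem_right {F : Fan} {ul ur : State} {S : Set State} (hp : F.up ∈ S) (hr : ur ∈ S)
    {t x : ℝ} (hx : F.V * t < x) (hs : F.sl * t ≤ F.V * t) : F.eval ul ur t x ∈ S := by
  rw [Fan.eval, if_neg (not_le.2 (hs.trans_lt hx)), if_neg (not_le.2 hx)]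
  split_ifs <;> assumption

theorem Int.eq_of_even_add_of_even_add {m m' : ℤ} {n : ℕ} (h : Even (m + n)) (h' : Even (m' + n)) :
    (∃ k : ℕ, m = m' - 2 - 2 * k) ∨ m = m' ∨ ∃ k : ℕ, m = m' + 2 + 2 * k := by
  obtain ⟨i, hi⟩ := h
  obtain ⟨j, hj⟩ := h'
  rcases lt_trichotomy i j with hij | hij | hij
  · exact Or.inl ⟨(j - i - 1).toNat, by omega⟩
  · exact Or.inr (Or.inl (by omega))
  · exact Or.inr (Or.inr ⟨(i - j - 1).toNat, by omega⟩)

section Scheme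

variable {M : Material} {φ V0 W : ℝ → ℝ} {p₀ q₀ r₀ s₀ ε εq εr C : ℝ}

theorem Frame.even_evolve_m {F : Frame} (hF : F.m = 0) (b : ℕ → ℝ) (n : ℕ) :
    Even ((F.evolve M V0 W b n).m + n) := by
  induction n with
  | zero => simp [Frame.evolve, hF]
  | succ n ih =>
    have hstep : (F.evolve M V0 W b (n + 1)).m = (F.evolve M V0 W b n).m +
      if b (n + 1) ≤ (F.evolve M V0 W b n).speed M V0 then 1 else -1 := rfl
    rw [hstep]
    obtain ⟨i, hi⟩ := ih
    split_ifs
    · exact ⟨i + 1, by push_cast; omega⟩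
    · exact ⟨i, by push_cast; omega⟩

theorem IsStableBox.evolve_represents (B : IsStableBox M φ V0 W p₀ q₀ r₀ s₀ ε εq εr C)
    (hφ : IsDissipationFunction M φ) {F : Frame} (hF : F.InBox p₀ q₀ r₀ s₀ ε εq εr)
    {u₀ : ℝ → State} {a : ℕ → ℝ} {h lam : ℝ} (hh : 0 < h) (hlam : 0 < lam)
    (hg : F.Represents M (glimmGrid M φ u₀ lam a h 0)) (n : ℕ) :
    (F.evolve M V0 W (fun n => lam * a n) n).Represents M (glimmGrid M φ u₀ lam a h n) := by
  induction n with
  | zero => exact hg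
  | succ n ih => exact B.step_represents hφ (B.evolve_inBox hF _ n) hh hlam ih

/-- The data and the solution of each of the Riemann problems between the cells of a frame. -/
theorem IsStableBox.riemann_cases (B : IsStableBox M φ V0 W p₀ q₀ r₀ s₀ ε εq εr C)
    (hφ : IsDissipationFunction M φ) {F : Frame} (hF : F.InBox p₀ q₀ r₀ s₀ ε εq εr)
    {g : ℤ → State} (hg : F.Represents M g) {m : ℤ} {n : ℕ} (hm : Even (m + n))
    (hFm : Even (F.m + n)) :
    ∃ G, (∀ G', IsRiemannSolution M φ (g (m - 2)) (g m) G' ↔ G' = G) ∧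
      ((m + 2 ≤ F.m ∧ g (m - 2) ∈ M.phase1 ∧ g m ∈ M.phase1 ∧ G.um ∈ M.phase1 ∧ G.up ∈ M.phase1) ∨
      (m = F.m ∧ g (m - 2) ∈ M.phase1 ∧ g m ∈ M.phase3 ∧ G = F.fan M V0 W) ∨
      (F.m + 2 ≤ m ∧ g (m - 2) ∈ M.phase3 ∧ g m ∈ M.phase3 ∧ G.um ∈ M.phase3 ∧
        G.up ∈ M.phase3)) := by
  have h1 := fun i j : ℕ => B.mem1 _ _ (hF i).1 (hF j).2.1
  have h3 := fun i j : ℕ => B.mem3 _ _ (hF i).2.2.1 (hF j).2.2.2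
  rcases Int.eq_of_even_add_of_even_add hm hFm with ⟨k, rfl⟩ | rfl | ⟨k, rfl⟩
  · have e : F.m - 2 - 2 * (k : ℤ) - 2 = F.m - 2 - 2 * (k + 1 : ℕ) := by push_cast; ring
    rw [e, (hg (k + 1)).1, (hg k).1]
    exact ⟨_, B.phase1_iff hF (k + 1) k,
      Or.inl ⟨by omega, h1 _ _, h1 _ _, h1 _ _, h1 _ _⟩⟩
  · have e : F.m - 2 = F.m - 2 - 2 * (0 : ℕ) := by simp
    have e' : F.m = F.m + 2 * (0 : ℕ) := by simp
    have hl : g (F.m - 2) = M.state1 (F.p 0) (F.q 0) := by rw [e, (hg 0).1]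
    have hr : g F.m = M.state3 (F.r 0) (F.s 0) := by rw [e', (hg 0).2]
    rw [hl, hr]
    exact ⟨_, B.boundary_iff hφ hF, Or.inr (Or.inl ⟨rfl, h1 _ _, h3 _ _, rfl⟩)⟩
  · have e : F.m + 2 + 2 * (k : ℤ) - 2 = F.m + 2 * k := by ring
    have e' : F.m + 2 + 2 * (k : ℤ) = F.m + 2 * (k + 1 : ℕ) := by push_cast; ring
    rw [e, e', (hg (k + 1)).2, (hg k).2]
    exact ⟨_, B.phase3_iff hF k (k + 1),
      Or.inr (Or.inr ⟨by omega, h3 _ _, h3 _ _, h3 _ _, h3 _ _⟩)⟩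

/-- The phase boundary of one strip of the approximate solution. -/
theorem IsStableBox.glimmStrip_mem (B : IsStableBox M φ V0 W p₀ q₀ r₀ s₀ ε εq εr C)
    (hφ : IsDissipationFunction M φ) {F : Frame} (hF : F.InBox p₀ q₀ r₀ s₀ ε εq εr)
    {u₀ : ℝ → State} {a : ℕ → ℝ} {h lam : ℝ} (hh : 0 < h) (hlam : M.c₁ < lam) {n : ℕ}
    (hg : F.Represents M (glimmGrid M φ u₀ lam a h n)) (hFm : Even (F.m + n)) {t : ℝ}
    (ht : t ∈ Ico (n * (h / lam)) ((n + 1) * (h / lam))) (x : ℝ) :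
    (x < F.m * h + F.speed M V0 * (t - n * (h / lam)) →
      glimmStrip M φ u₀ lam a h n t x ∈ M.phase1) ∧
    (F.m * h + F.speed M V0 * (t - n * (h / lam)) < x →
      glimmStrip M φ u₀ lam a h n t x ∈ M.phase3) := by
  have hc1 := M.c₁_pos
  have hc := M.c₃_lt_c₁
  have hlam0 : 0 < lam := hc1.trans hlam
  obtain ⟨hV1, hV2⟩ := B.speed_mem_Ioo hF
  rw [glimmStrip]
  split_ifs with h0
  · rw [h0, sub_self, mul_zero, add_zero]
    set j := ⌊(x / h - n) / 2⌋ with hj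
    have hpar : Even ((n : ℤ) + 2 * j + n) := ⟨n + j, by ring⟩
    have hj1 : (j : ℝ) ≤ (x / h - n) / 2 := Int.floor_le _
    have hj2 : (x / h - n) / 2 < j + 1 := Int.lt_floor_add_one _
    constructor
    · intro hx
      rw [← div_lt_iff₀ hh] at hx
      have hlt : (n : ℤ) + 2 * j < F.m := by
        have : ((n + 2 * j : ℤ) : ℝ) < F.m := by push_cast; linarith
        exact_mod_cast this
      rcases Int.eq_of_even_add_of_even_add hpar hFm with ⟨k, hk⟩ | hk | ⟨k, hk⟩
      · rw [hk, (hg k).1]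
        exact B.mem1 _ _ (hF k).1 (hF k).2.1
      · omega
      · omega
    · intro hx
      rw [← lt_div_iff₀ hh] at hx
      have hlt : F.m < (n : ℤ) + 2 * j + 2 := by
        have : (F.m : ℝ) < ((n + 2 * j + 2 : ℤ) : ℝ) := by push_cast; linarith
        exact_mod_cast this
      have hmem : ∀ k : ℕ, (n : ℤ) + 2 * j = F.m + 2 * k →
          glimmGrid M φ u₀ lam a h n (n + 2 * j) ∈ M.phase3 := fun k hk => by
        rw [hk, (hg k).2]
        exact B.mem3 _ _ (hF k).2.2.1 (hF k).2.2.2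
      rcases Int.eq_of_even_add_of_even_add hpar hFm with ⟨k, hk⟩ | hk | ⟨k, hk⟩
      · omega
      · exact hmem 0 (by simpa using hk)
      · exact hmem (k + 1) (by push_cast; omega)
  · set θ := t - n * (h / lam) with hθ
    have hθ0 : 0 < θ := sub_pos.2 (lt_of_le_of_ne ht.1 (Ne.symm h0))
    have hθ1 : lam * θ < h := by
      have : θ < h / lam := by rw [hθ]; linarith [ht.2]
      rwa [lt_div_iff₀' hlam0] at this
    -- As `lam` exceeds c₁, the boundary moves less than `h` within a strip and stays inside the fan
    -- of its own node; the other fans then lie wholly on one side of it.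
    have hVθ : |F.speed M V0 * θ| < h := by
      rw [abs_mul, abs_of_pos hθ0]
      refine lt_of_le_of_lt ?_ hθ1
      exact mul_le_mul_of_nonneg_right (abs_le.2 ⟨by linarith, by linarith⟩) hθ0.le
    rw [abs_lt] at hVθ
    set j := ⌊(x / h + 1 - n) / 2⌋ with hj
    have hpar : Even ((n : ℤ) + 2 * j + n) := ⟨n + j, by ring⟩
    have hj1 : (j : ℝ) ≤ (x / h + 1 - n) / 2 := Int.floor_le _
    have hj2 : (x / h + 1 - n) / 2 < j + 1 := Int.lt_floor_add_one _
    simp only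
    generalize hm : (n : ℤ) + 2 * j = m at hpar ⊢
    have hmr : (m : ℝ) = n + 2 * j := by rw [← hm]; push_cast; ring
    have hx1 : (m - 1) * h ≤ x := by rw [← le_div_iff₀ hh]; linarith
    have hx2 : x < (m + 1) * h := by rw [← div_lt_iff₀ hh]; linarith
    obtain ⟨G, hG, hcases⟩ := B.riemann_cases hφ hF hg hpar hFm
    rw [Material.riemann_eq hG]
    rcases hcases with ⟨hle, d1, d2, d3, d4⟩ | ⟨he, d1, d2, rfl⟩ | ⟨hle, d1, d2, d3, d4⟩
    · refine ⟨fun _ => Fan.eval_mem d1 d3 d4 d2 _ _, fun hx => ?_⟩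
      have : (m : ℝ) + 2 ≤ F.m := by exact_mod_cast hle
      nlinarith
    · rw [← he]
      refine ⟨fun hx => Fan.eval_mem_left d1 (B.fan_um_mem hF) ?_,
        fun hx => Fan.eval_mem_right (B.fan_up_mem hF) d2 ?_ ?_⟩
      · show x - m * h ≤ F.speed M V0 * θ
        linarith
      · show F.speed M V0 * θ < x - m * h
        linarith
      · show -M.c₁ * θ ≤ F.speed M V0 * θ
        exact mul_le_mul_of_nonneg_right (by linarith) hθ0.le
    · refine ⟨fun hx => ?_, fun _ => Fan.eval_mem d1 d3 d4 d2 _ _⟩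
      have : (F.m : ℝ) + 2 ≤ m := by exact_mod_cast hle
      nlinarith

/-- The polygonal front through the nodes `m n`, with slopes `V n`. -/
theorem IsStableBox.isPhaseBoundary (B : IsStableBox M φ V0 W p₀ q₀ r₀ s₀ ε εq εr C)
    (hφ : IsDissipationFunction M φ) {F : Frame} (hF : F.InBox p₀ q₀ r₀ s₀ ε εq εr)
    {u₀ : ℝ → State} {a : ℕ → ℝ} {h lam : ℝ} (hh : 0 < h) (hlam : M.c₁ < lam)
    (hg : F.Represents M (glimmGrid M φ u₀ lam a h 0)) (hFm : F.m = 0) :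
    IsPhaseBoundary M (glimmSolution M φ u₀ lam a h) (h / lam)
      (fun t => (F.evolve M V0 W (fun n => lam * a n) ⌊t / (h / lam)⌋₊).m * h +
        (F.evolve M V0 W (fun n => lam * a n) ⌊t / (h / lam)⌋₊).speed M V0 *
          (t - ⌊t / (h / lam)⌋₊ * (h / lam)))
      (fun t => (F.evolve M V0 W (fun n => lam * a n) ⌊t / (h / lam)⌋₊).speed M V0) := by
  have hlam0 : 0 < lam := M.c₁_pos.trans hlam
  have hτ : 0 < h / lam := div_pos hh hlam0
  have hfloor : ∀ t, 0 ≤ t → t ∈ Ico (⌊t / (h / lam)⌋₊ * (h / lam) : ℝ)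
      ((⌊t / (h / lam)⌋₊ + 1) * (h / lam)) := fun t ht =>
    ⟨(le_div_iff₀ hτ).1 (Nat.floor_le (by positivity)),
      (div_lt_iff₀ hτ).1 (Nat.lt_floor_add_one _)⟩
  have hmem := fun t ht => B.glimmStrip_mem hφ (B.evolve_inBox hF _ _) hh hlam
    (B.evolve_represents hφ hF hh hlam0 hg _) (Frame.even_evolve_m hFm _ _) (hfloor t ht)
  refine ⟨fun t ht x hx => (hmem t ht x).1 hx, fun t ht x hx => (hmem t ht x).2 hx,
    fun n t ht => ?_⟩
  have h1 : ⌊t / (h / lam)⌋₊ = n := by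
    rw [Nat.floor_eq_iff (div_nonneg ((by positivity : (0 : ℝ) ≤ n * (h / lam)).trans ht.1) hτ.le)]
    exact ⟨(le_div_iff₀ hτ).2 ht.1, (div_lt_iff₀ hτ).2 ht.2⟩
  have h2 : ⌊(n * (h / lam)) / (h / lam)⌋₊ = n := by
    rw [mul_div_cancel_right₀ _ hτ.ne', Nat.floor_natCast]
  simp only [h1, h2, sub_self, mul_zero, add_zero, and_self]

end Scheme

theorem theorem4p1 (M : Material) (φ : ℝ → ℝ) (hφ : IsDissipationFunction M φ)
    (uLs uRs : State) (Fs : Fan)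
    -- the Riemann problem for the constant states is solved by a single phase boundary, of speed `Fs.V`
    (huL : uLs ∈ M.phase1) (huR : uRs ∈ M.phase3)
    (hFs : IsRiemannSolution M φ uLs uRs Fs) (hum : Fs.um = uLs) (hup : Fs.up = uRs)
    -- the constant states are not on the boundary of the elliptic region
    (hwL : uLs.2 < M.wM) (hwR : M.wm < uRs.2)
    -- no strong wave arises in the characteristic case
    (hchar : Fs.V = M.c₃ →
      uLs.2 = 0 ∧ uRs.2 = √(derivWithin φ (Iic M.c₃) M.c₃ / M.c₃)) :
    ∃ δ : ℝ, 0 < δ ∧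
      ∀ uL uR : ℝ → State,
        (∀ x < 0, uL x ∈ M.phase1 ∪ M.phase3) → (∀ x > 0, uR x ∈ M.phase1 ∪ M.phase3) →
        bvNorm (fun x => uL x - uLs) (Iio 0) + bvNorm (fun x => uR x - uRs) (Ioi 0)
          < ENNReal.ofReal δ →
      ∀ lam : ℝ, M.c₁ < lam → ∀ a : ℕ → ℝ, IsEquidistributed a →
        -- every Riemann problem met by the scheme has exactly one solution
        (∀ h : ℝ, 0 < h → ∀ (n : ℕ) (m : ℤ), Even (m + n) →
          ∃! F : Fan, IsRiemannSolution M φ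
            (glimmGrid M φ (cauchyData uL uR) lam a h n (m - 2))
            (glimmGrid M φ (cauchyData uL uR) lam a h n m) F) ∧
        -- the approximate solutions have a phase boundary `χh h` of speed `speedh h`
        ∃ χh speedh : ℝ → ℝ → ℝ,
          (∀ h : ℝ, 0 < h → IsPhaseBoundary M
            (glimmSolution M φ (cauchyData uL uR) lam a h) (h / lam) (χh h) (speedh h)) ∧
          ∀ hs : ℕ → ℝ, (∀ j, 0 < hs j) → Tendsto hs atTop (𝓝 0) →
            ∃ ι : ℕ → ℕ, StrictMono ι ∧ ∃ (χ : ℝ → ℝ) (E : Set ℝ),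
              (∃ K : NNReal, LipschitzOnWith K χ (Ici 0)) ∧
              (∀ T : ℝ, 0 < T →
                TendstoUniformlyOn (fun j => χh (hs (ι j))) χ atTop (Icc 0 T)) ∧
              E ⊆ Ici 0 ∧ E.Countable ∧
              ∀ t ∈ Ici (0 : ℝ) \ E,
                DifferentiableWithinAt ℝ χ (Ici 0) t ∧
                Tendsto (fun j => speedh (hs (ι j)) t) atTop (𝓝 (derivWithin χ (Ici 0) t)) := by
  obtain ⟨V0, W, η, C₀, hη, hC₀, hsolver, hW, hVs⟩ := exists_localSolver hφ huL huR hFs hum hup hchar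
  obtain ⟨ε, εq, εr, C, B⟩ := hsolver.exists_stableBox hη hC₀ huL hwL hwR hW hVs
  -- The radius `ε` serves also as bound for the initial variations of p, r and s, so the choice of
  -- `δ` below controls both.
  obtain ⟨K, hK⟩ := B.exists_sum_speed_le ε
  have hc1 := M.c₁_pos
  have hc := M.c₃_lt_c₁
  refine ⟨ε / (1 + M.c₁), div_pos B.pos (by linarith), fun uL uR _ _ hδ lam hlam a ha => ?_⟩
  have hlam0 : 0 < lam := hc1.trans hlam
  have hF := fun (h : ℝ) (hh : 0 < h) => initialFrame_bounds (M := M) hδ hh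
    (by field_simp; exact le_rfl) B.le_q B.le_r
  have hg := fun (h : ℝ) (hh : 0 < h) => initialFrame_represents (M := M) (φ := φ) uL uR lam a hh
  set G : ℝ → ℕ → Frame := fun h => (initialFrame M uL uR h).evolve M V0 W (fun n => lam * a n)
    with hG
  refine ⟨fun h hh n m hm => ?_, fun h t => (G h ⌊t / (h / lam)⌋₊).m * h +
      (G h ⌊t / (h / lam)⌋₊).speed M V0 * (t - ⌊t / (h / lam)⌋₊ * (h / lam)),
    fun h t => (G h ⌊t / (h / lam)⌋₊).speed M V0,
    fun h hh => B.isPhaseBoundary hφ (hF h hh).1 hh hlam (hg h hh) rfl, fun hs hs0 hslim => ?_⟩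
  · obtain ⟨F, hFiff, -⟩ := B.riemann_cases hφ (B.evolve_inBox (hF h hh).1 _ n)
      (B.evolve_represents hφ (hF h hh).1 hh hlam0 (hg h hh) n) hm (Frame.even_evolve_m rfl _ n)
    exact Material.existsUnique_of_iff hFiff
  · refine exists_subseq_front_tendsto (V := fun h n => (G h n).speed M V0)
      (m := fun h n => (G h n).m) (B := K) hlam0 ha (fun h hh n => ?_)
      (fun h hh N => hK _ (hF h hh).1 (hF h hh).2.1 (hF h hh).2.2.1 (hF h hh).2.2.2 _ N)
      (fun h _ => rfl) (fun h _ n => rfl) (fun h _ t => rfl) (fun h _ t => rfl) hs0 hslim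
    obtain ⟨h1, h2⟩ := B.speed_mem_Ioo (B.evolve_inBox (hF h hh).1 (fun n => lam * a n) n)
    exact abs_lt.2 ⟨by linarith, by linarith⟩
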